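/- **Setting.** For $N\ge 1$ take the square lattice with $N\times N$ plaquettes and open boundary, with one spin of dimension $d=c+2$ on every edge and local space $\mathbb C^d=\mathbb C^2\oplus\mathbb C^c$ (Toric Code levels and $c$ classical colours). For $J>0$ let $$H_{\rm TC}=J\sum_s(1-A_s)+J\sum_p(1-B_p),\qquad A_s=\prod_{i\in s}\sigma^x_i,\quad B_p=\prod_{i\in p}\sigma^z_i,$$ be the Toric Code on the qubit spaces $\mathbb C^2$, where $p$ runs over the plaquettes and $s$ over the stars of the vertices with three or four incident edges. On $\bigotimes\mathbb C^d$ consider $$H^{(d)}_N=\tilde H_{\rm TC}+H_{\rm cl}+C\sum_{i\sim j}\big(\mathbb 1_{\rm tc}^i\otimes\mathbb 1_{\rm cl}^j+\mathbb 1_{\rm cl}^i\otimes\mathbb 1_{\rm tc}^j\big),$$ where $\tilde H_{\rm TC}$ is $H_{\rm TC}$ with $1$, $\sigma^x$, $\sigma^z$ extended by $0$ to $\mathbb C^d$ (each term acting on the spins of its own star or plaquette), $i\sim j$ means that two edges share a vertex, $\mathbb 1_{\rm tc},\mathbb 1_{\rm cl}$ are the projections onto $\mathbb C^2$ and $\mathbb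 C^c$, and $H_{\rm cl}$ is a translationally invariant interaction that is diagonal in the canonical basis: each plaquette contributes an energy depending on the four classical colours around it (and $0$ if one of them is not classical), and each nonempty pattern of prescribed classical colours on some of the (at most four) legs of a vertex contributes an energy wherever it occurs entirely inside the lattice. These energies do not depend on the position or on $N$, and they are half-integers (elements of $\frac12\mathbb Z$) of absolute value at most $8$. Call $n\ge1$ a *transition threshold* in dimension $d$ if some such $H_{\rm cl}$ satisfies, for all $J>0$ and $N\ge1$: * if $N\le n$, the ground state of $H^{(d)}_N$ is non-degenerate and is a product vector of the canonical basis with only classical colours, and all other eigenvalues are larger by at least $1/2$; * if $N>n$, the low-energy space is that of the Toric Code: for every $\mu<1/2$ the eigenspace of $H^{(d)}_N$ for $\mu$ is the image of the eigenspace of $H_{\rm TC}$ for $\mu$ under the inclusion $\bigotimes\mathbb C^2\subseteq\bigotimes\mathbb C^d$; moreover the ground state energy is $0$ and all other eigenvalues are at least $\min(2J,1/2)$. Let $S(q)$ be the Busy Beaver number: the largest number of steps after which a Turing machine with $q$ states and two symbols halts, when started on a blank two-way infinite tape (the step into the halting state counts; $S(0)=0$). **Theorem.** There is a constant $C>0$,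 independent of $d$, such that: 1. for every $d>3$ there are transition thresholds in dimension $d$, and there is a largest one, $N_d$; 2. $2$, $15$, $84$ and $420$ are transition thresholds in dimensions $4$, $6$, $7$ and $8$, respectively (so $N_4\ge2$, $N_6\ge15$, $N_7\ge84$, $N_8\ge420$); 3. $N_{q+4}\ge S(q)/\sqrt2$ for every $q\ge0$; moreover $N_9\ge 3.3\cdot10^7$ and $N_{10}\ge5.2\cdot10^{36534}$; 4. $N_d$ grows faster than any computable function: for every computable $f:\mathbb N\to\mathbb N$ one has $f(d)<N_d$ for all sufficiently large $d$. -/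

import Mathlib

namespace SizeDriven

/-! ### The lattice: `N × N` plaquettes, open boundary, one spin on every edge -/

/-- The four compass directions. -/
inductive Dir
  | north | east | south | west
  deriving DecidableEq

instance : Fintype Dir := ⟨{.north, .east, .south, .west}, by intro a; cases a <;> simp⟩

/-- Vertices of the lattice with `N × N` plaquettes: pairs (column, row). -/
abbrev Vertex (N : ℕ) : Type := Fin (N + 1) × Fin (N + 1)

/-- Plaquettes (tiles), given by their lower left vertex: pairs (column, row). -/
abbrev Plaquette (N : ℕ) : Type := Fin N × Fin N

/-- Edges. `Sum.inl (i, j)` is the horizontal edge between the vertices `(i, j)` and `(i + 1, j)`,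
`Sum.inr (i, j)` is the vertical edge between `(i, j)` and `(i, j + 1)`. -/
abbrev Edge (N : ℕ) : Type := (Fin N × Fin (N + 1)) ⊕ (Fin (N + 1) × Fin N)

/-- The four edges around a plaquette. -/
def side {N : ℕ} (p : Plaquette N) : Dir → Edge N
  | .north => Sum.inl (p.1, p.2.succ)
  | .east => Sum.inr (p.1.succ, p.2)
  | .south => Sum.inl (p.1, p.2.castSucc)
  | .west => Sum.inr (p.1.castSucc, p.2)

/-- The edge that leaves a vertex in a given direction, if the lattice has one there. -/
def leg {N : ℕ} (v : Vertex N) : Dir → Option (Edge N)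
  | .north => if h : v.2.1 < N then some (Sum.inr (v.1, ⟨v.2.1, h⟩)) else none
  | .east => if h : v.1.1 < N then some (Sum.inl (⟨v.1.1, h⟩, v.2)) else none
  | .south => if h : 0 < v.2.1 then
      some (Sum.inr (v.1, ⟨v.2.1 - 1, by have := v.2.2; omega⟩)) else none
  | .west => if h : 0 < v.1.1 then
      some (Sum.inl (⟨v.1.1 - 1, by have := v.1.2; omega⟩, v.2)) else none

/-- The star of a vertex: the edges incident to it (four in the bulk, three on the sides of the
lattice, two at its corners). -/
def starEdges {N : ℕ} (v : Vertex N) : Finset (Edge N) :=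
  Finset.univ.filter fun e => ∃ a, leg v a = some e

/-- The boundary of a plaquette as a set of edges. -/
def plaquetteEdges {N : ℕ} (p : Plaquette N) : Finset (Edge N) :=
  Finset.univ.filter fun e => ∃ a, side p a = e

/-- Two different spins are adjacent if their edges have a common end point. -/
def Adjacent {N : ℕ} (e e' : Edge N) : Prop :=
  e ≠ e' ∧ ∃ v : Vertex N, e ∈ starEdges v ∧ e' ∈ starEdges v

/-! ### Operators on a tensor product over the edges

With a local orthonormal basis labelled by `X`, the space `⊗_e ℂ^X` is `(Edge N → X) → ℂ`,
and operators are matrices indexed by `Edge N → X`. -/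

/-- The tensor product `⊗_e A_e` of one local matrix for every edge. -/
noncomputable def tensorOp {N : ℕ} {X Y : Type} (A : Edge N → Matrix X Y ℂ) :
    Matrix (Edge N → X) (Edge N → Y) ℂ :=
  Matrix.of fun σ τ => ∏ e, A e (σ e) (τ e)

/-- The operator `∏_{e ∈ s} A_e`, where `A_e` is `A` acting on the spin at `e`. -/
noncomputable def localProd {N : ℕ} {X : Type} [DecidableEq X] (s : Finset (Edge N))
    (A : Matrix X X ℂ) : Matrix (Edge N → X) (Edge N → X) ℂ :=
  tensorOp fun e => if e ∈ s then A else 1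

/-! ### The Toric Code -/

/-- The Pauli matrix `σ^x`. -/
def pauliX : Matrix (Fin 2) (Fin 2) ℂ := !![0, 1; 1, 0]

/-- The Pauli matrix `σ^z`. -/
def pauliZ : Matrix (Fin 2) (Fin 2) ℂ := !![1, 0; 0, -1]

/-- `∑_s (∏_{i ∈ s} P_i - ∏_{i ∈ s} A_i) + ∑_p (∏_{i ∈ p} P_i - ∏_{i ∈ p} B_i)`, where `s` runs over
the 3- and 4-local stars and `p` over the plaquettes. -/
noncomputable def stabilizerSum (N : ℕ) {X : Type} [DecidableEq X] (P A B : Matrix X X ℂ) :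
    Matrix (Edge N → X) (Edge N → X) ℂ :=
  (∑ v ∈ Finset.univ.filter (fun v : Vertex N => 3 ≤ (starEdges v).card),
      (localProd (starEdges v) P - localProd (starEdges v) A)) +
    ∑ p : Plaquette N, (localProd (plaquetteEdges p) P - localProd (plaquetteEdges p) B)

/-- The Toric Code Hamiltonian `J ∑_s (1 - A_s) + J ∑_p (1 - B_p)` on qubits. -/
noncomputable def toricCode (N : ℕ) (J : ℝ) : Matrix (Edge N → Fin 2) (Edge N → Fin 2) ℂ :=
  (J : ℂ) • stabilizerSum N 1 pauliX pauliZ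

/-! ### The combined model with local space `ℂ² ⊕ ℂ^c` -/

/-- Basis labels of the local space `ℂ² ⊕ ℂ^c`: Toric Code levels and classical colours. -/
abbrev Spin (c : ℕ) : Type := Fin 2 ⊕ Fin c

/-- A local operator on `ℂ²`, extended by `0` to `ℂ² ⊕ ℂ^c`. -/
def extend (c : ℕ) (A : Matrix (Fin 2) (Fin 2) ℂ) : Matrix (Spin c) (Spin c) ℂ :=
  Matrix.fromBlocks A 0 0 0

/-- The isometry `⊗ ℂ² → ⊗ (ℂ² ⊕ ℂ^c)` that comes from the local inclusions `ℂ² ⊆ ℂ² ⊕ ℂ^c`. -/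
noncomputable def inclusion (N c : ℕ) : Matrix (Edge N → Spin c) (Edge N → Fin 2) ℂ :=
  tensorOp fun _ => Matrix.of fun x k => if x = Sum.inl k then 1 else 0

/-- Coupling constants of a translationally invariant classical interaction on `c` colours.
`plaq w` is the energy of the tile `w`. `star t` is the energy of the pattern `t` around a vertex,
where `t a = none` means that the pattern does not involve the leg in direction `a`.
Neither depends on the position in the lattice. -/
structure Couplings (c : ℕ) where
  plaq : (Dir → Fin c) → ℝ
  star : (Dir → Option (Fin c)) → ℝ

/-- All couplings are half-integers of absolute value at most `8`, and the empty pattern does not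
contribute (so that the interaction acts on classical colours only). -/
def Couplings.Admissible {c : ℕ} (W : Couplings c) : Prop :=
  (∀ w, ∃ k : ℤ, |k| ≤ 16 ∧ W.plaq w = k / 2) ∧
  (∀ t, ∃ k : ℤ, |k| ≤ 16 ∧ W.star t = k / 2) ∧
  W.star (fun _ => none) = 0

/-- The four spins around `p` carry the colours of the tile `w`. -/
def TileAt {N c : ℕ} (w : Dir → Fin c) (σ : Edge N → Spin c) (p : Plaquette N) : Prop :=
  ∀ a, σ (side p a) = Sum.inr (w a)

/-- All the legs that the pattern `t` involves are present at `v` and carry the colours of `t`.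
On the lattice boundary only the patterns that are entirely inside the lattice occur. -/
def PatternAt {N c : ℕ} (t : Dir → Option (Fin c)) (σ : Edge N → Spin c) (v : Vertex N) : Prop :=
  ∀ a k, t a = some k → ∃ e, leg v a = some e ∧ σ e = Sum.inr k

open Classical in
/-- The energy of a basis configuration under the classical interaction: the sum over all plaquettes
and vertices of the tile and star energies. -/
noncomputable def classicalEnergy {N c : ℕ} (W : Couplings c) (σ : Edge N → Spin c) : ℝ :=
  (∑ p : Plaquette N, ∑ w : Dir → Fin c, if TileAt w σ p then W.plaq w else 0) +
    ∑ v : Vertex N, ∑ t : Dir → Option (Fin c), if PatternAt t σ v then W.star t else 0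

open Classical in
/-- The number of adjacent pairs of spins of which one is in the Toric Code sector and the other in
the classical sector, that is, the eigenvalue of
`∑_{i ∼ j} (𝟙_tc ⊗ 𝟙_cl + 𝟙_cl ⊗ 𝟙_tc)` at a basis configuration. -/
noncomputable def mismatches {N c : ℕ} (σ : Edge N → Spin c) : ℕ :=
  (Finset.univ.filter fun x : Edge N × Edge N =>
    Adjacent x.1 x.2 ∧ (σ x.1).isLeft ∧ (σ x.2).isRight).card

/-- The Hamiltonian `H_tc + H_cl + H'` on `⊗ (ℂ² ⊕ ℂ^c)`: the Toric Code on the Toric Code sector,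
the classical interaction, and the penalty `C` for adjacent spins in different sectors. -/
noncomputable def hamiltonian (N : ℕ) {c : ℕ} (J C : ℝ) (W : Couplings c) :
    Matrix (Edge N → Spin c) (Edge N → Spin c) ℂ :=
  (J : ℂ) • stabilizerSum N (extend c 1) (extend c pauliX) (extend c pauliZ) +
    Matrix.diagonal (fun σ => ((classicalEnergy W σ : ℝ) : ℂ)) +
    Matrix.diagonal (fun σ => ((C * (mismatches σ : ℝ) : ℝ) : ℂ))

theorem localProd_isHermitian {N : ℕ} {X : Type} [DecidableEq X] (s : Finset (Edge N))
    {A : Matrix X X ℂ} (hA : A.IsHermitian) : (localProd s A).IsHermitian := by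
  refine Matrix.IsHermitian.ext fun σ τ => ?_
  simp only [localProd, tensorOp, Matrix.of_apply, star_prod]
  refine Finset.prod_congr rfl fun e _ => ?_
  split_ifs
  · exact hA.apply _ _
  · exact Matrix.isHermitian_one.apply _ _

theorem stabilizerSum_isHermitian (N : ℕ) {X : Type} [DecidableEq X] {P A B : Matrix X X ℂ}
    (hP : P.IsHermitian) (hA : A.IsHermitian) (hB : B.IsHermitian) :
    (stabilizerSum N P A B).IsHermitian := by
  have key : ∀ {ι : Type} (s : Finset ι) (f : ι → Matrix (Edge N → X) (Edge N → X) ℂ),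
      (∀ i, (f i).IsHermitian) → (∑ i ∈ s, f i).IsHermitian := by
    intro ι s f hf
    unfold Matrix.IsHermitian
    rw [Matrix.conjTranspose_sum]
    exact Finset.sum_congr rfl fun i _ => hf i
  exact (key _ _ fun v => (localProd_isHermitian _ hP).sub (localProd_isHermitian _ hA)).add
    (key _ _ fun p => (localProd_isHermitian _ hP).sub (localProd_isHermitian _ hB))

/-- The Hamiltonian is Hermitian, so that its real eigenvalues are its whole spectrum. -/
theorem hamiltonian_isHermitian (N : ℕ) {c : ℕ} (J C : ℝ) (W : Couplings c) :
    (hamiltonian N J C W).IsHermitian := by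
  have hext : ∀ A : Matrix (Fin 2) (Fin 2) ℂ, A.IsHermitian → (extend c A).IsHermitian := by
    intro A hA
    exact Matrix.IsHermitian.fromBlocks hA (by simp) Matrix.isHermitian_zero
  have hX : pauliX.IsHermitian := by
    ext i j; fin_cases i <;> fin_cases j <;> simp [pauliX]
  have hZ : pauliZ.IsHermitian := by
    ext i j; fin_cases i <;> fin_cases j <;> simp [pauliZ]
  have hsmul : ((J : ℂ) • stabilizerSum N (extend c 1) (extend c pauliX)
      (extend c pauliZ)).IsHermitian := by
    unfold Matrix.IsHermitian
    rw [Matrix.conjTranspose_smul, (stabilizerSum_isHermitian N (hext _ Matrix.isHermitian_one)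
      (hext _ hX) (hext _ hZ)).eq]
    simp
  refine (hsmul.add ?_).add ?_
  · refine Matrix.isHermitian_diagonal_of_self_adjoint _ ?_
    ext σ; simp
  · refine Matrix.isHermitian_diagonal_of_self_adjoint _ ?_
    ext σ; simp

/-! ### The two regimes and the threshold -/

/-- The ground state of `H` is non-degenerate and is a product basis state of classical colours,
and there is a spectral gap of at least `1/2` above it. -/
def ClassicalRegime {N c : ℕ} (H : Matrix (Edge N → Spin c) (Edge N → Spin c) ℂ) : Prop :=
  ∃ (E : ℝ) (ω : Edge N → Fin c),
    Module.End.eigenspace (Matrix.toLin' H) (E : ℂ) =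
      Submodule.span ℂ {Pi.single (fun e => (Sum.inr (ω e) : Spin c)) (1 : ℂ)} ∧
    ∀ μ : ℝ, Module.End.HasEigenvalue (Matrix.toLin' H) (μ : ℂ) → μ = E ∨ E + 1 / 2 ≤ μ

/-- Below energy `1/2` the eigenvalues and eigenspaces of `H` are exactly those of the Toric Code;
the ground state energy is `0`, with a spectral gap of at least `min (2 J) (1/2)` above it. -/
def ToricRegime {N c : ℕ} (J : ℝ) (H : Matrix (Edge N → Spin c) (Edge N → Spin c) ℂ) : Prop :=
  (∀ μ : ℝ, μ < 1 / 2 →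
    Module.End.eigenspace (Matrix.toLin' H) (μ : ℂ) =
      (Module.End.eigenspace (Matrix.toLin' (toricCode N J)) (μ : ℂ)).map
        (Matrix.toLin' (inclusion N c))) ∧
  Module.End.HasEigenvalue (Matrix.toLin' H) 0 ∧
  ∀ μ : ℝ, Module.End.HasEigenvalue (Matrix.toLin' H) (μ : ℂ) → μ = 0 ∨ min (2 * J) (1 / 2) ≤ μ

/-- `n` is the transition threshold of the model with local dimension `c + 2` given by `C`, `W`,
for every strength `J > 0` of the Toric Code. -/
def HasTransitionAt {c : ℕ} (C : ℝ) (W : Couplings c) (n : ℕ) : Prop :=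
  1 ≤ n ∧ ∀ J : ℝ, 0 < J → ∀ N : ℕ, 1 ≤ N →
    (N ≤ n → ClassicalRegime (hamiltonian N J C W)) ∧
    (n < N → ToricRegime J (hamiltonian N J C W))

/-- Some model with local dimension `d` has transition threshold `n`. -/
def IsThreshold (C : ℝ) (d n : ℕ) : Prop :=
  ∃ W : Couplings (d - 2), W.Admissible ∧ HasTransitionAt C W n

/-! ### Busy Beavers -/

/-- Head moves. -/
inductive Move
  | left | right

/-- A Turing machine with `q` states and tape symbols `false` (blank) and `true`: in a given state,
reading a given symbol, it writes a symbol, moves, and goes to a state or halts (`none`). -/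
abbrev Machine (q : ℕ) : Type := Fin q → Bool → Bool × Move × Option (Fin q)

/-- Configurations of a machine on a two-way infinite tape; `state = none` means halted. -/
structure Config (q : ℕ) where
  state : Option (Fin q)
  tape : ℤ → Bool
  head : ℤ

/-- State `0` (if there is a state), blank tape. -/
def Config.init (q : ℕ) : Config q where
  state := if h : 0 < q then some ⟨0, h⟩ else none
  tape := fun _ => false
  head := 0

/-- One step of a machine; a halted machine stays as it is. -/
def Machine.step {q : ℕ} (M : Machine q) (x : Config q) : Config q :=
  match x.state with
  | none => x
  | some s =>
    { state := (M s (x.tape x.head)).2.2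
      tape := Function.update x.tape x.head (M s (x.tape x.head)).1
      head := match (M s (x.tape x.head)).2.1 with
        | .left => x.head - 1
        | .right => x.head + 1 }

/-- Started on the blank tape, the machine halts after exactly `t` steps. -/
def Machine.HaltsAfter {q : ℕ} (M : Machine q) (t : ℕ) : Prop :=
  (M.step^[t] (Config.init q)).state = none ∧
    ∀ t' < t, (M.step^[t'] (Config.init q)).state ≠ none

/-- The Busy Beaver number `S(q)`: the largest number of steps after which a machine with `q` states
and two symbols halts on the blank tape. -/
noncomputable def busyBeaver (q : ℕ) : ℕ :=
  sSup {t | ∃ M : Machine q, M.HaltsAfter t}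

end SizeDriven

/-! The classical interaction encodes a deterministic rule: at every vertex the colours of the west
and south legs, or their absence, prescribe the colours of the north and east legs. From the lower
left corner on, the rule fills the lattice in at most one way. If it gets stuck somewhere, there is
a last size that it survives, and that size is the transition threshold (`isThreshold_of_survives`).

Energetics: the lower left corner yields -1/2 if it obeys the rule and +1/2 if not; a violation at
any other vertex costs 1. So the unique tiling has energy -1/2, any other purely classical
configuration at least 1/2, and a pure Toric Code configuration has diagonal energy 0. In mixed
configurations a vertex in the interior can pose as a corner, but then it owns a mismatched pair,
whose penalty `C = 2` outweighs the bonus (`card_corners_le`, `one_half_le_energy_of_mixed`). Möbius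
inversion over sets of legs turns these vertex energies into admissible star couplings.

Spectrum: the stabilizer part is positive semidefinite and links only configurations with the same
classical spins, on which the diagonal part is constant. Hence an eigenvector vanishes wherever the
diagonal energy exceeds its eigenvalue (`eigenvector_apply_eq_zero`), and both regimes follow from
diagonal estimates alone. The Toric Code gap `2 J` comes from commuting projections. A largest
threshold exists because there are finitely many admissible couplings and each has at most one
threshold.

Lower bounds come from three rules: a base `c` counter (`counterRule_evolve`), a binary counter
whose number of digits is the period of another counter (`doubleCounterRule_evolve`), and the
space-time diagram of a Turing machine drawn along the diagonals with only `q + 2` colours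
(`Machine.HaltsAfter.exists_isThreshold`). The last gives `S(q) ≤ N_{q+4}`. The growth statement
then reduces to the Busy Beaver function dominating computable functions, for which partial
recursive codes are compiled through stack and Post machines into two-symbol machines with linearly
many states in the input (`exists_length_trNat_le`). -/

open scoped Matrix ComplexOrder

namespace SizeDriven

/-! ### Spectral estimates for frustration-free sums -/

section Spectral

variable {ι : Type*} [Fintype ι]

/-- A sum of a positive semidefinite matrix and a potential that is constant on its blocks has no
eigenvectors below the potential. -/
theorem eigenvector_apply_eq_zero [DecidableEq ι] {S : Matrix ι ι ℂ} (hS : S.PosSemidef) {D : ι → ℝ}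
    (hD : ∀ σ τ, S σ τ ≠ 0 → D σ = D τ) {J : ℝ} (hJ : 0 ≤ J) {μ : ℝ} {ψ : ι → ℂ}
    (h : ((J : ℂ) • S + Matrix.diagonal fun σ => (D σ : ℂ)) *ᵥ ψ = (μ : ℂ) • ψ) {σ : ι}
    (hσ : μ < D σ) : ψ σ = 0 := by
  -- Truncate `ψ` to the region where the potential exceeds `μ`. As `S` never links different values
  -- of `D`, on this region `S ψ'` agrees with `S ψ`. So `J ⟨ψ', S ψ'⟩`, which is nonnegative,
  -- equals `∑ (μ - D) |ψ'|²`, whose terms are nonpositive.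
  set ψ' : ι → ℂ := fun σ => if μ < D σ then ψ σ else 0 with hψ'
  have hblock : ∀ σ, μ < D σ → (S *ᵥ ψ') σ = (S *ᵥ ψ) σ := by
    intro σ hσ
    refine Finset.sum_congr rfl fun τ _ => ?_
    by_cases h0 : S σ τ = 0
    · simp [h0]
    · simp [hψ', ← hD σ τ h0, hσ]
  have heq : ∀ σ, (J : ℂ) * (S *ᵥ ψ) σ = ((μ - D σ : ℝ) : ℂ) * ψ σ := by
    intro σ
    have := congrFun h σ
    simp only [Matrix.add_mulVec, Matrix.smul_mulVec, Matrix.mulVec_diagonal, Pi.add_apply,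
      Pi.smul_apply, smul_eq_mul] at this
    push_cast
    linear_combination this
  have hnn : 0 ≤ (J : ℂ) * (star ψ' ⬝ᵥ (S *ᵥ ψ')) :=
    mul_nonneg (by exact_mod_cast hJ) (hS.dotProduct_mulVec_nonneg ψ')
  have hsum : (J : ℂ) * (star ψ' ⬝ᵥ (S *ᵥ ψ')) =
      ((∑ σ, (μ - D σ) * ‖ψ' σ‖ ^ 2 : ℝ) : ℂ) := by
    rw [dotProduct, Finset.mul_sum]
    push_cast
    refine Finset.sum_congr rfl fun σ _ => ?_
    by_cases hσ : μ < D σ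
    · have h1 : ψ' σ = ψ σ := by simp [hψ', hσ]
      have h2 := heq σ
      rw [hblock σ hσ, Pi.star_apply, h1, mul_left_comm, h2]
      have h3 : star (ψ σ) * ψ σ = (‖ψ σ‖ : ℂ) ^ 2 := Complex.conj_mul' _
      push_cast
      rw [← h3]
      ring
    · have h1 : ψ' σ = 0 := by simp [hψ', hσ]
      simp [h1]
  rw [hsum, Complex.zero_le_real] at hnn
  have hle : ∀ σ ∈ Finset.univ, (μ - D σ) * ‖ψ' σ‖ ^ 2 ≤ 0 := by
    intro σ _
    by_cases hσ : μ < D σ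
    · exact mul_nonpos_of_nonpos_of_nonneg (by linarith) (by positivity)
    · simp [hψ', hσ]
  have hz := (Finset.sum_eq_zero_iff_of_nonpos hle).1
    (le_antisymm (Finset.sum_nonpos hle) hnn) σ (Finset.mem_univ σ)
  have h1 : ψ' σ = ψ σ := by simp [hψ', hσ]
  rw [h1] at hz
  rcases mul_eq_zero.1 hz with h2 | h2
  · linarith
  · simpa using h2

/-- Half of each `T k` is an orthogonal projection and these projections commute. -/
structure CommutingProjections {κ : Type*} (T : κ → Matrix ι ι ℂ) : Prop where
  isHermitian : ∀ k, (T k).IsHermitian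
  mul_self : ∀ k, T k * T k = (2 : ℂ) • T k
  comm : ∀ k l, T k * T l = T l * T k

theorem posSemidef_of_mul_self {T : Matrix ι ι ℂ} (hT : T.IsHermitian) {r : ℝ} (hr : 0 < r)
    (h : T * T = (r : ℂ) • T) : T.PosSemidef := by
  have h1 : T = ((r⁻¹ : ℝ) : ℂ) • (Tᴴ * T) := by
    rw [hT.eq, h, smul_smul]
    push_cast
    rw [inv_mul_cancel₀ (by exact_mod_cast hr.ne'), one_smul]
  rw [h1]
  exact (Matrix.posSemidef_conjTranspose_mul_self T).smul
    (by rw [Complex.zero_le_real]; positivity)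

theorem CommutingProjections.posSemidef {κ : Type*} {T : κ → Matrix ι ι ℂ}
    (hT : CommutingProjections T) (k : κ) : (T k).PosSemidef :=
  posSemidef_of_mul_self (hT.isHermitian k) two_pos (by exact_mod_cast hT.mul_self k)

/-- The nonzero eigenvalues of a sum of commuting doubled projections are at least `2`. -/
theorem CommutingProjections.eigenvalue {κ : Type*} [Fintype κ] [DecidableEq κ]
    {T : κ → Matrix ι ι ℂ} (hT : CommutingProjections T) {μ : ℝ} {ψ : ι → ℂ} (hψ : ψ ≠ 0)
    (h : (∑ k, T k) *ᵥ ψ = (μ : ℂ) • ψ) : μ = 0 ∨ 2 ≤ μ := by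
  have hpos : ∀ A : Matrix ι ι ℂ, A.PosSemidef → ∀ x : ℝ, A *ᵥ ψ = (x : ℂ) • ψ → 0 ≤ x := by
    intro A hA x hx
    have h1 := hA.dotProduct_mulVec_nonneg ψ
    rw [hx, dotProduct_smul, smul_eq_mul] at h1
    have h2 : 0 < star ψ ⬝ᵥ ψ := Matrix.dotProduct_star_self_pos_iff.2 hψ
    have h3 : 0 ≤ (x : ℂ) := by
      by_contra hneg
      have h4 : (x : ℂ) < 0 := by
        rw [Complex.zero_le_real] at hneg
        exact_mod_cast not_le.1 hneg
      exact absurd (h1.trans_lt (mul_neg_of_neg_of_pos h4 h2)) (lt_irrefl _)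
    exact Complex.zero_le_real.1 h3
  have h0 : 0 ≤ μ := hpos _ (Matrix.posSemidef_sum _ fun k _ => hT.posSemidef k) μ h
  -- By `T k * T k = 2 T k` the diagonal terms of the square cancel. What remains are products of
  -- two different commuting terms, which are positive. Applied to `ψ` this says `μ² ≥ 2 μ`.
  have hsq : ((∑ k, T k) * (∑ k, T k) - (2 : ℂ) • ∑ k, T k).PosSemidef := by
    have hexp : (∑ k, T k) * (∑ k, T k) - (2 : ℂ) • ∑ k, T k =
        ∑ k, ∑ l, if k = l then 0 else T k * T l := by
      rw [Finset.sum_mul_sum, Finset.smul_sum, ← Finset.sum_sub_distrib]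
      refine Finset.sum_congr rfl fun k _ => ?_
      rw [← Finset.add_sum_erase _ _ (Finset.mem_univ k), hT.mul_self, add_sub_cancel_left,
        ← Finset.add_sum_erase _ (fun l => if k = l then 0 else T k * T l) (Finset.mem_univ k),
        if_pos rfl, zero_add]
      refine Finset.sum_congr rfl fun l hl => ?_
      rw [if_neg (Finset.ne_of_mem_erase hl).symm]
    rw [hexp]
    refine Matrix.posSemidef_sum _ fun k _ => Matrix.posSemidef_sum _ fun l _ => ?_
    split_ifs
    · exact Matrix.PosSemidef.zero
    · refine posSemidef_of_mul_self (r := 4) ?_ (by norm_num) ?_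
      · unfold Matrix.IsHermitian
        rw [Matrix.conjTranspose_mul, (hT.isHermitian k).eq, (hT.isHermitian l).eq, hT.comm]
      · calc T k * T l * (T k * T l) = T k * (T l * T k) * T l := by
              simp only [Matrix.mul_assoc]
          _ = T k * T k * (T l * T l) := by rw [hT.comm l k]; simp only [Matrix.mul_assoc]
          _ = ((4 : ℝ) : ℂ) • (T k * T l) := by
              rw [hT.mul_self, hT.mul_self, Matrix.smul_mul, Matrix.mul_smul, smul_smul]
              norm_num
  have h1 := hpos _ hsq (μ * μ - 2 * μ) (by
    rw [Matrix.sub_mulVec, Matrix.smul_mulVec, ← Matrix.mulVec_mulVec, h, Matrix.mulVec_smul, h,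
      smul_smul, smul_smul, ← sub_smul]
    push_cast
    rfl)
  by_contra hcon
  push Not at hcon
  have : 0 < μ := lt_of_le_of_ne h0 (Ne.symm hcon.1)
  nlinarith

end Spectral

/-! ### Tensor products of local matrices -/

section Tensor

variable {N : ℕ}

theorem tensorOp_mul {X Y Z : Type} [Fintype Y] [DecidableEq Y] (A : Edge N → Matrix X Y ℂ)
    (B : Edge N → Matrix Y Z ℂ) :
    tensorOp A * tensorOp B = tensorOp fun e => A e * B e := by
  ext σ τ
  simp only [tensorOp, Matrix.mul_apply, Matrix.of_apply]
  rw [Finset.prod_univ_sum, Fintype.piFinset_univ]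
  exact Finset.sum_congr rfl fun ρ _ => Finset.prod_mul_distrib.symm

variable {X : Type} [DecidableEq X]

theorem localProd_mul [Fintype X] (s : Finset (Edge N)) (A B : Matrix X X ℂ) :
    localProd s A * localProd s B = localProd s (A * B) := by
  rw [localProd, localProd, tensorOp_mul, localProd]
  congr 1
  ext1 e
  split_ifs <;> simp

/-- Every edge common to `s` and `t` contributes a sign `-1`, and there is an even number of them.
-/
theorem localProd_mul_comm [Fintype X] (s t : Finset (Edge N)) {A B : Matrix X X ℂ}
    (hAB : A * B = -(B * A)) (hst : Even (s ∩ t).card) :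
    localProd s A * localProd t B = localProd t B * localProd s A := by
  rw [localProd, localProd, tensorOp_mul, tensorOp_mul]
  ext σ τ
  simp only [tensorOp, Matrix.of_apply]
  have hfac : ∀ e, ((if e ∈ s then A else 1) * (if e ∈ t then B else 1)) (σ e) (τ e) =
      (if e ∈ s ∩ t then -1 else 1) *
        ((if e ∈ t then B else 1) * (if e ∈ s then A else 1)) (σ e) (τ e) := by
    intro e
    by_cases h1 : e ∈ s <;> by_cases h2 : e ∈ t <;> simp [h1, h2, hAB]
  rw [Finset.prod_congr rfl fun e _ => hfac e, Finset.prod_mul_distrib]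
  have hone : ∏ e, (if e ∈ s ∩ t then (-1 : ℂ) else 1) = 1 := by
    rw [Finset.prod_ite_mem, Finset.univ_inter, Finset.prod_const, hst.neg_one_pow]
  rw [hone, one_mul]

theorem localProd_mul_comm_of_commute [Fintype X] (s t : Finset (Edge N)) {A B : Matrix X X ℂ}
    (hAB : A * B = B * A) :
    localProd s A * localProd t B = localProd t B * localProd s A := by
  rw [localProd, localProd, tensorOp_mul, tensorOp_mul]
  congr 1
  ext1 e
  split_ifs <;> simp [hAB]

theorem localProd_one [Fintype X] (s : Finset (Edge N)) :
    localProd s (1 : Matrix X X ℂ) = 1 := by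
  ext σ τ
  simp only [localProd, tensorOp, ite_self, Matrix.of_apply, Matrix.one_apply]
  rw [Finset.prod_boole]
  simp [funext_iff]

theorem localProd_apply_ne_zero {s : Finset (Edge N)} {A : Matrix X X ℂ} {σ τ : Edge N → X}
    (h : localProd s A σ τ ≠ 0) (e : Edge N) :
    (e ∈ s → A (σ e) (τ e) ≠ 0) ∧ (e ∉ s → σ e = τ e) := by
  have := Finset.prod_ne_zero_iff.1 h e (Finset.mem_univ e)
  constructor
  · intro he
    simpa [he] using this
  · intro he
    by_contra hne
    simp [he, hne] at this

/-- The relations among a projection `P` and two anticommuting reflections `A`, `B` on its range. -/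
structure LocalAlgebra (P A B : Matrix X X ℂ) [Fintype X] : Prop where
  isHermitian : P.IsHermitian
  isHermitian_left : A.IsHermitian
  isHermitian_right : B.IsHermitian
  mul_self : P * P = P
  left_mul : P * A = A
  mul_left : A * P = A
  right_mul : P * B = B
  mul_right : B * P = B
  left_sq : A * A = P
  right_sq : B * B = P

theorem localProd_sub_mul_self [Fintype X] (s : Finset (Edge N)) {P A : Matrix X X ℂ}
    (hP : P * P = P) (h1 : P * A = A) (h2 : A * P = A) (h3 : A * A = P) :
    (localProd s P - localProd s A) * (localProd s P - localProd s A) =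
      (2 : ℂ) • (localProd s P - localProd s A) := by
  rw [sub_mul, mul_sub, mul_sub, localProd_mul, localProd_mul, localProd_mul, localProd_mul, hP,
    h1, h2, h3, two_smul]
  abel

/-- Every term separately is twice an orthogonal projection. -/
theorem stabilizerSum_posSemidef [Fintype X] {P A B : Matrix X X ℂ} (h : LocalAlgebra P A B) :
    (stabilizerSum N P A B).PosSemidef := by
  refine (Matrix.posSemidef_sum _ fun v _ => ?_).add (Matrix.posSemidef_sum _ fun p _ => ?_)
  · exact posSemidef_of_mul_self
      ((localProd_isHermitian _ h.isHermitian).sub (localProd_isHermitian _ h.isHermitian_left))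
      two_pos (by
        exact_mod_cast localProd_sub_mul_self _ h.mul_self h.left_mul h.mul_left h.left_sq)
  · exact posSemidef_of_mul_self
      ((localProd_isHermitian _ h.isHermitian).sub (localProd_isHermitian _ h.isHermitian_right))
      two_pos
      (by exact_mod_cast localProd_sub_mul_self _ h.mul_self h.right_mul h.mul_right h.right_sq)

end Tensor

/-! ### Pauli matrices and their extensions by zero -/

theorem pauliX_isHermitian : pauliX.IsHermitian := by
  ext i j; fin_cases i <;> fin_cases j <;> simp [pauliX]

theorem pauliZ_isHermitian : pauliZ.IsHermitian := by
  ext i j; fin_cases i <;> fin_cases j <;> simp [pauliZ]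

theorem pauliX_mul_self : pauliX * pauliX = 1 := by
  ext i j; fin_cases i <;> fin_cases j <;> simp [pauliX]

theorem pauliZ_mul_self : pauliZ * pauliZ = 1 := by
  ext i j; fin_cases i <;> fin_cases j <;> simp [pauliZ]

theorem pauliX_mul_pauliZ : pauliX * pauliZ = -(pauliZ * pauliX) := by
  ext i j; fin_cases i <;> fin_cases j <;> simp [pauliX, pauliZ]

theorem extend_mul (c : ℕ) (A B : Matrix (Fin 2) (Fin 2) ℂ) :
    extend c A * extend c B = extend c (A * B) := by
  simp [extend, Matrix.fromBlocks_multiply]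

theorem extend_isHermitian (c : ℕ) {A : Matrix (Fin 2) (Fin 2) ℂ} (hA : A.IsHermitian) :
    (extend c A).IsHermitian :=
  Matrix.IsHermitian.fromBlocks hA (by simp) Matrix.isHermitian_zero

theorem localAlgebra_extend (c : ℕ) :
    LocalAlgebra (extend c 1) (extend c pauliX) (extend c pauliZ) where
  isHermitian := extend_isHermitian c Matrix.isHermitian_one
  isHermitian_left := extend_isHermitian c pauliX_isHermitian
  isHermitian_right := extend_isHermitian c pauliZ_isHermitian
  mul_self := by rw [extend_mul, one_mul]
  left_mul := by rw [extend_mul, one_mul]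
  mul_left := by rw [extend_mul, mul_one]
  right_mul := by rw [extend_mul, one_mul]
  mul_right := by rw [extend_mul, mul_one]
  left_sq := by rw [extend_mul, pauliX_mul_self]
  right_sq := by rw [extend_mul, pauliZ_mul_self]

theorem extend_apply_ne_zero {c : ℕ} {A : Matrix (Fin 2) (Fin 2) ℂ} {x y : Spin c}
    (h : extend c A x y ≠ 0) : x.isLeft ∧ y.isLeft := by
  rcases x with x | x <;> rcases y with y | y <;> simp [extend] at h ⊢

/-! ### Incidence of edges, vertices and plaquettes -/

section Incidence

variable {N : ℕ}

/-- The lower or left end point of an edge. -/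
def source : Edge N → Vertex N
  | .inl (i, j) => (i.castSucc, j)
  | .inr (i, j) => (i, j.castSucc)

/-- The upper or right end point of an edge. -/
def target : Edge N → Vertex N
  | .inl (i, j) => (i.succ, j)
  | .inr (i, j) => (i, j.succ)

theorem source_ne_target (e : Edge N) : source e ≠ target e := by
  rcases e with ⟨i, j⟩ | ⟨i, j⟩ <;> simp [source, target, Prod.ext_iff, Fin.ext_iff]

theorem mem_starEdges {v : Vertex N} {e : Edge N} :
    e ∈ starEdges v ↔ v = source e ∨ v = target e := by
  obtain ⟨⟨x, hx⟩, ⟨y, hy⟩⟩ := v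
  simp only [starEdges, Finset.mem_filter, Finset.mem_univ, true_and]
  constructor
  · rintro ⟨a, ha⟩
    cases a <;> simp only [leg, Option.dite_none_right_eq_some, Option.some.injEq] at ha <;>
      obtain ⟨h, rfl⟩ := ha <;>
      simp [source, target] <;> omega
  · rcases e with ⟨⟨i, hi⟩, ⟨j, hj⟩⟩ | ⟨⟨i, hi⟩, ⟨j, hj⟩⟩
    · rintro (h | h)
      · simp only [source, Prod.ext_iff, Fin.ext_iff, Fin.val_castSucc] at h
        obtain ⟨rfl, rfl⟩ := h
        exact ⟨.east, by simp [leg, hi]⟩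
      · simp only [target, Prod.ext_iff, Fin.ext_iff, Fin.val_succ] at h
        obtain ⟨rfl, rfl⟩ := h
        exact ⟨.west, by simp [leg]⟩
    · rintro (h | h)
      · simp only [source, Prod.ext_iff, Fin.ext_iff, Fin.val_castSucc] at h
        obtain ⟨rfl, rfl⟩ := h
        exact ⟨.north, by simp [leg, hj]⟩
      · simp only [target, Prod.ext_iff, Fin.ext_iff, Fin.val_succ] at h
        obtain ⟨rfl, rfl⟩ := h
        exact ⟨.south, by simp [leg]⟩

theorem side_injective (p : Plaquette N) : Function.Injective (side p) := by
  intro a b h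
  cases a <;> cases b <;> simp [side, Fin.ext_iff] at h ⊢

theorem plaquetteEdges_eq_image (p : Plaquette N) :
    plaquetteEdges p = Finset.univ.image (side p) := by
  ext e; simp [plaquetteEdges]

theorem sum_dir {M : Type*} [AddCommMonoid M] (f : Dir → M) :
    ∑ a, f a = f .north + f .east + f .south + f .west := by
  have : (Finset.univ : Finset Dir) = {.north, .east, .south, .west} := rfl
  rw [this, Finset.sum_insert (by simp), Finset.sum_insert (by simp), Finset.sum_insert (by simp),
    Finset.sum_singleton]
  abel

/-- Each corner of the plaquette is an end point of exactly two of its sides. -/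
theorem sum_plaquetteEdges_coboundary (p : Plaquette N) (g : Vertex N → ZMod 2) :
    ∑ e ∈ plaquetteEdges p, (g (source e) + g (target e)) = 0 := by
  rw [plaquetteEdges_eq_image, Finset.sum_image fun a _ b _ h => side_injective p h, sum_dir]
  simp only [side, source, target]
  have : ∀ x : ZMod 2, x + x = 0 := by decide
  linear_combination this (g (p.1.castSucc, p.2.succ)) + this (g (p.1.succ, p.2.succ)) +
    this (g (p.1.succ, p.2.castSucc)) + this (g (p.1.castSucc, p.2.castSucc))

/-- Modulo 2 a star is the coboundary of the indicator function of its vertex. Both the commutation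
of stars with plaquettes and the star invariance of the ground state rest on this. -/
theorem indicator_starEdges (v : Vertex N) (e : Edge N) :
    (if e ∈ starEdges v then (1 : ZMod 2) else 0) =
      (if source e = v then 1 else 0) + (if target e = v then 1 else 0) := by
  have := source_ne_target e
  simp only [mem_starEdges]
  by_cases h1 : source e = v
  · by_cases h2 : target e = v
    · exact absurd (h1.trans h2.symm) this
    · simp [h1, h2]
  · by_cases h2 : target e = v
    · simp [h1, h2]
    · simp [h1, h2, Ne.symm h1, Ne.symm h2]

theorem even_card_starEdges_inter_plaquetteEdges (v : Vertex N) (p : Plaquette N) :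
    Even (starEdges v ∩ plaquetteEdges p).card := by
  rw [← ZMod.natCast_eq_zero_iff_even, Finset.inter_comm, ← Finset.filter_mem_eq_inter,
    Finset.card_filter, Nat.cast_sum,
    ← sum_plaquetteEdges_coboundary p fun w => if w = v then 1 else 0]
  refine Finset.sum_congr rfl fun e _ => ?_
  rw [← indicator_starEdges]
  split_ifs <;> simp

end Incidence

/-! ### The Toric Code -/

section ToricCode

variable {N : ℕ}

/-- The terms of the Toric Code at coupling strength one. -/
noncomputable def toricTerm (N : ℕ) :
    {v : Vertex N // 3 ≤ (starEdges v).card} ⊕ Plaquette N →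
      Matrix (Edge N → Fin 2) (Edge N → Fin 2) ℂ
  | .inl v => 1 - localProd (starEdges v.1) pauliX
  | .inr p => 1 - localProd (plaquetteEdges p) pauliZ

theorem stabilizerSum_eq_sum_toricTerm (N : ℕ) :
    stabilizerSum N 1 pauliX pauliZ = ∑ k, toricTerm N k := by
  rw [Fintype.sum_sum_type, stabilizerSum]
  simp only [localProd_one, toricTerm]
  congr 1
  exact (Finset.sum_subtype _ (by simp) _)

theorem commutingProjections_toricTerm (N : ℕ) : CommutingProjections (toricTerm N) where
  isHermitian
    | .inl _ => Matrix.isHermitian_one.sub (localProd_isHermitian _ pauliX_isHermitian)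
    | .inr _ => Matrix.isHermitian_one.sub (localProd_isHermitian _ pauliZ_isHermitian)
  mul_self
    | .inl v => by
      have := localProd_sub_mul_self (starEdges v.1) (one_mul (1 : Matrix (Fin 2) (Fin 2) ℂ))
        (one_mul pauliX) (mul_one _) pauliX_mul_self
      simpa only [localProd_one, toricTerm] using this
    | .inr p => by
      have := localProd_sub_mul_self (plaquetteEdges p) (one_mul (1 : Matrix (Fin 2) (Fin 2) ℂ))
        (one_mul pauliZ) (mul_one _) pauliZ_mul_self
      simpa only [localProd_one, toricTerm] using this
  comm k l := by
    have key : ∀ A B : Matrix (Edge N → Fin 2) (Edge N → Fin 2) ℂ, A * B = B * A →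
        (1 - A) * (1 - B) = (1 - B) * (1 - A) := by
      intro A B h
      simp only [sub_mul, mul_sub, one_mul, mul_one, h]
      abel
    rcases k with v | p <;> rcases l with w | q
    · exact key _ _ (localProd_mul_comm_of_commute _ _ rfl)
    · exact key _ _ (localProd_mul_comm _ _ pauliX_mul_pauliZ
        (even_card_starEdges_inter_plaquetteEdges _ _))
    · exact key _ _ (localProd_mul_comm _ _ pauliX_mul_pauliZ
        (even_card_starEdges_inter_plaquetteEdges _ _)).symm
    · exact key _ _ (localProd_mul_comm_of_commute _ _ rfl)

theorem toricCode_eigenvalue {J : ℝ} (hJ : 0 < J) {μ : ℝ} {ψ : (Edge N → Fin 2) → ℂ}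
    (hψ : ψ ≠ 0) (h : toricCode N J *ᵥ ψ = (μ : ℂ) • ψ) : μ = 0 ∨ 2 * J ≤ μ := by
  have h1 : (∑ k, toricTerm N k) *ᵥ ψ = ((μ / J : ℝ) : ℂ) • ψ := by
    rw [toricCode, stabilizerSum_eq_sum_toricTerm, Matrix.smul_mulVec] at h
    have hJ' : (J : ℂ) ≠ 0 := by exact_mod_cast hJ.ne'
    push_cast
    rw [div_eq_inv_mul, ← smul_smul, ← h, smul_smul, inv_mul_cancel₀ hJ', one_smul]
  rcases (commutingProjections_toricTerm N).eigenvalue hψ h1 with h2 | h2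
  · left
    rwa [div_eq_zero_iff, or_iff_left hJ.ne'] at h2
  · right
    rwa [le_div_iff₀ hJ] at h2

theorem localProd_pauliX_mulVec (s : Finset (Edge N)) (ψ : (Edge N → Fin 2) → ℂ)
    (σ : Edge N → Fin 2) :
    (localProd s pauliX *ᵥ ψ) σ = ψ fun e => if e ∈ s then σ e + 1 else σ e := by
  have hx : ∀ a b : Fin 2, pauliX a b = if b = a + 1 then 1 else 0 := by
    intro a b
    fin_cases a <;> fin_cases b <;> simp [pauliX]
  have hent : ∀ τ : Edge N → Fin 2, localProd s pauliX σ τ =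
      if τ = fun e => if e ∈ s then σ e + 1 else σ e then 1 else 0 := by
    intro τ
    simp only [localProd, tensorOp, Matrix.of_apply, funext_iff]
    have := Finset.prod_boole (s := (Finset.univ : Finset (Edge N))) (M₀ := ℂ)
      (p := fun e => τ e = if e ∈ s then σ e + 1 else σ e)
    simp only [Finset.mem_univ, true_implies] at this
    rw [← this]
    refine Finset.prod_congr rfl fun e _ => ?_
    by_cases he : e ∈ s
    · simp only [he, if_true, hx]
    · simp only [he, if_false, Matrix.one_apply, eq_comm]
  simp only [Matrix.mulVec, dotProduct, hent, ite_mul, one_mul, zero_mul, Finset.sum_ite_eq',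
    Finset.mem_univ, if_true]

/-- The operator is diagonal with entry `-1` to the number of excited spins in `s`. Asking for even
parity only on the support of `ψ` makes this apply to the superposition of coboundaries. -/
theorem localProd_pauliZ_mulVec (s : Finset (Edge N)) (ψ : (Edge N → Fin 2) → ℂ)
    (σ : Edge N → Fin 2) (hσ : ψ σ ≠ 0 → ∑ e ∈ s, ((σ e).val : ZMod 2) = 0) :
    (localProd s pauliZ *ᵥ ψ) σ = ψ σ := by
  have hz : ∀ a b : Fin 2, pauliZ a b = if a = b then (-1) ^ a.val else 0 := by
    intro a b
    fin_cases a <;> fin_cases b <;> simp [pauliZ]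
  have hdiag : ∀ τ : Edge N → Fin 2, σ ≠ τ → localProd s pauliZ σ τ = 0 := by
    intro τ h
    obtain ⟨e, he⟩ := Function.ne_iff.1 h
    refine Finset.prod_eq_zero (Finset.mem_univ e) ?_
    by_cases hs : e ∈ s
    · simp [hs, hz, he]
    · simp [hs, he]
  have hsum : (localProd s pauliZ *ᵥ ψ) σ = localProd s pauliZ σ σ * ψ σ :=
    Finset.sum_eq_single σ (fun τ _ hτ => by simp [hdiag τ hτ.symm]) (by simp)
  rw [hsum]
  by_cases h0 : ψ σ = 0
  · rw [h0, mul_zero]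
  · have h1 : Even (∑ e ∈ s, (σ e).val) := by
      rw [← ZMod.natCast_eq_zero_iff_even, Nat.cast_sum, hσ h0]
    have h2 : localProd s pauliZ σ σ = (-1) ^ ∑ e ∈ s, (σ e).val := by
      rw [← Finset.prod_pow_eq_pow_sum]
      simp only [localProd, tensorOp, Matrix.of_apply]
      rw [← Finset.prod_subset (Finset.subset_univ s)]
      · refine Finset.prod_congr rfl fun e he => ?_
        rw [if_pos he, hz, if_pos rfl]
      · intro e _ he
        rw [if_neg he, Matrix.one_apply_eq]
    rw [h2, h1.neg_one_pow, one_mul]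

open Classical in
/-- The equal-weight superposition of all coboundaries is a frustration-free ground state. -/
theorem exists_toricCode_groundState (N : ℕ) (J : ℝ) :
    ∃ ψ : (Edge N → Fin 2) → ℂ, ψ ≠ 0 ∧ toricCode N J *ᵥ ψ = 0 := by
  let P : (Edge N → Fin 2) → Prop := fun σ =>
    ∃ g : Vertex N → ZMod 2, ∀ e, ((σ e).val : ZMod 2) = g (source e) + g (target e)
  let ψ : (Edge N → Fin 2) → ℂ := fun σ => if P σ then 1 else 0
  have hX : ∀ v : Vertex N, localProd (starEdges v) pauliX *ᵥ ψ = ψ := by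
    intro v
    funext σ
    rw [localProd_pauliX_mulVec]
    have hflip : ∀ e, (((if e ∈ starEdges v then σ e + 1 else σ e : Fin 2).val : ℕ) : ZMod 2) =
        (σ e).val + if e ∈ starEdges v then 1 else 0 := by
      intro e
      have : ∀ a : Fin 2, (((a + 1 : Fin 2).val : ℕ) : ZMod 2) = a.val + 1 := by decide
      split_ifs
      · exact this _
      · simp
    have h2 : ∀ x : ZMod 2, x + x = 0 := by decide
    -- Flipping the star of `v` adds the coboundary of the indicator of `v`, so it permutes the
    -- coboundaries.
    refine if_congr ⟨?_, ?_⟩ rfl rfl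
    · rintro ⟨g, hg⟩
      refine ⟨fun w => g w + if w = v then 1 else 0, fun e => ?_⟩
      have h1 := hg e
      rw [hflip, indicator_starEdges] at h1
      linear_combination h1 - h2 (if source e = v then 1 else 0) -
        h2 (if target e = v then 1 else 0)
    · rintro ⟨g, hg⟩
      refine ⟨fun w => g w + if w = v then 1 else 0, fun e => ?_⟩
      rw [hflip, indicator_starEdges, hg]
      ring
  have hZ : ∀ p : Plaquette N, localProd (plaquetteEdges p) pauliZ *ᵥ ψ = ψ := by
    intro p
    funext σ
    refine localProd_pauliZ_mulVec _ _ _ fun h => ?_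
    have h1 : P σ := by
      by_contra hP
      exact h (if_neg hP)
    obtain ⟨g, hg⟩ := h1
    rw [← sum_plaquetteEdges_coboundary p g]
    exact Finset.sum_congr rfl fun e _ => hg e
  refine ⟨ψ, ?_, ?_⟩
  · intro h
    have h1 : ψ 0 = 0 := congrFun h 0
    have h2 : ψ 0 = 1 := if_pos ⟨0, fun e => by simp⟩
    rw [h1] at h2
    exact zero_ne_one h2
  · rw [toricCode, stabilizerSum_eq_sum_toricTerm, Matrix.smul_mulVec, Matrix.sum_mulVec,
      Finset.sum_eq_zero, smul_zero]
    rintro (v | p) _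
    · simp only [toricTerm, Matrix.sub_mulVec, Matrix.one_mulVec, hX, sub_self]
    · simp only [toricTerm, Matrix.sub_mulVec, Matrix.one_mulVec, hZ, sub_self]

end ToricCode

/-! ### The two regimes from energy estimates on basis configurations -/

section Regimes

variable {N c : ℕ}

/-- The diagonal part of the Hamiltonian at a basis configuration. -/
noncomputable def energy (C : ℝ) (W : Couplings c) (σ : Edge N → Spin c) : ℝ :=
  classicalEnergy W σ + C * mismatches σ

theorem hamiltonian_eq (J C : ℝ) (W : Couplings c) :
    hamiltonian N J C W =
      (J : ℂ) • stabilizerSum N (extend c 1) (extend c pauliX) (extend c pauliZ) +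
        Matrix.diagonal fun σ => (energy C W σ : ℂ) := by
  rw [hamiltonian, add_assoc, Matrix.diagonal_add]
  simp only [energy, Complex.ofReal_add]

theorem eq_inr_congr {x y : Spin c} (h : x = y ∨ x.isLeft ∧ y.isLeft) (k : Fin c) :
    x = .inr k ↔ y = .inr k := by
  rcases h with rfl | ⟨h1, h2⟩
  · rfl
  · rcases x with x | x <;> rcases y with y | y <;> simp at h1 h2 ⊢

-- The diagonal part sees only which spins are classical, and their colours. Together with the next
-- lemma this makes it constant on the blocks of the stabilizer sum.
open Classical in
theorem energy_congr (C : ℝ) (W : Couplings c) {σ τ : Edge N → Spin c}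
    (h : ∀ e, σ e = τ e ∨ (σ e).isLeft ∧ (τ e).isLeft) : energy C W σ = energy C W τ := by
  have hr : ∀ e k, σ e = .inr k ↔ τ e = .inr k := fun e k => eq_inr_congr (h e) k
  have hl : ∀ e, (σ e).isLeft = (τ e).isLeft := by
    intro e
    rcases h e with h1 | h1
    · rw [h1]
    · rw [h1.1, h1.2]
  have hr' : ∀ e, (σ e).isRight = (τ e).isRight := by
    intro e
    rcases h e with h1 | ⟨h1, h2⟩
    · rw [h1]
    · rw [Sum.isLeft_iff] at h1 h2
      obtain ⟨x, hx⟩ := h1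
      obtain ⟨y, hy⟩ := h2
      rw [hx, hy]
      rfl
  have hm : mismatches σ = mismatches τ := by
    unfold mismatches
    congr 1
    ext x
    simp only [Finset.mem_filter, hl, hr']
  rw [energy, energy, hm, classicalEnergy, classicalEnergy]
  refine congrArg (· + _) (congrArg₂ (· + ·) (Finset.sum_congr rfl fun p _ => Finset.sum_congr rfl
    fun w _ => if_congr ?_ rfl rfl) (Finset.sum_congr rfl fun v _ => Finset.sum_congr rfl
    fun t _ => if_congr ?_ rfl rfl))
  · simp only [TileAt, hr]
  · simp only [PatternAt, hr]

/-- A term acts on a nonempty set of edges, needs Toric Code levels on all of them and leaves the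
other spins alone. In particular the stabilizers annihilate purely classical configurations. -/
theorem stabilizerSum_extend_apply_ne_zero {σ τ : Edge N → Spin c}
    (h : stabilizerSum N (extend c 1) (extend c pauliX) (extend c pauliZ) σ τ ≠ 0) :
    (∀ e, σ e = τ e ∨ (σ e).isLeft ∧ (τ e).isLeft) ∧ ∃ e, (τ e).isLeft := by
  have key : ∀ s : Finset (Edge N), s.Nonempty → ∀ A, localProd s (extend c A) σ τ ≠ 0 →
      (∀ e, σ e = τ e ∨ (σ e).isLeft ∧ (τ e).isLeft) ∧ ∃ e, (τ e).isLeft := by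
    rintro s ⟨e₀, he₀⟩ A hA
    constructor
    · intro e
      by_cases he : e ∈ s
      · exact .inr (extend_apply_ne_zero ((localProd_apply_ne_zero hA e).1 he))
      · exact .inl ((localProd_apply_ne_zero hA e).2 he)
    · exact ⟨e₀, (extend_apply_ne_zero ((localProd_apply_ne_zero hA e₀).1 he₀)).2⟩
  have key2 : ∀ s : Finset (Edge N), s.Nonempty → ∀ A B,
      (localProd s (extend c A) - localProd s (extend c B)) σ τ ≠ 0 →
      (∀ e, σ e = τ e ∨ (σ e).isLeft ∧ (τ e).isLeft) ∧ ∃ e, (τ e).isLeft := by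
    intro s hs A B hAB
    by_cases hA : localProd s (extend c A) σ τ = 0
    · refine key s hs B fun hB => hAB ?_
      rw [Matrix.sub_apply, hA, hB, sub_zero]
    · exact key s hs A hA
  by_contra hcon
  refine h ?_
  rw [stabilizerSum, Matrix.add_apply, Matrix.sum_apply, Matrix.sum_apply,
    Finset.sum_eq_zero, Finset.sum_eq_zero, add_zero]
  · intro p _
    by_contra hp
    exact hcon (key2 _ ⟨side p .north, by simp [plaquetteEdges]⟩ _ _ hp)
  · intro v hv
    by_contra hp
    refine hcon (key2 _ (Finset.card_pos.1 ?_) _ _ hp)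
    have := (Finset.mem_filter.1 hv).2
    omega

theorem eigenvector_apply_eq_zero_of_lt_energy {J : ℝ} (hJ : 0 < J) {C : ℝ} {W : Couplings c}
    {μ : ℝ} {ψ : (Edge N → Spin c) → ℂ} (h : hamiltonian N J C W *ᵥ ψ = (μ : ℂ) • ψ)
    {σ : Edge N → Spin c} (hσ : μ < energy C W σ) : ψ σ = 0 := by
  rw [hamiltonian_eq] at h
  exact eigenvector_apply_eq_zero (stabilizerSum_posSemidef (localAlgebra_extend c))
    (fun σ τ hστ => energy_congr C W (stabilizerSum_extend_apply_ne_zero hστ).1) hJ.le h hσ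

theorem mem_eigenspace_toLin' {ι : Type*} [Fintype ι] [DecidableEq ι] {A : Matrix ι ι ℂ} {μ : ℂ}
    {ψ : ι → ℂ} : ψ ∈ Module.End.eigenspace (Matrix.toLin' A) μ ↔ A *ᵥ ψ = μ • ψ := by
  rw [Module.End.mem_eigenspace_iff, Matrix.toLin'_apply]

theorem exists_eigenvector {ι : Type*} [Fintype ι] [DecidableEq ι] {A : Matrix ι ι ℂ} {μ : ℂ}
    (h : Module.End.HasEigenvalue (Matrix.toLin' A) μ) : ∃ ψ, ψ ≠ 0 ∧ A *ᵥ ψ = μ • ψ := by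
  obtain ⟨ψ, hψ⟩ := h.exists_hasEigenvector
  exact ⟨ψ, hψ.2, mem_eigenspace_toLin'.1 hψ.1⟩

/-- The basis vector of `ω` is annihilated by the stabilizers, hence an exact eigenvector. An
eigenvector with eigenvalue below `E + 1/2` vanishes on all other configurations, so it is a
multiple of that one. -/
theorem classicalRegime_of_energy {J : ℝ} (hJ : 0 < J) {C : ℝ} {W : Couplings c}
    (ω : Edge N → Fin c) {E : ℝ} (hω : energy C W (fun e => .inr (ω e)) = E)
    (h : ∀ σ : Edge N → Spin c, σ ≠ (fun e => .inr (ω e)) → E + 1 / 2 ≤ energy C W σ) :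
    ClassicalRegime (hamiltonian N J C W) := by
  have hground : hamiltonian N J C W *ᵥ Pi.single (fun e => .inr (ω e)) 1 =
      (E : ℂ) • Pi.single (fun e => .inr (ω e)) 1 := by
    rw [hamiltonian_eq, Matrix.add_mulVec, Matrix.smul_mulVec]
    have h1 : stabilizerSum N (extend c 1) (extend c pauliX) (extend c pauliZ) *ᵥ
        Pi.single (fun e => .inr (ω e)) 1 = 0 := by
      rw [Matrix.mulVec_single_one]
      funext σ
      by_contra hne
      obtain ⟨e, he⟩ := (stabilizerSum_extend_apply_ne_zero hne).2
      simp at he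
    rw [h1, smul_zero, zero_add]
    funext σ
    rw [Matrix.mulVec_diagonal, Pi.smul_apply, smul_eq_mul]
    by_cases hσ : σ = fun e => .inr (ω e)
    · rw [hσ, hω]
    · rw [Pi.single_eq_of_ne hσ, mul_zero, mul_zero]
  have hspan : ∀ (μ : ℝ) (ψ : (Edge N → Spin c) → ℂ), μ < E + 1 / 2 →
      hamiltonian N J C W *ᵥ ψ = (μ : ℂ) • ψ →
      ψ = ψ (fun e => .inr (ω e)) • Pi.single (fun e => .inr (ω e)) 1 := by
    intro μ ψ hμ hψ
    funext σ
    rw [Pi.smul_apply, smul_eq_mul]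
    by_cases hσ : σ = fun e => .inr (ω e)
    · rw [hσ, Pi.single_eq_same, mul_one]
    · rw [Pi.single_eq_of_ne hσ, mul_zero]
      exact eigenvector_apply_eq_zero_of_lt_energy hJ hψ (hμ.trans_le (h σ hσ))
  refine ⟨E, ω, ?_, ?_⟩
  · ext ψ
    rw [mem_eigenspace_toLin', Submodule.mem_span_singleton]
    constructor
    · intro hψ
      exact ⟨_, (hspan E ψ (by linarith) hψ).symm⟩
    · rintro ⟨a, rfl⟩
      rw [Matrix.mulVec_smul, hground, smul_comm]
  · intro μ hμ
    obtain ⟨ψ, hψ0, hψ⟩ := exists_eigenvector hμ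
    by_contra hcon
    push Not at hcon
    have h1 := hspan μ ψ hcon.2 hψ
    set a := ψ (fun e => .inr (ω e)) with ha
    have ha0 : a ≠ 0 := by
      intro h0
      rw [h0, zero_smul] at h1
      exact hψ0 h1
    rw [h1, Matrix.mulVec_smul, hground] at hψ
    have h2 := congrFun hψ fun e => .inr (ω e)
    simp only [Pi.smul_apply, Pi.single_eq_same, smul_eq_mul, mul_one] at h2
    rw [mul_comm] at h2
    exact hcon.1 (by exact_mod_cast (mul_right_cancel₀ ha0 h2).symm)

theorem inclusion_apply (σ : Edge N → Spin c) (τ : Edge N → Fin 2) :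
    inclusion N c σ τ = if σ = fun e => .inl (τ e) then 1 else 0 := by
  simp only [inclusion, tensorOp, Matrix.of_apply, Finset.prod_boole, Finset.mem_univ,
    true_implies, funext_iff]

theorem inclusion_mulVec_inl (φ : (Edge N → Fin 2) → ℂ) (τ : Edge N → Fin 2) :
    (inclusion N c *ᵥ φ) (fun e => .inl (τ e)) = φ τ := by
  have : ∀ τ' : Edge N → Fin 2,
      ((fun e => .inl (τ e) : Edge N → Spin c) = fun e => .inl (τ' e)) ↔ τ = τ' := by
    intro τ'
    simp [funext_iff]
  simp only [Matrix.mulVec, dotProduct, inclusion_apply, this, ite_mul, one_mul, zero_mul,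
    Finset.sum_ite_eq, Finset.mem_univ, if_true]

theorem inclusion_mulVec_of_isRight (φ : (Edge N → Fin 2) → ℂ) {σ : Edge N → Spin c}
    (h : ∃ e, (σ e).isRight) : (inclusion N c *ᵥ φ) σ = 0 := by
  obtain ⟨e, he⟩ := h
  refine Finset.sum_eq_zero fun τ _ => ?_
  change inclusion N c σ τ * φ τ = 0
  rw [inclusion_apply, if_neg, zero_mul]
  intro hσ
  rw [hσ] at he
  simp at he

theorem eq_inl_of_forall_not_isRight {σ : Edge N → Spin c} (h : ¬∃ e, (σ e).isRight) :
    ∃ τ : Edge N → Fin 2, σ = fun e => .inl (τ e) := by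
  push Not at h
  have : ∀ e, ∃ k, σ e = .inl k := by
    intro e
    rcases hk : σ e with k | k
    · exact ⟨k, rfl⟩
    · exact absurd (by rw [hk]; rfl) (h e)
  choose τ hτ using this
  exact ⟨τ, funext hτ⟩

theorem localProd_extend_mul_inclusion (s : Finset (Edge N)) (A : Matrix (Fin 2) (Fin 2) ℂ) :
    localProd s (extend c A) * inclusion N c = inclusion N c * localProd s A := by
  rw [localProd, localProd, inclusion, tensorOp_mul, tensorOp_mul]
  congr 1
  ext1 e
  split_ifs
  · ext x k
    rw [Matrix.mul_apply, Matrix.mul_apply, Fintype.sum_sum_type]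
    rcases x with x | x <;> simp [extend]
  · rw [Matrix.one_mul, Matrix.mul_one]

theorem hamiltonian_mulVec_inclusion {J C : ℝ} {W : Couplings c}
    (h : ∀ τ : Edge N → Fin 2, energy C W (fun e => .inl (τ e)) = 0)
    (φ : (Edge N → Fin 2) → ℂ) :
    hamiltonian N J C W *ᵥ (inclusion N c *ᵥ φ) = inclusion N c *ᵥ (toricCode N J *ᵥ φ) := by
  have h1 : stabilizerSum N (extend c 1) (extend c pauliX) (extend c pauliZ) * inclusion N c =
      inclusion N c * stabilizerSum N 1 pauliX pauliZ := by
    simp only [stabilizerSum, Matrix.add_mul, Matrix.mul_add, Matrix.sum_mul, Matrix.mul_sum,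
      Matrix.sub_mul, Matrix.mul_sub, localProd_extend_mul_inclusion]
  have h2 : (Matrix.diagonal fun σ => (energy C W σ : ℂ)) *ᵥ (inclusion N c *ᵥ φ) = 0 := by
    funext σ
    rw [Matrix.mulVec_diagonal, Pi.zero_apply]
    by_cases hσ : ∃ e, (σ e).isRight
    · rw [inclusion_mulVec_of_isRight _ hσ, mul_zero]
    · obtain ⟨τ, rfl⟩ := eq_inl_of_forall_not_isRight hσ
      rw [h, Complex.ofReal_zero, zero_mul]
  rw [hamiltonian_eq, Matrix.add_mulVec, h2, add_zero, Matrix.smul_mulVec, Matrix.mulVec_mulVec,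
    h1, toricCode, Matrix.smul_mulVec, Matrix.mulVec_smul, Matrix.mulVec_mulVec]

/-- Below energy `1/2` eigenvectors vanish on every configuration with a classical spin, so they lie
in the image of the inclusion, which intertwines the Toric Code with the full Hamiltonian. -/
theorem toricRegime_of_energy {J : ℝ} (hJ : 0 < J) {C : ℝ} {W : Couplings c}
    (h0 : ∀ τ : Edge N → Fin 2, energy C W (fun e => .inl (τ e)) = 0)
    (h : ∀ σ : Edge N → Spin c, (∃ e, (σ e).isRight) → 1 / 2 ≤ energy C W σ) :
    ToricRegime J (hamiltonian N J C W) := by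
  have hinj : ∀ φ φ' : (Edge N → Fin 2) → ℂ, inclusion N c *ᵥ φ = inclusion N c *ᵥ φ' → φ = φ' := by
    intro φ φ' hφ
    funext τ
    rw [← inclusion_mulVec_inl (c := c) φ, hφ, inclusion_mulVec_inl]
  have hpre : ∀ (μ : ℝ) (ψ : (Edge N → Spin c) → ℂ), μ < 1 / 2 →
      hamiltonian N J C W *ᵥ ψ = (μ : ℂ) • ψ →
      ∃ φ, toricCode N J *ᵥ φ = (μ : ℂ) • φ ∧ inclusion N c *ᵥ φ = ψ := by
    intro μ ψ hμ hψ
    have hφ : inclusion N c *ᵥ (fun τ => ψ fun e => .inl (τ e)) = ψ := by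
      funext σ
      by_cases hσ : ∃ e, (σ e).isRight
      · rw [inclusion_mulVec_of_isRight _ hσ,
          eigenvector_apply_eq_zero_of_lt_energy hJ hψ (hμ.trans_le (h σ hσ))]
      · obtain ⟨τ, rfl⟩ := eq_inl_of_forall_not_isRight hσ
        rw [inclusion_mulVec_inl]
    refine ⟨_, hinj _ _ ?_, hφ⟩
    rw [← hamiltonian_mulVec_inclusion h0, hφ, hψ, Matrix.mulVec_smul, hφ]
  refine ⟨?_, ?_, ?_⟩
  · intro μ hμ
    ext ψ
    rw [mem_eigenspace_toLin', Submodule.mem_map]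
    constructor
    · intro hψ
      obtain ⟨φ, hφ, rfl⟩ := hpre μ ψ hμ hψ
      exact ⟨φ, mem_eigenspace_toLin'.2 hφ, rfl⟩
    · rintro ⟨φ, hφ, rfl⟩
      rw [mem_eigenspace_toLin'] at hφ
      rw [Matrix.toLin'_apply, hamiltonian_mulVec_inclusion h0, hφ, Matrix.mulVec_smul]
  · obtain ⟨ψ, hψ0, hψ⟩ := exists_toricCode_groundState N J
    refine Module.End.hasEigenvalue_of_hasEigenvector (x := inclusion N c *ᵥ ψ) ⟨?_, ?_⟩
    · rw [mem_eigenspace_toLin', hamiltonian_mulVec_inclusion h0, hψ, Matrix.mulVec_zero, zero_smul]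
    · intro hz
      exact hψ0 (hinj _ _ (by rw [hz, Matrix.mulVec_zero]))
  · intro μ hμ
    obtain ⟨ψ, hψ0, hψ⟩ := exists_eigenvector hμ
    by_cases hlt : μ < 1 / 2
    · obtain ⟨φ, hφ, rfl⟩ := hpre μ ψ hlt hψ
      have hφ0 : φ ≠ 0 := by
        rintro rfl
        exact hψ0 (Matrix.mulVec_zero _)
      rcases toricCode_eigenvalue hJ hφ0 hφ with h1 | h1
      · exact .inl h1
      · exact .inr ((min_le_left _ _).trans h1)
    · exact .inr ((min_le_right _ _).trans (not_lt.1 hlt))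

/-- The two regimes exclude each other. -/
theorem ClassicalRegime.not_toricRegime {J : ℝ} {H : Matrix (Edge N → Spin c) (Edge N → Spin c) ℂ}
    (hN : 1 ≤ N) (hJ : 0 < J) (hcl : ClassicalRegime H) : ¬ToricRegime J H := by
  rintro ⟨htc, h0, hgap⟩
  obtain ⟨E, ω, hE, hcgap⟩ := hcl
  have hmem : (Pi.single (fun e => (Sum.inr (ω e) : Spin c)) (1 : ℂ)) ∈
      Module.End.eigenspace (Matrix.toLin' H) (E : ℂ) := by
    rw [hE]
    exact Submodule.mem_span_singleton_self _
  have hev : Module.End.HasEigenvalue (Matrix.toLin' H) (E : ℂ) :=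
    Module.End.hasEigenvalue_of_hasEigenvector ⟨hmem, by simp⟩
  have hmin : (0 : ℝ) < min (2 * J) (1 / 2) := lt_min (by linarith) (by norm_num)
  -- Both `E` and `0` are eigenvalues. If they differed, the Toric Code gap would force `E > 0`, and
  -- the classical gap would force `E + 1/2 ≤ 0`.
  have hE0 : E = 0 := by
    rcases hgap E hev with h1 | h1
    · exact h1
    · rcases hcgap 0 (by exact_mod_cast h0) with h2 | h2
      · exact h2.symm
      · linarith
  rw [htc E (by rw [hE0]; norm_num), Submodule.mem_map] at hmem
  obtain ⟨φ, -, hφ⟩ := hmem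
  have h1 := congrFun hφ fun e => .inr (ω e)
  rw [Matrix.toLin'_apply, inclusion_mulVec_of_isRight, Pi.single_eq_same] at h1
  · exact zero_ne_one h1
  · exact ⟨.inr (0, ⟨0, hN⟩), rfl⟩

/-- Were one threshold larger, both regimes would hold at the size equal to it. -/
theorem HasTransitionAt.unique {C : ℝ} {W : Couplings c} {m n : ℕ} (hm : HasTransitionAt C W m)
    (hn : HasTransitionAt C W n) : m = n := by
  have key : ∀ {m n : ℕ}, HasTransitionAt C W m → HasTransitionAt C W n → n ≤ m := by
    intro m n hm hn
    by_contra hlt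
    exact ((hn.2 1 one_pos n hn.1).1 le_rfl).not_toricRegime hn.1 one_pos
      ((hm.2 1 one_pos n hn.1).2 (not_le.1 hlt))
  exact le_antisymm (key hn hm) (key hm hn)

theorem finite_setOf_admissible (c : ℕ) : {W : Couplings c | W.Admissible}.Finite := by
  let V : Set ℝ := (fun k : ℤ => (k : ℝ) / 2) '' Set.Icc (-16) 16
  have hV : V.Finite := (Set.finite_Icc _ _).image _
  have h1 : (Set.univ.pi fun _ : Dir → Fin c => V).Finite := Set.Finite.pi fun _ => hV
  have h2 : (Set.univ.pi fun _ : Dir → Option (Fin c) => V).Finite := Set.Finite.pi fun _ => hV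
  refine ((h1.prod h2).preimage (f := fun W : Couplings c => (W.plaq, W.star)) ?_).subset ?_
  · rintro ⟨p, s⟩ _ ⟨p', s'⟩ _ h
    simpa using h
  · rintro W ⟨hp, hs, -⟩
    refine ⟨fun w _ => ?_, fun t _ => ?_⟩
    · obtain ⟨k, hk, hk'⟩ := hp w
      exact ⟨k, abs_le.1 hk, hk'.symm⟩
    · obtain ⟨k, hk, hk'⟩ := hs t
      exact ⟨k, abs_le.1 hk, hk'.symm⟩

theorem finite_setOf_isThreshold (C : ℝ) (d : ℕ) : {n | IsThreshold C d n}.Finite := by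
  classical
  refine ((finite_setOf_admissible (d - 2)).image fun W =>
    if h : ∃ n, HasTransitionAt C W n then h.choose else 0).subset ?_
  rintro n ⟨W, hW, hn⟩
  refine ⟨W, hW, ?_⟩
  have h : ∃ n, HasTransitionAt C W n := ⟨n, hn⟩
  simp only [h, dif_pos]
  exact h.choose_spec.unique hn

end Regimes

/-! ### Deterministic tiling rules -/

/-- A rule assigns to the colours of the west and south legs of a vertex (`none` if the leg is
absent) the colours of the north and east legs, or `none` if there is no admissible choice. -/
abbrev Rule (K : Type*) : Type _ := Option K → Option K → Option (K × K)

/-- The colours of the north and east legs of the vertex `(i, j)` that a rule forces, or `none` if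
the rule gets stuck there or before. -/
def Rule.evolve {K : Type*} (ϕ : Rule K) : ℕ → ℕ → Option (K × K)
  | 0, 0 => ϕ none none
  | i + 1, 0 => (ϕ.evolve i 0).bind fun p => ϕ (some p.2) none
  | 0, j + 1 => (ϕ.evolve 0 j).bind fun q => ϕ none (some q.1)
  | i + 1, j + 1 => (ϕ.evolve i (j + 1)).bind fun p =>
      (ϕ.evolve (i + 1) j).bind fun q => ϕ (some p.2) (some q.1)
  termination_by i j => i + j

/-- The rule does not get stuck at vertices of the `N × N` lattice that have a north or east leg. -/
def Rule.Survives {K : Type*} (ϕ : Rule K) (N : ℕ) : Prop :=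
  ∀ i j, i ≤ N → j ≤ N → (i < N ∨ j < N) → (ϕ.evolve i j).isSome

theorem Rule.Survives.mono {K : Type*} {ϕ : Rule K} {M N : ℕ} (h : ϕ.Survives N) (hMN : M ≤ N) :
    ϕ.Survives M :=
  fun i j hi hj hij => h i j (hi.trans hMN) (hj.trans hMN) (by omega)

section Evolve

variable {K : Type*} {ϕ : Rule K}

/-- An explicit solution of the rule on a set of vertices that contains the past of its members. -/
theorem Rule.evolve_eq_of_solution {P : ℕ → ℕ → Prop} {v h : ℕ → ℕ → K}
    (hPi : ∀ i j, P (i + 1) j → P i j) (hPj : ∀ i j, P i (j + 1) → P i j)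
    (h00 : P 0 0 → ϕ none none = some (v 0 0, h 0 0))
    (hi0 : ∀ i, P (i + 1) 0 → ϕ (some (h i 0)) none = some (v (i + 1) 0, h (i + 1) 0))
    (h0j : ∀ j, P 0 (j + 1) → ϕ none (some (v 0 j)) = some (v 0 (j + 1), h 0 (j + 1)))
    (hij : ∀ i j, P (i + 1) (j + 1) → ϕ (some (h i (j + 1))) (some (v (i + 1) j)) =
      some (v (i + 1) (j + 1), h (i + 1) (j + 1))) :
    ∀ i j, P i j → ϕ.evolve i j = some (v i j, h i j)
  | 0, 0, hP => by rw [Rule.evolve, h00 hP]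
  | i + 1, 0, hP => by
    rw [Rule.evolve, evolve_eq_of_solution hPi hPj h00 hi0 h0j hij i 0 (hPi _ _ hP),
      Option.bind_some, hi0 i hP]
  | 0, j + 1, hP => by
    rw [Rule.evolve, evolve_eq_of_solution hPi hPj h00 hi0 h0j hij 0 j (hPj _ _ hP),
      Option.bind_some, h0j j hP]
  | i + 1, j + 1, hP => by
    rw [Rule.evolve, evolve_eq_of_solution hPi hPj h00 hi0 h0j hij i (j + 1) (hPi _ _ hP),
      evolve_eq_of_solution hPi hPj h00 hi0 h0j hij (i + 1) j (hPj _ _ hP),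
      Option.bind_some, Option.bind_some, hij i j hP]
  termination_by i j => i + j

/-- Renaming the colours of a rule. -/
def Rule.rename {L : Type*} (e : K ≃ L) (ϕ : Rule K) : Rule L :=
  fun w s => (ϕ (w.map e.symm) (s.map e.symm)).map (Prod.map e e)

theorem Rule.evolve_rename {L : Type*} (e : K ≃ L) :
    ∀ i j, (ϕ.rename e).evolve i j = (ϕ.evolve i j).map (Prod.map e e)
  | 0, 0 => by rw [Rule.evolve, Rule.evolve]; rfl
  | i + 1, 0 => by
    rw [Rule.evolve, Rule.evolve, evolve_rename e i 0]
    cases ϕ.evolve i 0 <;> simp [Rule.rename]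
  | 0, j + 1 => by
    rw [Rule.evolve, Rule.evolve, evolve_rename e 0 j]
    cases ϕ.evolve 0 j <;> simp [Rule.rename]
  | i + 1, j + 1 => by
    rw [Rule.evolve, Rule.evolve, evolve_rename e i (j + 1), evolve_rename e (i + 1) j]
    cases ϕ.evolve i (j + 1) <;> cases ϕ.evolve (i + 1) j <;> simp [Rule.rename]
  termination_by i j => i + j

theorem Rule.survives_rename {L : Type*} (e : K ≃ L) (N : ℕ) :
    (ϕ.rename e).Survives N ↔ ϕ.Survives N := by
  simp [Rule.Survives, Rule.evolve_rename]

end Evolve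

/-! ### Vertex energies -/

section VertexEnergy

variable {c : ℕ}

/-- Möbius inversion on the Boolean lattice. In the induction, the sets `A` and `insert x A` are
paired: the terms with `x ∉ B` cancel, and those with `x ∈ B` give the same sum for `f (insert x
·)`. -/
theorem sum_powerset_alternating {α : Type*} [DecidableEq α] (f : Finset α → ℤ) (U : Finset α) :
    ∑ A ∈ U.powerset, ∑ B ∈ A.powerset, (-1) ^ (A \ B).card * f B = f U := by
  induction U using Finset.induction_on generalizing f with
  | empty => simp
  | insert x U hx ih =>
    rw [Finset.sum_powerset_insert hx, ← Finset.sum_add_distrib, ← ih fun B => f (insert x B)]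
    refine Finset.sum_congr rfl fun A hA => ?_
    have hxA : x ∉ A := fun h => hx (Finset.mem_powerset.1 hA h)
    rw [Finset.sum_powerset_insert hxA, ← add_assoc, ← Finset.sum_add_distrib,
      Finset.sum_eq_zero, zero_add]
    · refine Finset.sum_congr rfl fun B hB => ?_
      rw [Finset.insert_sdiff_insert, Finset.sdiff_insert_of_notMem hxA]
    · intro B hB
      have hxB : x ∉ B := fun h => hxA (Finset.mem_powerset.1 hB h)
      rw [Finset.insert_sdiff_of_notMem _ hxB, Finset.card_insert_of_notMem (by simp [hxA]),
        pow_succ]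
      ring

/-- The legs that a pattern involves. -/
def legs (t : Dir → Option (Fin c)) : Finset Dir :=
  Finset.univ.filter fun a => (t a).isSome

theorem mem_legs {t : Dir → Option (Fin c)} {a : Dir} : a ∈ legs t ↔ (t a).isSome := by
  simp [legs]

/-- The part of a pattern on a set of legs. -/
def restrict (t : Dir → Option (Fin c)) (B : Finset Dir) : Dir → Option (Fin c) :=
  fun a => if a ∈ B then t a else none

theorem legs_restrict (t : Dir → Option (Fin c)) {B : Finset Dir} (hB : B ⊆ legs t) :
    legs (restrict t B) = B := by
  ext a
  rw [mem_legs, restrict]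
  by_cases h : a ∈ B
  · simpa [h] using mem_legs.1 (hB h)
  · simp [h]

theorem restrict_restrict (t : Dir → Option (Fin c)) {A B : Finset Dir} (h : B ⊆ A) :
    restrict (restrict t A) B = restrict t B := by
  funext a
  by_cases ha : a ∈ B
  · simp [restrict, ha, h ha]
  · simp [restrict, ha]

theorem restrict_legs (t : Dir → Option (Fin c)) : restrict t (legs t) = t := by
  funext a
  by_cases ha : a ∈ legs t
  · simp [restrict, ha]
  · rw [mem_legs, Option.not_isSome_iff_eq_none] at ha
    simp [restrict, ha]

/-- The north and east legs of a pattern are as the rule prescribes. -/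
def Rule.Obeys (ϕ : Rule (Fin c)) (t : Dir → Option (Fin c)) : Prop :=
  (∀ k, t .north = some k → (ϕ (t .west) (t .south)).map Prod.fst = some k) ∧
    ∀ k, t .east = some k → (ϕ (t .west) (t .south)).map Prod.snd = some k

/-- Twice the penalty for violating a rule, depending on the legs present. -/
def penalty (B : Finset Dir) : ℤ :=
  if B = {.north, .east} then 1
  else if B = {.south, .east} ∨ B = {.north, .west} ∨ 3 ≤ B.card then 2 else 0

theorem penalty_nonneg (B : Finset Dir) : 0 ≤ penalty B := by
  unfold penalty
  split_ifs <;> norm_num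

/-- This total keeps the star couplings within 16 half-units. It is small enough because only leg
sets of actual lattice vertices with an output leg are penalised. -/
theorem sum_penalty : ∑ B : Finset Dir, penalty B = 15 := by decide

open Classical in
/-- Twice the energy of a vertex: violations of the rule are penalised, and the lower left corner
of the lattice gets a bonus. -/
noncomputable def Rule.vertexEnergy (ϕ : Rule (Fin c)) (t : Dir → Option (Fin c)) : ℤ :=
  if ϕ.Obeys t then (if legs t = {.north, .east} then -1 else 0) else penalty (legs t)

theorem Rule.abs_vertexEnergy_le (ϕ : Rule (Fin c)) (t : Dir → Option (Fin c)) :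
    |ϕ.vertexEnergy t| ≤ penalty (legs t) := by
  unfold Rule.vertexEnergy
  split_ifs with h1 h2
  · rw [h2]; decide
  · simpa using penalty_nonneg _
  · rw [abs_of_nonneg (penalty_nonneg _)]

/-- The star energies that add up to `vertexEnergy`, by inclusion-exclusion. -/
noncomputable def Rule.starEnergy (ϕ : Rule (Fin c)) (t : Dir → Option (Fin c)) : ℤ :=
  ∑ B ∈ (legs t).powerset, (-1) ^ (legs t \ B).card * ϕ.vertexEnergy (restrict t B)

theorem Rule.abs_starEnergy_le (ϕ : Rule (Fin c)) (t : Dir → Option (Fin c)) :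
    |ϕ.starEnergy t| ≤ 16 := by
  calc |ϕ.starEnergy t| ≤ ∑ B ∈ (legs t).powerset,
        |(-1) ^ (legs t \ B).card * ϕ.vertexEnergy (restrict t B)| :=
        Finset.abs_sum_le_sum_abs _ _
    _ ≤ ∑ B ∈ (legs t).powerset, penalty B := by
        refine Finset.sum_le_sum fun B hB => ?_
        rw [abs_mul, abs_pow, abs_neg, abs_one, one_pow, one_mul]
        have := ϕ.abs_vertexEnergy_le (restrict t B)
        rwa [legs_restrict t (Finset.mem_powerset.1 hB)] at this
    _ ≤ ∑ B : Finset Dir, penalty B :=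
        Finset.sum_le_sum_of_subset_of_nonneg (Finset.subset_univ _) fun B _ _ => penalty_nonneg B
    _ ≤ 16 := by rw [sum_penalty]; norm_num

/-- Möbius inversion, as restricting `P` to different subsets of its legs gives different patterns.
-/
theorem sum_starEnergy (ϕ : Rule (Fin c)) (P : Dir → Option (Fin c)) :
    ∑ t ∈ (legs P).powerset.image (restrict P), ϕ.starEnergy t = ϕ.vertexEnergy P := by
  rw [Finset.sum_image, ← restrict_legs P,
    ← sum_powerset_alternating (fun B => ϕ.vertexEnergy (restrict P B)) (legs P), restrict_legs]
  · refine Finset.sum_congr rfl fun A hA => ?_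
    rw [Rule.starEnergy, legs_restrict P (Finset.mem_powerset.1 hA)]
    refine Finset.sum_congr rfl fun B hB => ?_
    rw [restrict_restrict P (Finset.mem_powerset.1 hB)]
  · intro A hA B hB (h' : restrict P A = restrict P B)
    rw [← legs_restrict P (Finset.mem_powerset.1 hA), h',
      legs_restrict P (Finset.mem_powerset.1 hB)]

/-- The classical interaction that enforces a rule. -/
noncomputable def Rule.couplings (ϕ : Rule (Fin c)) : Couplings c where
  plaq _ := 0
  star t := (ϕ.starEnergy t : ℝ) / 2

theorem Rule.couplings_admissible (ϕ : Rule (Fin c)) : ϕ.couplings.Admissible := by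
  refine ⟨fun _ => ⟨0, by norm_num, by simp [couplings]⟩,
    fun t => ⟨ϕ.starEnergy t, ϕ.abs_starEnergy_le t, rfl⟩, ?_⟩
  have h0 : legs (fun _ : Dir => (none : Option (Fin c))) = ∅ := by simp [legs]
  have h1 : ϕ.Obeys fun _ => none := by simp [Rule.Obeys]
  have h2 : restrict (fun _ : Dir => (none : Option (Fin c))) ∅ = fun _ => none := by
    funext a
    simp [restrict]
  have h3 : (∅ : Finset Dir) ≠ {.north, .east} := by decide
  simp [couplings, Rule.starEnergy, h0, h2, Rule.vertexEnergy, h1, h3]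

end VertexEnergy

/-! ### Energies of configurations under a rule -/

section RuleEnergy

variable {N c : ℕ}

/-- The classical colours around a vertex. -/
def patternOf (σ : Edge N → Spin c) (v : Vertex N) : Dir → Option (Fin c) :=
  fun a => (leg v a).bind fun e => (σ e).getRight?

/-- The patterns that occur at a vertex are the restrictions of its full classical pattern, which is
the index set of the inversion formula. -/
theorem patternAt_iff {σ : Edge N → Spin c} {v : Vertex N} {t : Dir → Option (Fin c)} :
    PatternAt t σ v ↔ t ∈ (legs (patternOf σ v)).powerset.image (restrict (patternOf σ v)) := by
  have key : PatternAt t σ v ↔ ∀ a k, t a = some k → patternOf σ v a = some k := by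
    simp only [PatternAt, patternOf, Option.bind_eq_some_iff, Sum.getRight?_eq_some_iff]
  rw [key, Finset.mem_image]
  constructor
  · intro h
    refine ⟨legs t, Finset.mem_powerset.2 fun a ha => ?_, ?_⟩
    · simp only [mem_legs, Option.isSome_iff_exists] at ha ⊢
      obtain ⟨k, hk⟩ := ha
      exact ⟨k, h a k hk⟩
    · funext a
      rcases ht : t a with _ | k
      · simp [restrict, mem_legs, ht]
      · simp [restrict, mem_legs, ht, h a k ht]
  · rintro ⟨A, -, rfl⟩ a k h
    by_cases ha : a ∈ A
    · simpa [restrict, ha] using h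
    · simp [restrict, ha] at h

open Classical in
theorem classicalEnergy_couplings (ϕ : Rule (Fin c)) (σ : Edge N → Spin c) :
    classicalEnergy ϕ.couplings σ = ((∑ v, ϕ.vertexEnergy (patternOf σ v) : ℤ) : ℝ) / 2 := by
  rw [classicalEnergy, Finset.sum_eq_zero, zero_add]
  · push_cast
    rw [Finset.sum_div]
    refine Finset.sum_congr rfl fun v _ => ?_
    rw [← sum_starEnergy, Int.cast_sum, Finset.sum_div, ← Finset.sum_filter]
    refine Finset.sum_congr ?_ fun t _ => rfl
    ext t
    rw [Finset.mem_filter, patternAt_iff]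
    simp
  · intro p _
    refine Finset.sum_eq_zero fun w _ => ?_
    simp [Rule.couplings]

theorem exists_leg_iff (v : Vertex N) (a : Dir) :
    (∃ e, leg v a = some e) ↔ match a with
      | .north => v.2.1 < N
      | .east => v.1.1 < N
      | .south => 0 < v.2.1
      | .west => 0 < v.1.1 := by
  cases a <;> simp [leg]

theorem mismatches_inl (τ : Edge N → Fin 2) :
    mismatches (fun e => .inl (τ e) : Edge N → Spin c) = 0 := by
  simp [mismatches]

theorem mismatches_inr (ω : Edge N → Fin c) :
    mismatches (fun e => .inr (ω e) : Edge N → Spin c) = 0 := by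
  simp [mismatches]

theorem vertexEnergy_none (ϕ : Rule (Fin c)) : ϕ.vertexEnergy (fun _ => none) = 0 := by
  have h0 : legs (fun _ : Dir => (none : Option (Fin c))) = ∅ := by simp [legs]
  have h1 : ϕ.Obeys fun _ => none := by simp [Rule.Obeys]
  have h3 : (∅ : Finset Dir) ≠ {.north, .east} := by decide
  rw [Rule.vertexEnergy, if_pos h1, h0, if_neg h3]

theorem energy_inl (C : ℝ) (ϕ : Rule (Fin c)) (τ : Edge N → Fin 2) :
    energy C ϕ.couplings (fun e => .inl (τ e)) = 0 := by
  have : ∀ v : Vertex N, patternOf (fun e => .inl (τ e) : Edge N → Spin c) v = fun _ => none := by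
    intro v
    funext a
    simp [patternOf]
  simp only [energy, mismatches_inl, classicalEnergy_couplings, this, vertexEnergy_none]
  simp

/-- The configuration obeys the rule at every vertex. -/
def Rule.Tiling (ϕ : Rule (Fin c)) (ω : Edge N → Fin c) : Prop :=
  ∀ v, ϕ.Obeys (patternOf (fun e => .inr (ω e)) v)

theorem mem_legs_patternOf_inr (ω : Edge N → Fin c) (v : Vertex N) (a : Dir) :
    a ∈ legs (patternOf (fun e => .inr (ω e)) v) ↔ ∃ e, leg v a = some e := by
  rw [mem_legs, patternOf]
  cases leg v a <;> simp

/-- In a purely classical configuration the legs of a vertex show its position: only the lower left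
corner lacks both west and south. This is how a translationally invariant interaction finds the
corner. -/
theorem legs_patternOf_inr_eq_iff (hN : 1 ≤ N) (ω : Edge N → Fin c) (v : Vertex N) :
    legs (patternOf (fun e => .inr (ω e)) v) = {.north, .east} ↔ v = 0 := by
  have hx := v.1.2
  have hy := v.2.2
  have h : legs (patternOf (fun e => .inr (ω e)) v) = {.north, .east} ↔
      v.2.1 < N ∧ v.1.1 < N ∧ ¬0 < v.2.1 ∧ ¬0 < v.1.1 := by
    rw [Finset.ext_iff]
    simp only [mem_legs_patternOf_inr, exists_leg_iff]
    constructor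
    · intro h
      have h1 := h .north
      have h2 := h .east
      have h3 := h .south
      have h4 := h .west
      simp at h1 h2 h3 h4
      exact ⟨h1, h2, by simp [h3], by simp [h4]⟩
    · rintro ⟨h1, h2, h3, h4⟩ a
      cases a <;> simp_all
  rw [h, Prod.ext_iff, Fin.ext_iff, Fin.ext_iff]
  simp only [Prod.fst_zero, Prod.snd_zero, Fin.val_zero]
  omega

theorem energy_inr_of_tiling (hN : 1 ≤ N) (C : ℝ) {ϕ : Rule (Fin c)} {ω : Edge N → Fin c}
    (h : ϕ.Tiling ω) : energy C ϕ.couplings (fun e => .inr (ω e)) = -1 / 2 := by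
  have : ∀ v, ϕ.vertexEnergy (patternOf (fun e => .inr (ω e)) v) = if v = 0 then -1 else 0 := by
    intro v
    rw [Rule.vertexEnergy, if_pos (h v)]
    exact if_congr (legs_patternOf_inr_eq_iff hN ω v) rfl rfl
  simp only [energy, mismatches_inr, classicalEnergy_couplings, this]
  simp

/-- A violation needs an output leg, an open lattice with `N ≥ 1` leaves at least one leg of each
opposite pair, and a vertex other than the corner has an input leg. The leg sets allowed by this are
exactly the corner's, which is excluded, and those with penalty 2. -/
theorem vertexEnergy_eq_two_of_not_obeys (hN : 1 ≤ N) {ϕ : Rule (Fin c)} {ω : Edge N → Fin c}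
    {v : Vertex N} (hv : v ≠ 0) (h : ¬ϕ.Obeys (patternOf (fun e => .inr (ω e)) v)) :
    ϕ.vertexEnergy (patternOf (fun e => .inr (ω e)) v) = 2 := by
  rw [Rule.vertexEnergy, if_neg h, penalty, if_neg (mt (legs_patternOf_inr_eq_iff hN ω v).1 hv),
    if_pos]
  have hlegs := mem_legs_patternOf_inr ω v
  simp only [exists_leg_iff] at hlegs
  set B := legs (patternOf (fun e => .inr (ω e)) v) with hB
  have h1 := hlegs .north
  have h2 := hlegs .east
  have h3 := hlegs .south
  have h4 := hlegs .west
  simp only at h1 h2 h3 h4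
  have hx := v.1.2
  have hy := v.2.2
  have hne : Dir.north ∈ B ∨ Dir.east ∈ B := by
    by_contra hcon
    push Not at hcon
    refine h ⟨fun k hk => ?_, fun k hk => ?_⟩
    · exact absurd (by simp [hB, mem_legs, hk]) hcon.1
    · exact absurd (by simp [hB, mem_legs, hk]) hcon.2
  have hv' : 0 < v.1.1 ∨ 0 < v.2.1 := by
    by_contra hcon
    push Not at hcon
    exact hv (Prod.ext (Fin.ext (by simpa using hcon.1)) (Fin.ext (by simpa using hcon.2)))
  have hew : Dir.east ∈ B ∨ Dir.west ∈ B := by rw [h2, h4]; omega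
  have hns : Dir.north ∈ B ∨ Dir.south ∈ B := by rw [h1, h3]; omega
  have hsw : Dir.south ∈ B ∨ Dir.west ∈ B := by rw [h3, h4]; omega
  clear_value B
  clear h1 h2 h3 h4 hlegs h hB
  revert B
  decide

/-- In half-units: if the corner obeys, its `-1` is outweighed by the `2` of some other vertex; if
it does not, it contributes `+1` itself. -/
theorem one_half_le_energy_inr (hN : 1 ≤ N) (C : ℝ) {ϕ : Rule (Fin c)} {ω : Edge N → Fin c}
    (h : ¬ϕ.Tiling ω) : 1 / 2 ≤ energy C ϕ.couplings (fun e => .inr (ω e)) := by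
  have hnn : ∀ v : Vertex N, v ≠ 0 →
      0 ≤ ϕ.vertexEnergy (patternOf (fun e => .inr (ω e)) v) := by
    intro v hv
    rw [Rule.vertexEnergy, if_neg (mt (legs_patternOf_inr_eq_iff hN ω v).1 hv)]
    split_ifs
    · exact le_rfl
    · exact penalty_nonneg _
  have hsum : 1 ≤ ∑ v : Vertex N, ϕ.vertexEnergy (patternOf (fun e => .inr (ω e)) v) := by
    rw [← Finset.add_sum_erase _ _ (Finset.mem_univ 0)]
    have hrest : ∀ v ∈ Finset.univ.erase (0 : Vertex N),
        0 ≤ ϕ.vertexEnergy (patternOf (fun e => .inr (ω e)) v) :=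
      fun v hv => hnn v (Finset.ne_of_mem_erase hv)
    have h0 := (legs_patternOf_inr_eq_iff hN ω 0).2 rfl
    by_cases hob : ϕ.Obeys (patternOf (fun e => .inr (ω e)) 0)
    · obtain ⟨v, hv⟩ := not_forall.1 h
      have hv0 : v ≠ 0 := by
        rintro rfl
        exact hv hob
      have h1 := Finset.single_le_sum hrest (Finset.mem_erase.2 ⟨hv0, Finset.mem_univ v⟩)
      rw [vertexEnergy_eq_two_of_not_obeys hN hv0 hv] at h1
      have h2 : ϕ.vertexEnergy (patternOf (fun e => .inr (ω e)) 0) = -1 := by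
        rw [Rule.vertexEnergy, if_pos hob, if_pos h0]
      omega
    · have h1 := Finset.sum_nonneg hrest
      have h2 : ϕ.vertexEnergy (patternOf (fun e => .inr (ω e)) 0) = 1 := by
        rw [Rule.vertexEnergy, if_neg hob, h0]
        decide
      omega
  simp only [energy, mismatches_inr, classicalEnergy_couplings]
  have : (1 : ℝ) ≤ ((∑ v : Vertex N, ϕ.vertexEnergy (patternOf (fun e => .inr (ω e)) v) : ℤ) : ℝ) :=
    by exact_mod_cast hsum
  simp only [CharP.cast_eq_zero, mul_zero, add_zero]
  linarith

/-! ### Domain walls -/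

open Classical in
theorem isLeft_eq_of_mismatches_eq_zero {σ : Edge N → Spin c} (h : mismatches σ = 0)
    {v : Vertex N} {e e' : Edge N} (he : e ∈ starEdges v) (he' : e' ∈ starEdges v) :
    (σ e).isLeft = (σ e').isLeft := by
  have key : ∀ e e' : Edge N, e ∈ starEdges v → e' ∈ starEdges v → (σ e).isLeft →
      (σ e').isLeft := by
    intro e e' he he' hl
    by_contra hr
    rw [mismatches, Finset.card_eq_zero] at h
    refine Finset.notMem_empty (e, e') (h ▸ Finset.mem_filter.2
      ⟨Finset.mem_univ _, ⟨?_, v, he, he'⟩, hl, ?_⟩)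
    · intro (heq : e = e')
      exact hr (heq ▸ hl)
    · rcases hx : σ e' with x | x
      · exact absurd (by rw [hx]; rfl) hr
      · rfl
  exact Bool.eq_iff_iff.2 ⟨key e e' he he', key e' e he' he⟩

theorem source_mem (e : Edge N) : e ∈ starEdges (source e) := mem_starEdges.2 (.inl rfl)

theorem target_mem (e : Edge N) : e ∈ starEdges (target e) := mem_starEdges.2 (.inr rfl)

/-- Without domain walls all spins are in the same sector, as the lattice is connected. -/
theorem isLeft_eq_of_forall_star {σ : Edge N → Spin c} (h : mismatches σ = 0) (e e' : Edge N) :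
    (σ e).isLeft = (σ e').isLeft := by
  have hstar := fun {v : Vertex N} {e e' : Edge N} => isLeft_eq_of_mismatches_eq_zero h (v := v)
    (e := e) (e' := e')
  let conn : Vertex N → Vertex N → Prop := fun v w =>
    ∀ e e', e ∈ starEdges v → e' ∈ starEdges w → (σ e).isLeft = (σ e').isLeft
  have hstep : ∀ f : Edge N, ∀ v, conn v (source f) → conn v (target f) := by
    intro f v hv e e' he he'
    exact (hv e f he (source_mem f)).trans (hstar (target_mem f) he')
  have hcol : ∀ (j : ℕ) (hj : j < N + 1), conn 0 (0, ⟨j, hj⟩) := by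
    intro j
    induction j with
    | zero => intro _ e e' he he'; exact hstar he he'
    | succ j ih => intro hj; exact hstep (.inr (0, ⟨j, by omega⟩)) 0 (ih (by omega))
  have hall : ∀ (i : ℕ) (hi : i < N + 1) (y : Fin (N + 1)), conn 0 (⟨i, hi⟩, y) := by
    intro i
    induction i with
    | zero => intro _ y; exact hcol y.1 y.2
    | succ i ih => intro hi y; exact hstep (.inl (⟨i, by omega⟩, y)) 0 (ih (by omega) y)
  have hN : 0 < N := by
    rcases e with ⟨i, -⟩ | ⟨-, i⟩ <;> exact i.pos
  have h0 : (.inr (0, ⟨0, hN⟩) : Edge N) ∈ starEdges (0 : Vertex N) :=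
    mem_starEdges.2 (.inl rfl)
  have h1 : ∀ e : Edge N, (σ (.inr (0, ⟨0, hN⟩))).isLeft = (σ e).isLeft := fun e =>
    hall (source e).1.1 (source e).1.2 (source e).2 _ e h0 (source_mem e)
  exact (h1 e).symm.trans (h1 e')

/-- A vertex other than the origin has a west or south leg. If its classical legs are just north and
east, that leg is in the Toric Code sector and forms a mismatch with the north leg. The north leg
determines the vertex, so different vertices get different mismatches; the `+ 1` is for the origin.
-/
theorem card_corners_le (hN : 1 ≤ N) (σ : Edge N → Spin c) :
    (Finset.univ.filter fun v : Vertex N => legs (patternOf σ v) = {.north, .east}).card ≤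
      mismatches σ + 1 := by
  classical
  let e₀ : Edge N := .inr (0, ⟨0, hN⟩)
  have hmem : ∀ (v : Vertex N) (a : Dir), legs (patternOf σ v) = {.north, .east} →
      (a ∈ ({.north, .east} : Finset Dir) ↔ ∃ e, leg v a = some e ∧ (σ e).isRight) := by
    intro v a hv
    rw [← hv]
    rw [mem_legs, patternOf]
    rcases leg v a with _ | e
    · simp
    · rcases h : σ e with x | x <;> simp [h]
  have hex : ∀ v : Vertex N, ∃ x : Edge N × Edge N,
      (legs (patternOf σ v) = {.north, .east} ∧ v ≠ 0) →
      (Adjacent x.1 x.2 ∧ (σ x.1).isLeft ∧ (σ x.2).isRight) ∧ leg v .north = some x.2 := by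
    intro v
    by_cases h : legs (patternOf σ v) = {.north, .east} ∧ v ≠ 0
    · obtain ⟨e, he, her⟩ := (hmem v .north h.1).1 (by decide)
      have hsw : ∃ a, a ∉ ({.north, .east} : Finset Dir) ∧ ∃ e', leg v a = some e' := by
        have : 0 < v.1.1 ∨ 0 < v.2.1 := by
          by_contra hcon
          push Not at hcon
          exact h.2 (Prod.ext (Fin.ext (by simpa using hcon.1)) (Fin.ext (by simpa using hcon.2)))
        rcases this with h' | h'
        · exact ⟨.west, by decide, (exists_leg_iff v .west).2 h'⟩
        · exact ⟨.south, by decide, (exists_leg_iff v .south).2 h'⟩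
      obtain ⟨a, ha, e', he'⟩ := hsw
      have hl : (σ e').isLeft := by
        rcases hx : σ e' with x | x
        · rfl
        · exact absurd ((hmem v a h.1).2 ⟨e', he', by rw [hx]; rfl⟩) ha
      refine ⟨(e', e), fun _ => ⟨⟨⟨?_, v, ?_, ?_⟩, hl, her⟩, he⟩⟩
      · intro (heq : e' = e)
        subst heq
        rcases hx : σ e' with x | x <;> simp [hx] at hl her
      · simpa [starEdges] using ⟨a, he'⟩
      · simpa [starEdges] using ⟨Dir.north, he⟩
    · exact ⟨(e₀, e₀), fun h' => absurd h' h⟩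
  choose f hf using hex
  have hsub : (Finset.univ.filter fun v : Vertex N => legs (patternOf σ v) = {.north, .east}) ⊆
      insert 0 (Finset.univ.filter fun v : Vertex N =>
        legs (patternOf σ v) = {.north, .east} ∧ v ≠ 0) := by
    intro v hv
    by_cases h0 : v = 0
    · simp [h0]
    · simp_all
  refine (Finset.card_le_card hsub).trans ((Finset.card_insert_le _ _).trans ?_)
  refine Nat.add_le_add_right (Finset.card_le_card_of_injOn f ?_ ?_) 1
  · intro v hv
    simp only [Finset.coe_filter, Finset.mem_univ, true_and, Set.mem_ofPred_eq] at hv ⊢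
    exact (hf v hv).1
  · intro v hv w hw hvw
    simp only [Finset.coe_filter, Finset.mem_univ, true_and, Set.mem_ofPred_eq] at hv hw
    have h1 := (hf v hv).2
    have h2 := (hf w hw).2
    rw [← hvw] at h2
    simp only [leg, Option.dite_none_right_eq_some, Option.some.injEq] at h1 h2
    obtain ⟨_, h1⟩ := h1
    obtain ⟨_, h2⟩ := h2
    have h3 := h1.trans h2.symm
    simp only [Sum.inr.injEq, Prod.mk.injEq, Fin.mk.injEq] at h3
    exact Prod.ext h3.1 (Fin.ext h3.2)

/-- With `m ≥ 1` mismatches there are at most `m + 1` bonuses of `1/2`, so the energy is at least `2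
m - (m + 1) / 2 ≥ 1`. -/
theorem one_half_le_energy_of_mixed (hN : 1 ≤ N) (ϕ : Rule (Fin c)) {σ : Edge N → Spin c}
    (h : mismatches σ ≠ 0) : 1 / 2 ≤ energy 2 ϕ.couplings σ := by
  have hv : ∀ v : Vertex N, -(if legs (patternOf σ v) = {.north, .east} then (1 : ℤ) else 0) ≤
      ϕ.vertexEnergy (patternOf σ v) := by
    intro v
    have := penalty_nonneg (legs (patternOf σ v))
    unfold Rule.vertexEnergy
    split_ifs <;> omega
  have hsum := Finset.sum_le_sum fun v (_ : v ∈ Finset.univ) => hv v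
  rw [Finset.sum_neg_distrib, ← Finset.sum_filter, Finset.sum_const, nsmul_eq_mul, mul_one] at hsum
  have hcard : ((Finset.univ.filter fun v : Vertex N =>
      legs (patternOf σ v) = {.north, .east}).card : ℤ) ≤ mismatches σ + 1 := by
    exact_mod_cast card_corners_le hN σ
  have h1 : -((mismatches σ : ℝ) + 1) ≤
      ((∑ v : Vertex N, ϕ.vertexEnergy (patternOf σ v) : ℤ) : ℝ) := by
    have : -((mismatches σ : ℤ) + 1) ≤ ∑ v : Vertex N, ϕ.vertexEnergy (patternOf σ v) := by omega
    exact_mod_cast this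
  have h2 : (1 : ℝ) ≤ mismatches σ := by exact_mod_cast Nat.one_le_iff_ne_zero.2 h
  rw [energy, classicalEnergy_couplings]
  linarith

theorem sector_cases (σ : Edge N → Spin c) :
    (∃ τ : Edge N → Fin 2, σ = fun e => .inl (τ e)) ∨
      (∃ ω : Edge N → Fin c, σ = fun e => .inr (ω e)) ∨ mismatches σ ≠ 0 := by
  by_cases h : mismatches σ = 0
  · by_cases hl : ∃ e, (σ e).isRight
    · right; left
      obtain ⟨e₀, he₀⟩ := hl
      have : ∀ e, ∃ k, σ e = .inr k := by
        intro e
        have h1 := isLeft_eq_of_forall_star h e e₀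
        rcases hk : σ e with k | k
        · rcases hk' : σ e₀ with k' | k' <;> simp [hk, hk'] at h1 he₀
        · exact ⟨k, rfl⟩
      choose ω hω using this
      exact ⟨ω, funext hω⟩
    · exact .inl (eq_inl_of_forall_not_isRight hl)
  · exact .inr (.inr h)

/-! ### Thresholds from rules -/

theorem classicalRegime_of_tiling (hN : 1 ≤ N) {J : ℝ} (hJ : 0 < J) {ϕ : Rule (Fin c)}
    {ω : Edge N → Fin c} (hω : ϕ.Tiling ω) (huniq : ∀ ω' : Edge N → Fin c, ϕ.Tiling ω' → ω' = ω) :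
    ClassicalRegime (hamiltonian N J 2 ϕ.couplings) := by
  refine classicalRegime_of_energy hJ ω (energy_inr_of_tiling hN 2 hω) fun σ hσ => ?_
  rcases sector_cases σ with ⟨τ, rfl⟩ | ⟨ω', rfl⟩ | h
  · rw [energy_inl]; norm_num
  · refine le_trans (by norm_num) (one_half_le_energy_inr hN 2 fun h => hσ ?_)
    rw [huniq ω' h]
  · exact le_trans (by norm_num) (one_half_le_energy_of_mixed hN ϕ h)

theorem toricRegime_of_not_tiling (hN : 1 ≤ N) {J : ℝ} (hJ : 0 < J) {ϕ : Rule (Fin c)}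
    (h : ∀ ω : Edge N → Fin c, ¬ϕ.Tiling ω) : ToricRegime J (hamiltonian N J 2 ϕ.couplings) := by
  refine toricRegime_of_energy hJ (energy_inl 2 ϕ) fun σ hσ => ?_
  rcases sector_cases σ with ⟨τ, rfl⟩ | ⟨ω', rfl⟩ | hm
  · simp at hσ
  · exact one_half_le_energy_inr hN 2 (h ω')
  · exact one_half_le_energy_of_mixed hN ϕ hm

theorem patternOf_inr_north (ω : Edge N → Fin c) (i j : ℕ) (hi : i < N + 1) (hj : j < N + 1) :
    patternOf (fun e => .inr (ω e)) (⟨i, hi⟩, ⟨j, hj⟩) .north =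
      if h : j < N then some (ω (.inr (⟨i, hi⟩, ⟨j, h⟩))) else none := by
  by_cases h : j < N <;> simp [patternOf, leg, h]

theorem patternOf_inr_east (ω : Edge N → Fin c) (i j : ℕ) (hi : i < N + 1) (hj : j < N + 1) :
    patternOf (fun e => .inr (ω e)) (⟨i, hi⟩, ⟨j, hj⟩) .east =
      if h : i < N then some (ω (.inl (⟨i, h⟩, ⟨j, hj⟩))) else none := by
  by_cases h : i < N <;> simp [patternOf, leg, h]

theorem patternOf_inr_south_zero (ω : Edge N → Fin c) (i : ℕ) (hi : i < N + 1) (hj : 0 < N + 1) :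
    patternOf (fun e => .inr (ω e)) (⟨i, hi⟩, ⟨0, hj⟩) .south = none := by
  simp [patternOf, leg]

theorem patternOf_inr_south_succ (ω : Edge N → Fin c) (i j : ℕ) (hi : i < N + 1)
    (hj : j + 1 < N + 1) :
    patternOf (fun e => .inr (ω e)) (⟨i, hi⟩, ⟨j + 1, hj⟩) .south =
      some (ω (.inr (⟨i, hi⟩, ⟨j, by omega⟩))) := by
  simp [patternOf, leg]

theorem patternOf_inr_west_zero (ω : Edge N → Fin c) (j : ℕ) (hi : 0 < N + 1) (hj : j < N + 1) :
    patternOf (fun e => .inr (ω e)) (⟨0, hi⟩, ⟨j, hj⟩) .west = none := by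
  simp [patternOf, leg]

theorem patternOf_inr_west_succ (ω : Edge N → Fin c) (i j : ℕ) (hi : i + 1 < N + 1)
    (hj : j < N + 1) :
    patternOf (fun e => .inr (ω e)) (⟨i + 1, hi⟩, ⟨j, hj⟩) .west =
      some (ω (.inl (⟨i, by omega⟩, ⟨j, hj⟩))) := by
  simp [patternOf, leg]

/-- The colours that the rule forces are the inputs at the next vertices. -/
theorem Rule.evolve_eq_apply (ϕ : Rule (Fin c)) (ω : Edge N → Fin c) (i j : ℕ) (hi : i < N + 1)
    (hj : j < N + 1)
    (hW : ∀ i' (h : i' + 1 = i),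
      (ϕ.evolve i' j).map Prod.snd = some (ω (.inl (⟨i', by omega⟩, ⟨j, hj⟩))))
    (hS : ∀ j' (h : j' + 1 = j),
      (ϕ.evolve i j').map Prod.fst = some (ω (.inr (⟨i, hi⟩, ⟨j', by omega⟩)))) :
    ϕ.evolve i j = ϕ (patternOf (fun e => .inr (ω e)) (⟨i, hi⟩, ⟨j, hj⟩) .west)
      (patternOf (fun e => .inr (ω e)) (⟨i, hi⟩, ⟨j, hj⟩) .south) := by
  rcases i with _ | i <;> rcases j with _ | j
  · rw [Rule.evolve, patternOf_inr_west_zero, patternOf_inr_south_zero]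
  · obtain ⟨q, hq, hq'⟩ := Option.map_eq_some_iff.1 (hS j rfl)
    rw [Rule.evolve, patternOf_inr_west_zero, patternOf_inr_south_succ, hq, Option.bind_some, hq']
  · obtain ⟨p, hp, hp'⟩ := Option.map_eq_some_iff.1 (hW i rfl)
    rw [Rule.evolve, patternOf_inr_west_succ, patternOf_inr_south_zero, hp, Option.bind_some, hp']
  · obtain ⟨q, hq, hq'⟩ := Option.map_eq_some_iff.1 (hS j rfl)
    obtain ⟨p, hp, hp'⟩ := Option.map_eq_some_iff.1 (hW i rfl)
    rw [Rule.evolve, patternOf_inr_west_succ, patternOf_inr_south_succ, hp, hq, Option.bind_some,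
      Option.bind_some, hp', hq']

/-- Induction along the diagonals `i + j = n`: the inputs of a vertex are outputs of the previous
diagonal, and obedience forces its own outputs. -/
theorem Rule.Tiling.eq_evolve {ϕ : Rule (Fin c)} {ω : Edge N → Fin c} (h : ϕ.Tiling ω) :
    ∀ (n i j : ℕ) (hi : i < N + 1) (hj : j < N + 1), i + j = n →
      (∀ h' : j < N, (ϕ.evolve i j).map Prod.fst = some (ω (.inr (⟨i, hi⟩, ⟨j, h'⟩)))) ∧
      ∀ h' : i < N, (ϕ.evolve i j).map Prod.snd = some (ω (.inl (⟨i, h'⟩, ⟨j, hj⟩))) := by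
  intro n
  induction n using Nat.strong_induction_on with
  | _ n ih =>
    intro i j hi hj hij
    have hev := ϕ.evolve_eq_apply ω i j hi hj
      (fun i' h' => (ih (i' + j) (by omega) i' j (by omega) hj rfl).2 (by omega))
      (fun j' h' => (ih (i + j') (by omega) i j' hi (by omega) rfl).1 (by omega))
    obtain ⟨h1, h2⟩ := h (⟨i, hi⟩, ⟨j, hj⟩)
    rw [← hev] at h1 h2
    rw [patternOf_inr_north] at h1
    rw [patternOf_inr_east] at h2
    exact ⟨fun h' => h1 _ (dif_pos h'), fun h' => h2 _ (dif_pos h')⟩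

theorem Rule.Tiling.survives {ϕ : Rule (Fin c)} {ω : Edge N → Fin c} (h : ϕ.Tiling ω) :
    ϕ.Survives N := by
  intro i j hi hj hij
  have := h.eq_evolve _ i j (by omega) (by omega) rfl
  rcases hij with h' | h'
  · have h1 := congrArg Option.isSome (this.2 h')
    simpa using h1
  · have h1 := congrArg Option.isSome (this.1 h')
    simpa using h1

theorem Rule.Tiling.unique {ϕ : Rule (Fin c)} {ω ω' : Edge N → Fin c} (h : ϕ.Tiling ω)
    (h' : ϕ.Tiling ω') : ω' = ω := by
  funext e
  rcases e with ⟨i, j⟩ | ⟨i, j⟩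
  · have h1 := (h.eq_evolve _ i j (by omega) j.2 rfl).2 i.2
    have h2 := (h'.eq_evolve _ i j (by omega) j.2 rfl).2 i.2
    exact Option.some_injective _ (h2.symm.trans h1)
  · have h1 := (h.eq_evolve _ i j i.2 (by omega) rfl).1 j.2
    have h2 := (h'.eq_evolve _ i j i.2 (by omega) rfl).1 j.2
    exact Option.some_injective _ (h2.symm.trans h1)

theorem Rule.Survives.exists_tiling {ϕ : Rule (Fin c)} (h : ϕ.Survives N) :
    ∃ ω : Edge N → Fin c, ϕ.Tiling ω := by
  let ω : Edge N → Fin c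
    | .inl (i, j) => ((ϕ.evolve i j).get (h i j (by omega) (by omega) (.inl i.2))).2
    | .inr (i, j) => ((ϕ.evolve i j).get (h i j (by omega) (by omega) (.inr j.2))).1
  have hl : ∀ (i j : ℕ) (hi : i < N) (hj : j < N + 1),
      (ϕ.evolve i j).map Prod.snd = some (ω (.inl (⟨i, hi⟩, ⟨j, hj⟩))) := by
    intro i j hi hj
    rw [← Option.some_get (h i j (by omega) (by omega) (.inl hi)), Option.map_some]
  have hr : ∀ (i j : ℕ) (hi : i < N + 1) (hj : j < N),
      (ϕ.evolve i j).map Prod.fst = some (ω (.inr (⟨i, hi⟩, ⟨j, hj⟩))) := by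
    intro i j hi hj
    rw [← Option.some_get (h i j (by omega) (by omega) (.inr hj)), Option.map_some]
  refine ⟨ω, fun v => ?_⟩
  obtain ⟨⟨i, hi⟩, ⟨j, hj⟩⟩ := v
  have hev := ϕ.evolve_eq_apply ω i j hi hj (fun i' h' => hl i' j (by omega) hj)
    (fun j' h' => hr i j' hi (by omega))
  unfold Rule.Obeys
  rw [← hev, patternOf_inr_north, patternOf_inr_east]
  refine ⟨fun k hk => ?_, fun k hk => ?_⟩
  · rw [Option.dite_none_right_eq_some] at hk
    obtain ⟨h1, h2⟩ := hk
    rw [hr i j hi h1, h2]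
  · rw [Option.dite_none_right_eq_some] at hk
    obtain ⟨h1, h2⟩ := hk
    rw [hl i j h1 hj, h2]

end RuleEnergy

/-- A tiling of the `N × N` lattice exists exactly if the rule survives `N`, it is then unique, and
survival passes to smaller sizes. -/
theorem isThreshold_of_survives {c n : ℕ} (hn : 1 ≤ n) {ϕ : Rule (Fin c)} (h : ϕ.Survives n)
    (h' : ¬ϕ.Survives (n + 1)) : IsThreshold 2 (c + 2) n := by
  refine ⟨ϕ.couplings, ϕ.couplings_admissible, hn, fun J hJ N hN => ⟨fun hNn => ?_, fun hnN => ?_⟩⟩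
  · obtain ⟨ω, hω⟩ := (h.mono hNn).exists_tiling
    exact classicalRegime_of_tiling hN hJ hω fun ω' hω' => hω.unique hω'
  · exact toricRegime_of_not_tiling hN hJ fun ω hω => h' (hω.survives.mono hnN)

theorem exists_isThreshold_of_survives {K : Type*} {c m : ℕ} (e : K ≃ Fin c) (hm : 1 ≤ m)
    {ϕ : Rule K} (h : ϕ.Survives m) {i j : ℕ} (hij : ϕ.evolve i j = none) :
    ∃ n, m ≤ n ∧ IsThreshold 2 (c + 2) n := by
  classical
  rw [← Rule.survives_rename e] at h
  have hex : ∃ n, ¬(ϕ.rename e).Survives n := by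
    -- The stuck vertex `(i, j)` lies in this lattice and has output legs there.
    refine ⟨i + j + 1, fun hs => ?_⟩
    have := hs i j (by omega) (by omega) (by omega)
    simp [Rule.evolve_rename, hij] at this
  have hlt : m < Nat.find hex := by
    by_contra hle
    exact Nat.find_spec hex (h.mono (not_lt.1 hle))
  refine ⟨Nat.find hex - 1, by omega, isThreshold_of_survives (ϕ := ϕ.rename e) (by omega) ?_ ?_⟩
  · exact not_not.1 (Nat.find_min hex (by omega))
  · rw [Nat.sub_add_cancel (by omega)]
    exact Nat.find_spec hex

/-! ### Counters -/

/-- A rule given by a function on natural numbers, read modulo the number of colours. -/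
def Rule.ofNat (c : ℕ) [NeZero c] (ψ : Rule ℕ) : Rule (Fin c) :=
  fun w s => (ψ (w.map Fin.val) (s.map Fin.val)).map (Prod.map (Fin.ofNat c) (Fin.ofNat c))

/-- As long as the explicit solution stays below `c`, reduction modulo `c` is invisible and the
equations can be checked in the natural numbers. -/
theorem Rule.evolve_ofNat_eq {c : ℕ} [NeZero c] {ψ : Rule ℕ} {P : ℕ → ℕ → Prop} {v h : ℕ → ℕ → ℕ}
    (hPi : ∀ i j, P (i + 1) j → P i j) (hPj : ∀ i j, P i (j + 1) → P i j)
    (hv : ∀ i j, P i j → v i j < c) (hh : ∀ i j, P i j → h i j < c)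
    (h00 : ψ none none = some (v 0 0, h 0 0))
    (hi0 : ∀ i, P (i + 1) 0 → ψ (some (h i 0)) none = some (v (i + 1) 0, h (i + 1) 0))
    (h0j : ∀ j, P 0 (j + 1) → ψ none (some (v 0 j)) = some (v 0 (j + 1), h 0 (j + 1)))
    (hij : ∀ i j, P (i + 1) (j + 1) → ψ (some (h i (j + 1))) (some (v (i + 1) j)) =
      some (v (i + 1) (j + 1), h (i + 1) (j + 1))) {i j : ℕ} (hP : P i j) :
    (Rule.ofNat c ψ).evolve i j = some (Fin.ofNat c (v i j), Fin.ofNat c (h i j)) := by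
  have hv' : ∀ i j, P i j → (Fin.ofNat c (v i j)).val = v i j := fun i j hP =>
    Nat.mod_eq_of_lt (hv i j hP)
  have hh' : ∀ i j, P i j → (Fin.ofNat c (h i j)).val = h i j := fun i j hP =>
    Nat.mod_eq_of_lt (hh i j hP)
  refine Rule.evolve_eq_of_solution (P := P) (v := fun i j => Fin.ofNat c (v i j))
    (h := fun i j => Fin.ofNat c (h i j)) hPi hPj (fun _ => ?_) (fun i hP => ?_) (fun j hP => ?_)
    (fun i j hP => ?_) i j hP
  · simp [Rule.ofNat, h00]
  · rw [Rule.ofNat, Option.map_some, hh' i 0 (hPi _ _ hP), Option.map_none, hi0 i hP]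
    rfl
  · rw [Rule.ofNat, Option.map_some, hv' 0 j (hPj _ _ hP), Option.map_none, h0j j hP]
    rfl
  · rw [Rule.ofNat, Option.map_some, Option.map_some, hh' i (j + 1) (hPi _ _ hP),
      hv' (i + 1) j (hPj _ _ hP), hij i j hP]
    rfl

/-- The `k`-th digit of `n` in base `b`. -/
def digit (b k n : ℕ) : ℕ := n / b ^ k % b

theorem digit_lt {b : ℕ} (hb : 0 < b) (k n : ℕ) : digit b k n < b := Nat.mod_lt _ hb

theorem digit_succ_of_not_dvd {b k n : ℕ} (h : ¬b ^ k ∣ n + 1) :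
    digit b k (n + 1) = digit b k n := by
  rw [digit, Nat.succ_div, if_neg h, add_zero, digit]

/-- The condition `b ^ k ∣ n + 1` says that the increment of `n` carries into digit `k`; whether it
carries on depends on that digit being `b - 1`. -/
theorem digit_succ_of_dvd {b k n : ℕ} (h : b ^ k ∣ n + 1) :
    (digit b k n + 1 < b → ¬b ^ (k + 1) ∣ n + 1 ∧ digit b k (n + 1) = digit b k n + 1) ∧
      (digit b k n + 1 = b → b ^ (k + 1) ∣ n + 1 ∧ digit b k (n + 1) = 0) := by
  have h1 : (n + 1) / b ^ k = n / b ^ k + 1 := by rw [Nat.succ_div, if_pos h]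
  have h2 : b ^ (k + 1) ∣ n + 1 ↔ b ∣ n / b ^ k + 1 := by
    rw [pow_succ, ← h1]
    exact (Nat.dvd_div_iff_mul_dvd h).symm
  have h3 := Nat.div_add_mod (n / b ^ k) b
  rw [h2, digit, digit, h1]
  constructor
  · intro hlt
    have h4 : (n / b ^ k + 1) % b = n / b ^ k % b + 1 := by
      conv_lhs => rw [← h3, add_assoc, Nat.mul_add_mod, Nat.mod_eq_of_lt hlt]
    exact ⟨fun hd => by rw [Nat.dvd_iff_mod_eq_zero, h4] at hd; omega, h4⟩
  · intro heq
    have h4 : b ∣ n / b ^ k + 1 := ⟨n / b ^ k / b + 1, by rw [mul_add, mul_one]; omega⟩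
    exact ⟨h4, Nat.dvd_iff_mod_eq_zero.1 h4⟩

/-- A counter with `k + 1` digits in base `c` that starts from `off` and gets stuck at overflow.
The vertical edges in column `i` carry the `i`-th digit, and the horizontal edges between the
columns `i` and `i + 1` carry `2 i`, or `2 i + 1` if there is a carry. -/
def counterRule (c k off : ℕ) : Rule ℕ
  | none, none => some (digit c 0 off, 0)
  | some x, none => some (digit c (x / 2 + 1) off, if x / 2 + 1 < k then 2 * (x / 2 + 1) else x)
  | none, some d => if d + 1 < c then some (d + 1, 0) else some (0, 1)
  | some x, some d =>
    if x % 2 = 0 then some (d, if x / 2 + 1 < k then 2 * (x / 2 + 1) else x)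
    else if d + 1 < c then some (d + 1, if x / 2 + 1 < k then 2 * (x / 2 + 1) else 2 * (x / 2))
    else if x / 2 + 1 < k then some (0, 2 * (x / 2 + 1) + 1) else none

/-- Row `j` holds `off + j`, so the overflow occurs in row `n + 1`, at the leading digit in column
`k`. The labels `2 i` and `2 i + 1` with `i < k` need `2 k` colours. -/
theorem counterRule_evolve {c k off n : ℕ} [NeZero c] (hk : 1 ≤ k) (hkc : 2 * k ≤ c)
    (hn : off + (n + 1) = c ^ (k + 1)) :
    (∀ i j, j ≤ n → ((Rule.ofNat c (counterRule c k off)).evolve i j).isSome) ∧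
      (Rule.ofNat c (counterRule c k off)).evolve k (n + 1) = none := by
  have hc : 0 < c := by omega
  set v : ℕ → ℕ → ℕ := fun i j => if i ≤ k then digit c i (off + j) else digit c k off with hvdef
  -- The condition `0 < j` is needed since row 0 is written, not incremented. From column `k` on
  -- there is no carry and the label stays at its last even value.
  set h : ℕ → ℕ → ℕ := fun i j =>
    if i < k then 2 * i + (if 0 < j ∧ c ^ (i + 1) ∣ off + j then 1 else 0)
    else 2 * (k - 1) with hhdef
  -- In the overflow row the solution is still valid to the left of the leading digit.
  have hsol : ∀ i j, (j < n + 1 ∨ i < k) → (Rule.ofNat c (counterRule c k off)).evolve i j =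
      some (Fin.ofNat c (v i j), Fin.ofNat c (h i j)) := by
    intro i j hP
    refine Rule.evolve_ofNat_eq (P := fun i j => j < n + 1 ∨ i < k) (fun i j => by omega)
      (fun i j => by omega) (fun i j _ => ?_) (fun i j _ => ?_) ?_ (fun i _ => ?_) (fun j _ => ?_)
      (fun i j hP => ?_) hP
    · simp only [hvdef]
      split_ifs <;> exact digit_lt hc _ _
    · simp only [hhdef]
      split_ifs <;> omega
    · simp [counterRule, hvdef, hhdef, show 0 < k by omega]
    · simp only [counterRule, hvdef, hhdef, lt_irrefl, false_and, if_false, add_zero]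
      by_cases h1 : i + 1 < k
      · simp [h1, show i < k by omega, show i + 1 ≤ k by omega]
      · by_cases h2 : i < k
        · have h3 : i + 1 = k := by omega
          subst h3
          simp
        · have h3 : k - 1 + 1 = k := by omega
          simp only [h2, h1, if_false, show ¬i + 1 ≤ k by omega]
          rw [Nat.mul_div_cancel_left _ two_pos, h3, if_neg (lt_irrefl k)]
    · have hdvd : c ^ 0 ∣ off + j + 1 := by simp
      have hd := digit_lt hc 0 (off + j)
      simp only [counterRule, hvdef, hhdef, Nat.zero_le, if_true, show 0 < k by omega,
        Nat.succ_pos, true_and, mul_zero, zero_add, ← add_assoc]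
      rcases lt_or_ge (digit c 0 (off + j) + 1) c with hlt | hge
      · obtain ⟨h1, h2⟩ := (digit_succ_of_dvd hdvd).1 hlt
        rw [zero_add] at h1
        rw [if_pos hlt, h2, if_neg h1]
      · obtain ⟨h1, h2⟩ := (digit_succ_of_dvd hdvd).2 (by omega)
        rw [zero_add] at h1
        rw [if_neg (not_lt.2 hge), h2, if_pos h1]
    · have hd := digit_lt hc (i + 1) (off + j)
      simp only [counterRule, hvdef, hhdef, Nat.succ_pos, true_and, ← add_assoc]
      by_cases h2 : i < k
      · simp only [h2, if_true, show i + 1 ≤ k by omega]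
        by_cases hdvd : c ^ (i + 1) ∣ off + j + 1
        · rw [if_pos hdvd, if_neg (by omega), show (2 * i + 1) / 2 = i by omega]
          rcases lt_or_ge (digit c (i + 1) (off + j) + 1) c with hlt | hge
          · obtain ⟨h4, h5⟩ := (digit_succ_of_dvd hdvd).1 hlt
            rw [if_pos hlt, h5, if_neg h4]
            by_cases h1 : i + 1 < k
            · simp [h1]
            · simp [h1, show k - 1 = i by omega]
          · obtain ⟨h4, h5⟩ := (digit_succ_of_dvd hdvd).2 (by omega)
            rw [if_neg (not_lt.2 hge), h5, if_pos h4]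
            by_cases h1 : i + 1 < k
            · simp [h1]
            · exfalso
              rw [show i + 1 + 1 = k + 1 by omega] at h4
              have := Nat.le_of_dvd (by omega) h4
              omega
        · have h4 : ¬c ^ (i + 1 + 1) ∣ off + j + 1 := fun h =>
            hdvd ((pow_dvd_pow c (by omega)).trans h)
          rw [if_neg hdvd, digit_succ_of_not_dvd hdvd, if_neg h4, add_zero, if_pos (by omega),
            Nat.mul_div_cancel_left _ two_pos]
          by_cases h1 : i + 1 < k
          · simp [h1]
          · simp [h1, show k - 1 = i by omega]
      · simp only [h2, if_false, show ¬i + 1 ≤ k by omega, show ¬i + 1 < k by omega]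
        rw [if_pos (by omega), Nat.mul_div_cancel_left _ two_pos, if_neg (by omega)]
  refine ⟨fun i j hj => by rw [hsol i j (by omega)]; rfl, ?_⟩
  obtain ⟨k, rfl⟩ : ∃ k', k = k' + 1 := ⟨k - 1, by omega⟩
  rw [Rule.evolve, hsol k (n + 1) (by omega), hsol (k + 1) n (by omega), Option.bind_some,
    Option.bind_some]
  have hd := digit_lt hc (k + 1) (off + n)
  have hvk : v (k + 1) n = c - 1 := by
    simp only [hvdef, le_refl, if_true]
    have hdvd : c ^ (k + 1) ∣ off + n + 1 := by
      rw [add_assoc, hn]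
      exact pow_dvd_pow c (by omega)
    by_contra hne
    refine ((digit_succ_of_dvd hdvd).1 (by omega)).1 ?_
    rw [show off + n + 1 = off + (n + 1) by omega, hn]
  have hhk : h k (n + 1) = 2 * k + 1 := by
    simp only [hhdef, Nat.lt_succ_self, if_true, Nat.succ_pos, true_and]
    rw [if_pos]
    rw [hn]
    exact pow_dvd_pow c (by omega)
  have hv' : (Fin.ofNat c (c - 1)).val = c - 1 := Nat.mod_eq_of_lt (by omega)
  have hh' : (Fin.ofNat c (2 * k + 1)).val = 2 * k + 1 := Nat.mod_eq_of_lt (by omega)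
  rw [hvk, hhk]
  simp only [Rule.ofNat, Option.map_some, hv', hh', counterRule, Option.map_eq_none_iff]
  rw [if_neg (by omega), if_neg (by omega), if_neg (by omega)]

/-- Counters realise every threshold below `c ^ (k + 1)`. -/
theorem isThreshold_of_lt_pow {c k n : ℕ} (hk : 1 ≤ k) (hkc : 2 * k ≤ c) (hkn : k ≤ n)
    (hn : n < c ^ (k + 1)) : IsThreshold 2 (c + 2) n := by
  have : NeZero c := ⟨by omega⟩
  -- This offset puts the overflow into row `n + 1`; by `k ≤ n` the stuck vertex has an east leg in
  -- the lattice of size `n + 1`.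
  obtain ⟨h1, h2⟩ := counterRule_evolve (off := c ^ (k + 1) - (n + 1)) (n := n) hk hkc (by omega)
  refine isThreshold_of_survives (by omega) (fun i j _ hj _ => h1 i j hj) fun hs => ?_
  have := hs k (n + 1) (by omega) le_rfl (by omega)
  rw [h2] at this
  simp at this

/-- A counter whose length is the period of another counter. In the first `b + 1` columns the
vertical edges carry the digits in base `b` of the row, and the horizontal edges the carry. The
next column changes from `b` to `b + 1` when the first counter overflows. To the right of it, the
horizontal edges carry binary digits `2`, `3` below that row and `4` above, and the vertical edges
the carry. The rule gets stuck if the carry reaches a `4`. -/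
def doubleCounterRule (b : ℕ) : Rule ℕ
  | none, none => some (0, 0)
  | some x, none =>
    if x < b then some (0, x + 1) else if x = b then some (b, x + 1) else some (1, x)
  | none, some d => if d + 1 < b then some (d + 1, 0) else some (0, 1)
  | some x, some d =>
    if x = 0 then if d < b then some (d, 0) else if d = b then some (b, 2) else some (b + 1, 4)
    else if x = 1 then
      if d + 1 < b then some (d + 1, 0) else if d < b then some (0, 1) else some (b + 1, 4)
    else if d = 0 then some (0, x)
    else if x = 2 then some (0, 3)
    else if x = 3 then some (1, 2) else none

/-- The vertical counter marks row `R`. To the right of column `b + 1` the rows `1, …, R - 1` hold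
the `R - 1` binary digits of the column number `t`, counted from that column. Its carry first
reaches row `R` at `t = 2 ^ (R - 1)`. The bound `3 ≤ b` makes room for the colour 4. -/
theorem doubleCounterRule_evolve {b R : ℕ} (hb : 3 ≤ b) (hR : R = b ^ (b + 1)) :
    (∀ i j, i ≤ 2 ^ (R - 1) → ((Rule.ofNat (b + 2) (doubleCounterRule b)).evolve i j).isSome) ∧
      (Rule.ofNat (b + 2) (doubleCounterRule b)).evolve (b + 1 + 2 ^ (R - 1)) R = none := by
  have hR1 : 1 < R := hR ▸ Nat.one_lt_pow (by omega) (by omega)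
  have hb0 : 0 < b := by omega
  set v : ℕ → ℕ → ℕ := fun i j =>
    if i < b + 1 then digit b i j
    else if i = b + 1 then (if j < R then b else b + 1)
    else if j < R ∧ 2 ^ j ∣ i - (b + 1) then 1 else 0 with hvdef
  set h : ℕ → ℕ → ℕ := fun i j =>
    if j = 0 then min i (b + 1)
    else if i < b + 1 then (if b ^ (i + 1) ∣ j then 1 else 0)
    else if j < R then 2 + digit 2 (j - 1) (i - (b + 1)) else 4 with hhdef
  -- Below row `R` nothing gets stuck in any column.
  have hsol : ∀ i j, (i < b + 1 + 2 ^ (R - 1) ∨ j < R) →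
      (Rule.ofNat (b + 2) (doubleCounterRule b)).evolve i j =
        some (Fin.ofNat (b + 2) (v i j), Fin.ofNat (b + 2) (h i j)) := by
    intro i j hP
    refine Rule.evolve_ofNat_eq (P := fun i j => i < b + 1 + 2 ^ (R - 1) ∨ j < R)
      (fun i j => by omega) (fun i j => by omega) (fun i j _ => ?_) (fun i j _ => ?_) ?_
      (fun i _ => ?_) (fun j _ => ?_) (fun i j hP => ?_) hP
    · have := digit_lt hb0 i j
      simp only [hvdef]
      split_ifs <;> omega
    · have := digit_lt two_pos (j - 1) (i - (b + 1))
      simp only [hhdef]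
      split_ifs <;> omega
    · simp [doubleCounterRule, hvdef, hhdef, digit]
    · simp only [doubleCounterRule, hvdef, hhdef, if_true]
      rcases lt_trichotomy i b with h1 | h1 | h1
      · simp [h1, show min i (b + 1) = i by omega, show min (i + 1) (b + 1) = i + 1 by omega, digit]
      · simp [h1, show 0 < R by omega]
      · simp [show min i (b + 1) = b + 1 by omega, show min (i + 1) (b + 1) = b + 1 by omega,
          show ¬i < b by omega, show i ≠ b by omega, show 0 < R by omega]
    · have hdvd : b ^ 0 ∣ j + 1 := by simp
      have hd := digit_lt hb0 0 j
      simp only [doubleCounterRule, hvdef, hhdef, Nat.succ_pos, if_true, zero_add,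
        Nat.add_eq_zero_iff, one_ne_zero, and_false, if_false]
      rcases lt_or_ge (digit b 0 j + 1) b with hlt | hge
      · obtain ⟨h1, h2⟩ := (digit_succ_of_dvd hdvd).1 hlt
        rw [zero_add] at h1
        rw [if_pos hlt, h2, if_neg h1]
      · obtain ⟨h1, h2⟩ := (digit_succ_of_dvd hdvd).2 (by omega)
        rw [zero_add] at h1
        rw [if_neg (not_lt.2 hge), h2, if_pos h1]
    · simp only [doubleCounterRule, hvdef, hhdef, Nat.add_eq_zero_iff, one_ne_zero, and_false,
        if_false, Nat.add_right_cancel_iff, Nat.add_lt_add_iff_right]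
      rcases lt_trichotomy i b with h1 | h1 | h1
      · have hd := digit_lt hb0 (i + 1) j
        simp only [h1, if_true, show i < b + 1 by omega]
        by_cases hdvd : b ^ (i + 1) ∣ j + 1
        · rw [if_pos hdvd, if_neg one_ne_zero, if_pos rfl]
          rcases lt_or_ge (digit b (i + 1) j + 1) b with hlt | hge
          · obtain ⟨h4, h5⟩ := (digit_succ_of_dvd hdvd).1 hlt
            rw [if_pos hlt, h5, if_neg h4]
          · obtain ⟨h4, h5⟩ := (digit_succ_of_dvd hdvd).2 (by omega)
            rw [if_neg (not_lt.2 hge), if_pos hd, h5, if_pos h4]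
        · have h4 : ¬b ^ (i + 1 + 1) ∣ j + 1 := fun h =>
            hdvd ((pow_dvd_pow b (by omega)).trans h)
          rw [if_neg hdvd, digit_succ_of_not_dvd hdvd, if_neg h4, if_pos rfl, if_pos hd]
      · subst h1
        simp only [lt_irrefl, if_false, if_true, Nat.lt_succ_self, Nat.sub_self, ← hR]
        have h0 : digit 2 (j + 1 - 1) 0 = 0 := by simp [digit]
        rw [h0, add_zero]
        rcases lt_trichotomy (j + 1) R with h2 | h2 | h2
        · have h3 : ¬R ∣ j + 1 := fun h => by
            have := Nat.le_of_dvd (by omega) h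
            omega
          simp [h2, h3, show j < R by omega]
        · simp [h2, show j < R by omega]
        -- The first counter keeps overflowing with period `R`, but the marking column ignores all
        -- overflows after the first.
        · by_cases h3 : R ∣ j + 1
          · simp [h3, show ¬j < R by omega, show ¬j + 1 < R by omega]
            omega
          · simp [h3, show ¬j < R by omega, show ¬j + 1 < R by omega]
      · obtain ⟨t, rfl⟩ : ∃ t, i = b + 1 + t := ⟨i - (b + 1), by omega⟩
        have e1 : b + 1 + t + 1 - (b + 1) = t + 1 := by omega
        simp only [show ¬b + 1 + t < b by omega, show b + 1 + t ≠ b by omega, if_false,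
          show ¬b + 1 + t < b + 1 by omega, Nat.add_sub_cancel_left, e1, Nat.add_sub_cancel]
        have hd := digit_lt two_pos j t
        rcases lt_trichotomy (j + 1) R with h2 | h2 | h2
        · simp only [h2, show j < R by omega, if_true, true_and]
          rw [if_neg (by omega), if_neg (by omega)]
          by_cases hdvd : 2 ^ j ∣ t + 1
          · rw [if_pos hdvd, if_neg one_ne_zero]
            rcases lt_or_ge (digit 2 j t + 1) 2 with hlt | hge
            · obtain ⟨h4, h5⟩ := (digit_succ_of_dvd hdvd).1 hlt
              rw [if_pos (by omega), h5, if_neg h4, show digit 2 j t = 0 by omega]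
            · obtain ⟨h4, h5⟩ := (digit_succ_of_dvd hdvd).2 (by omega)
              rw [if_neg (by omega), if_pos (by omega), h5, if_pos h4]
          · have h4 : ¬2 ^ (j + 1) ∣ t + 1 := fun h =>
              hdvd ((pow_dvd_pow 2 (by omega)).trans h)
            rw [if_neg hdvd, if_pos rfl, if_neg h4, digit_succ_of_not_dvd hdvd]
        · have h3 : ¬2 ^ j ∣ t + 1 := fun h => by
            have := Nat.le_of_dvd (by omega) h
            have h4 : R - 1 = j := by omega
            rw [h4] at hP
            omega
          simp [h3, h2]
        · simp [show ¬j < R by omega, show ¬j + 1 < R by omega]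
  refine ⟨fun i j hi => by rw [hsol i j (by omega)]; rfl, ?_⟩
  obtain ⟨R, rfl⟩ : ∃ R', R = R' + 1 := ⟨R - 1, by omega⟩
  obtain ⟨T, hT⟩ : ∃ T, 2 ^ R = T + 1 := ⟨2 ^ R - 1, by have := Nat.one_le_two_pow (n := R); omega⟩
  simp only [Nat.add_sub_cancel] at hsol ⊢
  rw [hT] at hsol ⊢
  rw [← add_assoc, Rule.evolve, hsol (b + 1 + T) (R + 1) (by omega),
    hsol (b + 1 + T + 1) R (by omega), Option.bind_some, Option.bind_some]
  have hvk : v (b + 1 + T + 1) R = 1 := by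
    simp only [hvdef]
    have hd : 2 ^ R ∣ b + 1 + T + 1 - (b + 1) := by
      rw [hT, show b + 1 + T + 1 - (b + 1) = T + 1 by omega]
    rw [if_neg (by omega), if_neg (by omega), if_pos ⟨by omega, hd⟩]
  have hhk : h (b + 1 + T) (R + 1) = 4 := by
    simp only [hhdef]
    rw [if_neg (by omega), if_neg (by omega), if_neg (by omega)]
  have hv' : (Fin.ofNat (b + 2) 1).val = 1 := Nat.mod_eq_of_lt (by omega)
  have hh' : (Fin.ofNat (b + 2) 4).val = 4 := Nat.mod_eq_of_lt (by omega)
  rw [hvk, hhk]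
  simp only [Rule.ofNat, Option.map_some, hv', hh', doubleCounterRule, Option.map_eq_none_iff]
  simp

theorem exists_isThreshold_two_pow {b : ℕ} (hb : 3 ≤ b) :
    ∃ n, 2 ^ (b ^ (b + 1) - 1) ≤ n ∧ IsThreshold 2 (b + 2 + 2) n := by
  obtain ⟨h1, h2⟩ := doubleCounterRule_evolve hb rfl
  exact exists_isThreshold_of_survives (Equiv.refl _) Nat.one_le_two_pow
    (fun i j hi _ _ => h1 i j hi) h2

/-- Crude comparison by `52 ≤ 16²` and `10 ≤ 16`, which avoids evaluating the large powers. -/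
theorem mul_ten_pow_le_two_pow {m e : ℕ} (h : 4 * (2 + m) ≤ e) : 52 * 10 ^ m ≤ 2 ^ e :=
  calc 52 * 10 ^ m ≤ (2 ^ 4) ^ 2 * (2 ^ 4) ^ m :=
        Nat.mul_le_mul (by norm_num) (Nat.pow_le_pow_left (by norm_num) _)
    _ = 2 ^ (4 * (2 + m)) := by rw [← pow_add, ← pow_mul]
    _ ≤ 2 ^ e := Nat.pow_le_pow_right two_pos h

/-! ### Turing machines -/

section Simulation

variable {q : ℕ} (M : Machine q) (z : Fin q) (r : Bool)

/-- Colours of the space-time diagram of a machine: tape symbols and states. The state `z` also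
serves as a spacer between the symbols. -/
abbrev Colour (q : ℕ) : Type := Bool ⊕ Fin q

/-- The colour of the head. -/
def headColour (s : Fin q) : Colour q := if s = z then .inl false else .inr s

/-- The symbol and the state that a transition emits, to the north and to the east. -/
def transition (s : Fin q) (a : Bool) : Option (Colour q × Colour q) :=
  match M s a with
  | (_, _, none) => none
  | (b, .right, some s') => some (.inl b, .inr s')
  | (b, .left, some s') => some (.inr s', .inl b)

/-- The rule that draws the space-time diagram of a machine along the diagonals. The Boolean `r`
says that the state `z` is entered by moves to the right only (otherwise: to the left only). -/
def machineRule (s₀ : Fin q) : Rule (Colour q)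
  | none, none => some (headColour z s₀, .inl false)
  | none, some x => if x = .inr z then some (.inl false, .inr z) else some (.inr z, x)
  | some x, none => if x = .inr z then some (.inr z, .inl false) else some (x, .inr z)
  | some (.inl a), some (.inl b) => transition M z (a || b)
  | some (.inl a), some (.inr s) => if s = z then some (.inl a, .inr z) else transition M s a
  | some (.inr s), some (.inl a) => if s = z then some (.inr z, .inl a) else transition M s a
  | some (.inr s), some (.inr s') =>
    if s = z ∧ s' = z then
      if r then some (.inr z, .inl false) else some (.inl false, .inr z)
    else some (.inr s', .inr s)

/-- The west input of cell `m` at an even time; `d` tells from which side the head has come. -/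
def westInput (d : Bool) (s : Fin q) (a : ℤ → Bool) (p m : ℤ) : Colour q :=
  if m < p then .inl (a m) else if p < m then .inr z else if d then headColour z s else .inl (a m)

/-- The south input of cell `m` at an even time; `d` tells from which side the head has come. -/
def southInput (d : Bool) (s : Fin q) (a : ℤ → Bool) (p m : ℤ) : Colour q :=
  if m < p then .inr z else if p < m then .inl (a m) else if d then .inl (a m) else headColour z s

/-- The outputs of cell `m` at an even time. -/
def cellOutput (s : Fin q) (a : ℤ → Bool) (p m : ℤ) : Option (Colour q × Colour q) :=
  if m < p then some (.inl (a m), .inr z) else if p < m then some (.inr z, .inl (a m))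
  else transition M s (a m)

variable {M z r} {s₀ s s' : Fin q} {a : ℤ → Bool} {p m : ℤ} {d b : Bool}

/-- Away from the head, the spacer tells on which side of the head a cell lies. State `z` arrives as
a blank, so that two symbols meet and their disjunction is the scanned one. -/
theorem machineRule_input :
    machineRule M z r s₀ (some (westInput z d s a p m)) (some (southInput z d s a p m)) =
      cellOutput M z s a p m := by
  unfold westInput southInput cellOutput headColour
  rcases lt_trichotomy m p with h | h | h
  · simp [h, machineRule]
  · by_cases hs : s = z <;> cases d <;> simp [h, hs, machineRule]
  · simp [h, not_lt.2 h.le, machineRule]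

/-- Between two even times, symbols and spacers return to the cell that sent them, while the head
changes places with the spacer of the neighbouring cell. If the new state is `z`, two equal colours
meet and the direction is lost; `r` restores it. -/
theorem machineRule_right (hr : ∀ s a b mv, M s a = (b, mv, some z) → (mv = .right ↔ r = true))
    (hM : M s (a p) = (b, .right, some s')) {x y x' y' : Colour q}
    (h : cellOutput M z s a p m = some (x, y)) (h' : cellOutput M z s a p (m + 1) = some (x', y')) :
    machineRule M z r s₀ (some y) (some x') =
      some (southInput z true s' (Function.update a p b) (p + 1) m,
        westInput z true s' (Function.update a p b) (p + 1) (m + 1)) := by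
  have hz : s' = z → r = true := fun h => (hr s (a p) b .right (h ▸ hM)).1 rfl
  unfold cellOutput at h h'
  unfold southInput westInput headColour
  rcases lt_trichotomy (m + 1) p with h1 | h1 | h1
  · rw [if_pos (by omega)] at h h'
    simp only [Option.some.injEq, Prod.mk.injEq] at h h'
    rw [← h.2, ← h'.1, if_pos (by omega), if_pos (by omega), Function.update_of_ne (by omega)]
    simp [machineRule]
  · subst h1
    rw [if_pos (by omega)] at h
    rw [if_neg (by omega), if_neg (by omega), transition, hM] at h'
    simp only [Option.some.injEq, Prod.mk.injEq] at h h'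
    rw [← h.2, ← h'.1, if_pos (by omega), if_pos (by omega), Function.update_self]
    simp [machineRule]
  · rcases (show m = p ∨ p < m by omega) with rfl | h2
    · rw [if_neg (by omega), if_neg (by omega), transition, hM] at h
      rw [if_neg (by omega), if_pos (by omega)] at h'
      simp only [Option.some.injEq, Prod.mk.injEq] at h h'
      rw [← h.2, ← h'.1, if_pos (by omega), if_neg (by omega), if_neg (by omega), if_pos rfl]
      by_cases hs : s' = z
      · simp [machineRule, hs, hz hs]
      · simp [machineRule, hs]
    · rw [if_neg (by omega), if_pos (by omega)] at h h'
      simp only [Option.some.injEq, Prod.mk.injEq] at h h'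
      rw [← h.2, ← h'.1, if_neg (by omega), if_neg (show ¬m + 1 < p + 1 by omega),
        if_pos (show p + 1 < m + 1 by omega), Function.update_of_ne (by omega)]
      simp [machineRule]

theorem machineRule_left (hr : ∀ s a b mv, M s a = (b, mv, some z) → (mv = .right ↔ r = true))
    (hM : M s (a p) = (b, .left, some s')) {x y x' y' : Colour q}
    (h : cellOutput M z s a p m = some (x, y)) (h' : cellOutput M z s a p (m + 1) = some (x', y')) :
    machineRule M z r s₀ (some y) (some x') =
      some (southInput z false s' (Function.update a p b) (p - 1) m,
        westInput z false s' (Function.update a p b) (p - 1) (m + 1)) := by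
  have hz : s' = z → r = false := fun h => by
    have := hr s (a p) b .left (h ▸ hM)
    simpa using this
  unfold cellOutput at h h'
  unfold southInput westInput headColour
  rcases lt_trichotomy (m + 1) p with h1 | h1 | h1
  · rw [if_pos (by omega)] at h h'
    simp only [Option.some.injEq, Prod.mk.injEq] at h h'
    rw [← h.2, ← h'.1, if_pos (by omega), Function.update_of_ne (by omega)]
    by_cases h2 : m + 1 < p - 1
    · simp [machineRule, h2]
    · simp [machineRule, h2, show ¬p - 1 < m + 1 by omega]
  · subst h1
    rw [if_pos (by omega)] at h
    rw [if_neg (by omega), if_neg (by omega), transition, hM] at h'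
    simp only [Option.some.injEq, Prod.mk.injEq] at h h'
    rw [← h.2, ← h'.1]
    by_cases hs : s' = z
    · simp [machineRule, hs, hz hs]
    · simp [machineRule, hs]
  · rcases (show m = p ∨ p < m by omega) with rfl | h2
    · rw [if_neg (by omega), if_neg (by omega), transition, hM] at h
      rw [if_neg (by omega), if_pos (by omega)] at h'
      simp only [Option.some.injEq, Prod.mk.injEq] at h h'
      rw [← h.2, ← h'.1, if_neg (by omega), if_pos (by omega), if_neg (by omega),
        if_pos (by omega), Function.update_self]
      simp [machineRule]
    · rw [if_neg (by omega), if_pos (by omega)] at h h'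
      simp only [Option.some.injEq, Prod.mk.injEq] at h h'
      rw [← h.2, ← h'.1, if_neg (by omega), if_pos (by omega), if_neg (by omega),
        if_pos (by omega), Function.update_of_ne (by omega)]
      simp [machineRule]

end Simulation

/-! ### Simulation of whole runs and the Busy Beaver bound -/

section Run

variable {q : ℕ} {M : Machine q}

/-- The configuration after `k` steps on the blank tape. -/
def Machine.run (M : Machine q) (k : ℕ) : Config q := M.step^[k] (Config.init q)

theorem Machine.run_succ (k : ℕ) : M.run (k + 1) = M.step (M.run k) :=
  Function.iterate_succ_apply' _ _ _

theorem Machine.run_head_le (k : ℕ) : |(M.run k).head| ≤ k := by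
  induction k with
  | zero => simp [Machine.run, Config.init]
  | succ k ih =>
    rw [Machine.run_succ, Machine.step, abs_le] at *
    push_cast
    split
    · omega
    · dsimp only
      split <;> omega

theorem Machine.run_tape_eq_false (k : ℕ) {m : ℤ} (hm : k ≤ |m|) : (M.run k).tape m = false := by
  induction k with
  | zero => rfl
  | succ k ih =>
    have hp := M.run_head_le k
    push_cast at hm
    rw [Machine.run_succ, Machine.step]
    split
    · exact ih (by omega)
    · dsimp only
      rw [Function.update_of_ne (by rintro rfl; omega), ih (by omega)]

variable {z : Fin q} {r : Bool} {s₀ : Fin q}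

/-- The outputs at the even time `2 k + 2`, from those one step before. -/
theorem evolve_even {k : ℕ} {d : Bool} {s : Fin q}
    (hA : ∀ (i j : ℕ) (m : ℤ), i + j = 2 * k + 1 → (i : ℤ) - j = 2 * m + 1 →
      (machineRule M z r s₀).evolve i j =
        some (southInput z d s (M.run k).tape (M.run k).head m,
          westInput z d s (M.run k).tape (M.run k).head (m + 1)))
    (i j : ℕ) (m : ℤ) (hij : i + j = 2 * k + 2) (hm : (i : ℤ) - j = 2 * m) :
    (machineRule M z r s₀).evolve i j = cellOutput M z s (M.run k).tape (M.run k).head m := by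
  have hp := abs_le.1 (M.run_head_le k)
  rcases i with _ | i <;> rcases j with _ | j
  · omega
  -- On the lattice boundary an input is missing. The head is at distance at most `k` and has not
  -- been here, so the blank supplied by the rule is right.
  · have hmk : m = -(k + 1) := by push_cast at hm; omega
    rw [Rule.evolve, hA 0 j m (by omega) (by push_cast at hm ⊢; omega), Option.bind_some,
      southInput, if_pos (by omega), cellOutput, if_pos (by omega),
      Machine.run_tape_eq_false k (by rw [le_abs]; omega)]
    simp [machineRule]
  · have hmk : m = k + 1 := by push_cast at hm; omega
    rw [Rule.evolve, hA i 0 (m - 1) (by omega) (by push_cast at hm ⊢; omega), Option.bind_some,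
      sub_add_cancel, westInput, if_neg (by omega), if_pos (by omega), cellOutput,
      if_neg (by omega), if_pos (by omega), Machine.run_tape_eq_false k (by rw [le_abs]; omega)]
    simp [machineRule]
  · rw [Rule.evolve, hA i (j + 1) (m - 1) (by omega) (by push_cast at hm ⊢; omega),
      hA (i + 1) j m (by omega) (by push_cast at hm ⊢; omega), Option.bind_some,
      Option.bind_some, sub_add_cancel]
    exact machineRule_input

/-- Induction on the number of machine steps, each taking two diagonals. The side `d` from which the
head enters its cell depends on the last move and is therefore existentially quantified. -/
theorem exists_evolve_odd (hr : ∀ s a b mv, M s a = (b, mv, some z) → (mv = .right ↔ r = true))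
    (h0 : 0 < q) (hs₀ : s₀ = ⟨0, h0⟩) (k : ℕ) :
    ∀ s, (M.run k).state = some s → ∃ d, ∀ (i j : ℕ) (m : ℤ), i + j = 2 * k + 1 →
      (i : ℤ) - j = 2 * m + 1 → (machineRule M z r s₀).evolve i j =
        some (southInput z d s (M.run k).tape (M.run k).head m,
          westInput z d s (M.run k).tape (M.run k).head (m + 1)) := by
  induction k with
  | zero =>
    intro s hs
    have hss : s₀ = s := by
      simp only [Machine.run, Config.init, Function.iterate_zero, id, dif_pos h0,
        Option.some.injEq] at hs
      rw [hs₀, hs]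
    subst hss
    -- The origin emits the head to the north, and the next vertex passes it to the west input of
    -- cell 0.
    refine ⟨true, fun i j m hij hm => ?_⟩
    have hz : headColour z s₀ ≠ .inr z := by
      unfold headColour
      split_ifs with h <;> simp [h]
    rcases (show (i = 0 ∧ j = 1) ∨ (i = 1 ∧ j = 0) by omega) with ⟨rfl, rfl⟩ | ⟨rfl, rfl⟩
    · obtain rfl : m = -1 := by omega
      rw [Rule.evolve, Rule.evolve]
      simp [machineRule, hz, southInput, westInput, Machine.run, Config.init]
    · obtain rfl : m = 0 := by omega
      rw [Rule.evolve, Rule.evolve]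
      simp [machineRule, southInput, westInput, Machine.run, Config.init]
  | succ k ih =>
    intro s' hs'
    rw [Machine.run_succ] at hs' ⊢
    have hp := abs_le.1 (M.run_head_le k)
    rcases hst : (M.run k).state with _ | s
    · simp [Machine.step, hst] at hs'
    obtain ⟨d, hA⟩ := ih s hst
    have hB := evolve_even hA
    rcases hM : M s ((M.run k).tape (M.run k).head) with ⟨b, mv, t⟩
    have ht : t = some s' := by simpa [Machine.step, hst, hM] using hs'
    subst ht
    have hout : ∀ m, ∃ x y,
        cellOutput M z s (M.run k).tape (M.run k).head m = some (x, y) := by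
      intro m
      unfold cellOutput
      split_ifs with h1 h2
      · exact ⟨_, _, rfl⟩
      · exact ⟨_, _, rfl⟩
      · obtain rfl : m = (M.run k).head := by omega
        rw [transition, hM]
        cases mv <;> exact ⟨_, _, rfl⟩
    have key : ∃ d', ∀ m x y x' y',
        cellOutput M z s (M.run k).tape (M.run k).head m = some (x, y) →
        cellOutput M z s (M.run k).tape (M.run k).head (m + 1) = some (x', y') →
        machineRule M z r s₀ (some y) (some x') =
          some (southInput z d' s' (M.step (M.run k)).tape (M.step (M.run k)).head m,
            westInput z d' s' (M.step (M.run k)).tape (M.step (M.run k)).head (m + 1)) := by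
      cases mv
      · refine ⟨false, fun m x y x' y' h h' => ?_⟩
        simpa [Machine.step, hst, hM] using machineRule_left (s₀ := s₀) hr hM h h'
      · refine ⟨true, fun m x y x' y' h h' => ?_⟩
        simpa [Machine.step, hst, hM] using machineRule_right (s₀ := s₀) hr hM h h'
    obtain ⟨d', key⟩ := key
    refine ⟨d', fun i j m hij hm => ?_⟩
    obtain ⟨x, y, hxy⟩ := hout m
    obtain ⟨x', y', hxy'⟩ := hout (m + 1)
    rw [← key m x y x' y' hxy hxy']
    rcases i with _ | i <;> rcases j with _ | j
    · omega
    · have hmk : m + 1 = -(k + 1) := by push_cast at hm; omega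
      rw [Rule.evolve, hB 0 j (m + 1) (by omega) (by push_cast at hm ⊢; omega), hxy',
        Option.bind_some]
      rw [cellOutput, if_pos (by omega)] at hxy hxy'
      simp only [Option.some.injEq, Prod.mk.injEq] at hxy hxy'
      rw [← hxy.2, ← hxy'.1]
      simp [machineRule]
    · have hmk : m = k + 1 := by push_cast at hm; omega
      rw [Rule.evolve, hB i 0 m (by omega) (by push_cast at hm ⊢; omega), hxy, Option.bind_some]
      rw [cellOutput, if_neg (by omega), if_pos (by omega)] at hxy hxy'
      simp only [Option.some.injEq, Prod.mk.injEq] at hxy hxy'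
      rw [← hxy.2, ← hxy'.1]
      simp [machineRule]
    · rw [Rule.evolve, hB i (j + 1) m (by omega) (by push_cast at hm ⊢; omega), hxy,
        hB (i + 1) j (m + 1) (by omega) (by push_cast at hm ⊢; omega), hxy', Option.bind_some,
        Option.bind_some]

/-- If some transition halts, then some state is entered from at most one side. -/
theorem exists_one_sided_state {s : Fin q} {a : Bool} (h : (M s a).2.2 = none) :
    ∃ (z : Fin q) (r : Bool), ∀ s a b mv, M s a = (b, mv, some z) → (mv = .right ↔ r = true) := by
  by_contra! hcon
  choose g₁ g₂ b mv hM hmv using hcon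
  -- Pigeonhole: if all states were entered from both sides, the `2 q` pairs of a state and a
  -- direction would use up all `2 q` transitions, including the halting one.
  have hinj : Function.Injective fun x : Fin q × Bool => (g₁ x.1 x.2, g₂ x.1 x.2) := by
    rintro ⟨z, r⟩ ⟨z', r'⟩ heq
    simp only [Prod.mk.injEq] at heq
    have h1 := hM z r
    rw [heq.1, heq.2, hM z' r'] at h1
    simp only [Prod.mk.injEq, Option.some.injEq] at h1
    obtain ⟨-, h2, rfl⟩ := h1
    have h3 := hmv z' r
    have h4 := hmv z' r'
    rw [h2] at h4
    cases r <;> cases r' <;> first | rfl | (exfalso; simp at h3 h4; tauto)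
  obtain ⟨⟨z, r⟩, hzr⟩ := (Finite.injective_iff_surjective.1 hinj) (s, a)
  simp only [Prod.mk.injEq] at hzr
  have := hM z r
  rw [hzr.1, hzr.2] at this
  rw [this] at h
  simp at h

/-- The halting time of a machine with `q` states is at most a threshold in dimension `q + 4`. -/
theorem Machine.HaltsAfter.exists_isThreshold {T : ℕ} (h : M.HaltsAfter T) (hT : 1 ≤ T) :
    ∃ n, T ≤ n ∧ IsThreshold 2 (q + 4) n := by
  obtain ⟨T, rfl⟩ : ∃ T', T = T' + 1 := ⟨T - 1, by omega⟩
  have hrun : ∀ k < T + 1, ∃ s, (M.run k).state = some s := fun k hk =>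
    Option.ne_none_iff_exists'.1 (h.2 k hk)
  obtain ⟨s, hs⟩ := hrun T (by omega)
  have hhalt : (M s ((M.run T).tape (M.run T).head)).2.2 = none := by
    have h1 : (M.run (T + 1)).state = none := h.1
    rw [Machine.run_succ] at h1
    simpa [Machine.step, hs] using h1
  obtain ⟨z, r, hr⟩ := exists_one_sided_state hhalt
  have h0 : 0 < q := z.pos
  have hodd := exists_evolve_odd hr h0 rfl
  have e : Colour q ≃ Fin (q + 2) :=
    Fintype.equivFinOfCardEq (by simp [Colour]; omega)
  -- The stuck vertex is the head cell on diagonal `2 T + 2`, where the halting transition is read.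
  refine exists_isThreshold_of_survives (ϕ := machineRule M z r ⟨0, h0⟩)
    (i := (T + 1 + (M.run T).head).toNat) (j := (T + 1 - (M.run T).head).toNat) e hT ?_ ?_
  -- Excluding the upper right corner leaves the diagonals up to `2 T + 1`, where only transitions
  -- before the halting one are read.
  · intro i j hi hj hij
    obtain ⟨k, hk⟩ : ∃ k, i + j = 2 * k ∨ i + j = 2 * k + 1 := ⟨(i + j) / 2, by omega⟩
    rcases hk with hk | hk
    · rcases k with _ | k
      · obtain ⟨rfl, rfl⟩ : i = 0 ∧ j = 0 := by omega
        rw [Rule.evolve]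
        rfl
      · obtain ⟨s, hs⟩ := hrun k (by omega)
        obtain ⟨s', hs'⟩ := hrun (k + 1) (by omega)
        obtain ⟨d, hA⟩ := hodd k s hs
        obtain ⟨m, hm⟩ : ∃ m : ℤ, (i : ℤ) - j = 2 * m := ⟨((i : ℤ) - j) / 2, by omega⟩
        rw [evolve_even hA i j m (by omega) hm, cellOutput]
        split_ifs with h1 h2
        · rfl
        · rfl
        · obtain rfl : m = (M.run k).head := by omega
          rw [transition]
          rw [Machine.run_succ] at hs'
          split
          · rename_i heq
            simp [Machine.step, hs, heq] at hs'
          · rfl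
          · rfl
    · obtain ⟨s, hs⟩ := hrun k (by omega)
      obtain ⟨d, hA⟩ := hodd k s hs
      obtain ⟨m, hm⟩ : ∃ m : ℤ, (i : ℤ) - j = 2 * m + 1 := ⟨((i : ℤ) - j - 1) / 2, by omega⟩
      rw [hA i j m hk hm]
      rfl
  · have hp := abs_le.1 (M.run_head_le T)
    obtain ⟨d, hA⟩ := hodd T s hs
    rw [evolve_even hA _ _ (M.run T).head (by omega) (by omega), cellOutput,
      if_neg (lt_irrefl _), if_neg (lt_irrefl _), transition]
    split
    · rfl
    · rename_i heq; simp [heq] at hhalt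
    · rename_i heq; simp [heq] at hhalt

theorem Machine.HaltsAfter.unique {t t' : ℕ} (h : M.HaltsAfter t) (h' : M.HaltsAfter t') :
    t = t' := by
  rcases lt_trichotomy t t' with hlt | heq | hlt
  · exact absurd h.1 (h'.2 t hlt)
  · exact heq
  · exact absurd h'.1 (h.2 t' hlt)

instance : Finite Move :=
  Finite.of_surjective (fun b : Bool => if b then Move.left else Move.right) fun m => by
    cases m
    · exact ⟨true, rfl⟩
    · exact ⟨false, rfl⟩

theorem finite_setOf_haltsAfter (q : ℕ) : {t | ∃ M : Machine q, M.HaltsAfter t}.Finite := by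
  have : Finite (Machine q) := inferInstance
  rw [Set.ofPred_exists]
  refine Set.finite_iUnion fun M => Set.Subsingleton.finite ?_
  exact fun t ht t' ht' => Machine.HaltsAfter.unique ht ht'

theorem Machine.HaltsAfter.le_busyBeaver {t : ℕ} (h : M.HaltsAfter t) : t ≤ busyBeaver q :=
  le_csSup (finite_setOf_haltsAfter q).bddAbove ⟨M, h⟩

theorem exists_haltsAfter_busyBeaver (h : 1 ≤ busyBeaver q) :
    ∃ M : Machine q, M.HaltsAfter (busyBeaver q) := by
  refine Nat.sSup_mem ?_ (finite_setOf_haltsAfter q).bddAbove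
  by_contra hne
  rw [Set.not_nonempty_iff_eq_empty] at hne
  rw [busyBeaver, hne] at h
  simp at h

theorem busyBeaver_le_of_isGreatest {N : ℕ} (hN : IsGreatest {n | IsThreshold 2 (q + 4) n} N) :
    busyBeaver q ≤ N := by
  rcases Nat.eq_zero_or_pos (busyBeaver q) with h | h
  · omega
  · obtain ⟨M, hM⟩ := exists_haltsAfter_busyBeaver h
    obtain ⟨n, hn, hn'⟩ := hM.exists_isThreshold h
    exact hn.trans (hN.2 hn')

end Run

/-! ### Busy Beavers outgrow computable functions -/

section PostMachines

theorem Machine.exists_haltsAfter {q : ℕ} {M : Machine q} {t : ℕ} (h : (M.run t).state = none) :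
    ∃ T, M.HaltsAfter T ∧ M.run T = M.run t := by
  classical
  have hex : ∃ t, (M.run t).state = none := ⟨t, h⟩
  refine ⟨Nat.find hex, ⟨Nat.find_spec hex, fun t' ht' => Nat.find_min hex ht'⟩, ?_⟩
  obtain ⟨k, hk⟩ := Nat.exists_eq_add_of_le (Nat.find_min' hex h)
  rw [hk]
  clear hk
  induction k with
  | zero => rfl
  | succ k ih =>
    rw [← add_assoc, Machine.run_succ, ← ih, Machine.step, Nat.find_spec hex]

/-- States of any type can be numbered; a swap sends the initial state to 0. Values outside `A` are
irrelevant. -/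
theorem exists_coding {α : Type*} {q : ℕ} (A : Finset α) {x : α} (hx : x ∈ A) (hA : A.card ≤ q)
    (h0 : 0 < q) : ∃ (e : α → Fin q) (d : Fin q → α), (∀ y ∈ A, d (e y) = y) ∧ e x = ⟨0, h0⟩ := by
  classical
  obtain ⟨g⟩ : Nonempty (A ↪ Fin q) :=
    Function.Embedding.nonempty_of_card_le (by simpa using hA)
  let e : α → Fin q := fun y =>
    if h : y ∈ A then Equiv.swap (g ⟨x, hx⟩) ⟨0, h0⟩ (g ⟨y, h⟩) else ⟨0, h0⟩
  have he : Set.InjOn e A := by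
    intro y hy y' hy' h
    simp only [e, dif_pos (Finset.mem_coe.1 hy), dif_pos (Finset.mem_coe.1 hy')] at h
    simpa using h
  have : Nonempty α := ⟨x⟩
  refine ⟨e, Function.invFunOn e A, fun y hy => he.leftInvOn_invFunOn hy, ?_⟩
  simp [e, hx]

variable {Λ : Type*} [Inhabited Λ] {q : ℕ}

/-- The transitions of a machine that writes `W 0, …, W n` from right to left, and then imitates a
Post machine. The states `(s, false)` are those of the Post machine, and `(s, true)` precedes
`(s, false)` after a symbol was written. -/
def postTransition (M : Turing.TM0.Machine Bool Λ) (W : ℕ → Bool) (n : ℕ) :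
    ℕ ⊕ Λ × Bool → Bool → Bool × Move × Option (ℕ ⊕ Λ × Bool)
  | .inl i, _ => (W i, .left, some (if i < n then .inl (i + 1) else .inr (default, true)))
  | .inr (s, true), a => (a, .right, some (.inr (s, false)))
  | .inr (s, false), a =>
    match M s a with
    | none => (a, .right, none)
    | some (s', .move .left) => (a, .left, some (.inr (s', false)))
    | some (s', .move .right) => (a, .right, some (.inr (s', false)))
    | some (s', .write b) => (b, .left, some (.inr (s', true)))

/-- The machine with transitions `m` on states that are coded by numbers. -/
def Machine.ofCoding {α : Type*} (e : α → Fin q) (d : Fin q → α)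
    (m : α → Bool → Bool × Move × Option α) : Machine q :=
  fun s a => ((m (d s) a).1, (m (d s) a).2.1, (m (d s) a).2.2.map e)

theorem Machine.step_ofCoding {α : Type*} {e : α → Fin q} {d : Fin q → α}
    {m : α → Bool → Bool × Move × Option α} {s : α} (hs : d (e s) = s) (tape : ℤ → Bool) (p : ℤ)
    {b : Bool} {mv : Move} {t : Option α} (hm : m s (tape p) = (b, mv, t)) :
    (Machine.ofCoding e d m).step ⟨some (e s), tape, p⟩ =
      ⟨t.map e, Function.update tape p b,
        match mv with
        | .left => p - 1
        | .right => p + 1⟩ := by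
  simp only [Machine.step, Machine.ofCoding, hs, hm]
  cases mv <;> rfl

variable {M : Turing.TM0.Machine Bool Λ} {e : ℕ ⊕ Λ × Bool → Fin q} {d : Fin q → ℕ ⊕ Λ × Bool}

/-- The configuration that represents the label `s` and the tape `T` with head at `p`. -/
def postConfig (e : ℕ ⊕ Λ × Bool → Fin q) (s : Λ) (T : Turing.Tape Bool) (p : ℤ) : Config q :=
  ⟨some (e (.inr (s, false))), fun z => T.nth (z - p), p⟩

theorem update_nth (T : Turing.Tape Bool) (p : ℤ) (b : Bool) :
    Function.update (fun z => T.nth (z - p)) p b = fun z => (T.write b).nth (z - p) := by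
  funext z
  by_cases h : z = p
  · subst h
    simp
    rfl
  · rw [Function.update_of_ne h, Turing.Tape.write_nth, if_neg (by omega)]

theorem update_nth_self (T : Turing.Tape Bool) (p : ℤ) :
    Function.update (fun z => T.nth (z - p)) p (T.nth (p - p)) = fun z => T.nth (z - p) :=
  Function.update_eq_self _ _

/-- A Post machine either moves or writes, whereas a machine here always does both: a move rewrites
the scanned symbol, and a write is followed by a step to the left and one back. -/
theorem exists_iterate_postConfig {W : ℕ → Bool} {n : ℕ} {s s' : Λ} {T T' : Turing.Tape Bool}
    (hs : ∀ b, d (e (.inr (s, b))) = .inr (s, b)) (hs' : ∀ b, d (e (.inr (s', b))) = .inr (s', b))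
    (h : Turing.TM0.step M ⟨s, T⟩ = some ⟨s', T'⟩) (p : ℤ) :
    ∃ t p', (Machine.ofCoding e d (postTransition M W n)).step^[t] (postConfig e s T p) =
      postConfig e s' T' p' := by
  simp only [Turing.TM0.step, Option.map_eq_some_iff] at h
  obtain ⟨⟨s'', o⟩, hM, h⟩ := h
  simp only [Turing.TM0.Cfg.mk.injEq] at h
  obtain ⟨rfl, h⟩ := h
  have hT : T.nth (p - p) = T.head := by rw [sub_self]; rfl
  rcases o with (_ | _) | b
  · refine ⟨1, p - 1, ?_⟩
    rw [Function.iterate_one, postConfig, Machine.step_ofCoding (hs false) _ _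
      (b := T.nth (p - p)) (mv := .left) (t := some (.inr (s'', false)))
      (by simp only [postTransition, hT, hM]), update_nth_self, postConfig, ← h]
    simp only [Option.map_some, Turing.Tape.move_left_nth]
    congr 1
    funext z
    congr 1
    omega
  · refine ⟨1, p + 1, ?_⟩
    rw [Function.iterate_one, postConfig, Machine.step_ofCoding (hs false) _ _
      (b := T.nth (p - p)) (mv := .right) (t := some (.inr (s'', false)))
      (by simp only [postTransition, hT, hM]), update_nth_self, postConfig, ← h]
    simp only [Option.map_some, Turing.Tape.move_right_nth]
    congr 1
    funext z
    congr 1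
    omega
  · refine ⟨2, p, ?_⟩
    rw [Function.iterate_succ, Function.iterate_one, Function.comp_apply, postConfig,
      Machine.step_ofCoding (hs false) _ _ (b := b) (mv := .left) (t := some (.inr (s'', true)))
      (by simp only [postTransition, hT, hM]), update_nth, Option.map_some,
      Machine.step_ofCoding (hs' true) _ _ (mv := .right) (t := some (.inr (s'', false)))
      (by simp only [postTransition]; rfl), Function.update_eq_self, postConfig, ← h]
    simp

theorem step_postConfig_of_none {W : ℕ → Bool} {n : ℕ} {s : Λ} {T : Turing.Tape Bool}
    (hs : ∀ b, d (e (.inr (s, b))) = .inr (s, b)) (h : Turing.TM0.step M ⟨s, T⟩ = none) (p : ℤ) :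
    (Machine.ofCoding e d (postTransition M W n)).step (postConfig e s T p) =
      ⟨none, fun z => T.nth (z - p), p + 1⟩ := by
  simp only [Turing.TM0.step, Option.map_eq_none_iff] at h
  have hT : T.nth (p - p) = T.head := by rw [sub_self]; rfl
  rw [postConfig, Machine.step_ofCoding (hs false) _ _ (b := T.nth (p - p)) (mv := .right)
    (t := none) (by simp only [postTransition, hT, h]), update_nth_self]
  rfl

/-- Writing the input from right to left ends next to its first cell, so one step back to the right
reaches the initial position of the Post machine. -/
theorem run_write {n : ℕ} {T : Turing.Tape Bool} (h0 : 0 < q) (he : e (.inl 0) = ⟨0, h0⟩)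
    (hd : ∀ i ≤ n, d (e (.inl i)) = .inl i)
    (hd' : ∀ b, d (e (.inr (default, b))) = .inr (default, b))
    (hT : ∀ j : ℤ, j < 0 ∨ n < j → T.nth j = false) :
    (Machine.ofCoding e d (postTransition M (fun i => T.nth (n - i)) n)).run (n + 2) =
      postConfig e default T (-n) := by
  have key : ∀ i ≤ n + 1,
      (Machine.ofCoding e d (postTransition M (fun i => T.nth (n - i)) n)).run i =
        ⟨some (e (if i ≤ n then .inl i else .inr (default, true))),
          fun z => if -(i : ℤ) < z then T.nth (z + n) else false, -i⟩ := by
    intro i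
    induction i with
    | zero =>
      intro _
      simp only [Machine.run, Function.iterate_zero, id, Config.init, dif_pos h0, Nat.zero_le,
        if_true, he]
      congr 1
      funext z
      split_ifs with h
      · exact (hT _ (.inr (by push_cast at h; omega))).symm
      · rfl
    | succ i ih =>
      intro hi
      rw [Machine.run_succ, ih (by omega), if_pos (by omega),
        Machine.step_ofCoding (hd i (by omega)) _ _ (b := T.nth (n - i)) (mv := .left)
        (t := some (if i < n then .inl (i + 1) else .inr (default, true))) rfl]
      simp only [Option.map_some, Order.add_one_le_iff]
      congr 1
      · funext z
        by_cases h : z = -(i : ℤ)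
        · subst h
          rw [Function.update_self, if_pos (by push_cast; omega)]
          congr 1
          omega
        · rw [Function.update_of_ne h]
          by_cases h1 : -(i : ℤ) < z
          · rw [if_pos h1, if_pos (by push_cast; omega)]
          · rw [if_neg h1, if_neg (by push_cast; omega)]
      · push_cast
        omega
  rw [Machine.run_succ, key (n + 1) le_rfl, if_neg (by omega), Machine.step_ofCoding (hd' true) _ _
    (mv := .right) (t := some (.inr (default, false))) (by simp only [postTransition]; rfl),
    Function.update_eq_self, postConfig]
  simp only [Option.map_some]
  congr 1
  · funext z
    split_ifs with h
    · congr 1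
      omega
    · exact (hT _ (.inl (by push_cast at h; omega))).symm
  · push_cast
    omega

/-- If a Post machine with few states, started on few symbols, halts with a mark far to the right of
the head, then the Busy Beaver number is large. -/
theorem le_busyBeaver_of_post {S : Finset Λ} (hS : Turing.TM0.Supports M ↑S) {n : ℕ}
    {T T' : Turing.Tape Bool} {s : Λ} (hT : ∀ j : ℤ, j < 0 ∨ n < j → T.nth j = false)
    (h : (⟨s, T'⟩ : Turing.TM0.Cfg Bool Λ) ∈
      StateTransition.eval (Turing.TM0.step M) ⟨default, T⟩)
    {j : ℕ} (hj : T'.nth j = true) (hq : n + 1 + 2 * S.card ≤ q) : j ≤ 2 * busyBeaver q := by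
  have h0 : 0 < q := by omega
  obtain ⟨e, d, hd, he⟩ := exists_coding
    ((Finset.range (n + 1)).disjSum (S ×ˢ (Finset.univ : Finset Bool))) (x := .inl 0)
    (by simp) (q := q) (by
      rw [Finset.card_disjSum, Finset.card_range, Finset.card_product, Finset.card_univ,
        Fintype.card_bool]
      omega) h0
  have hl : ∀ i ≤ n, d (e (.inl i)) = .inl i := fun i hi => hd _ (by simp; omega)
  have hr : ∀ s ∈ S, ∀ b, d (e (.inr (s, b))) = .inr (s, b) := fun s hs b => hd _ (by simp [hs])
  set M' := Machine.ofCoding e d (postTransition M (fun i => T.nth (n - i)) n) with hM'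
  obtain ⟨hreach, hnone⟩ := StateTransition.mem_eval.1 h
  have key : ∀ c, StateTransition.Reaches (Turing.TM0.step M) ⟨default, T⟩ c →
      c.q ∈ S ∧ ∃ t p, M'.run t = postConfig e c.q c.Tape p := by
    intro c hc
    induction hc with
    | refl => exact ⟨hS.1, n + 2, -n, run_write h0 he hl (hr _ hS.1) hT⟩
    | @tail c c' _ hcc' ih =>
      obtain ⟨hc, t, p, hp⟩ := ih
      have hcS : c'.q ∈ S := by
        have h1 : Turing.TM0.step M ⟨c.q, c.Tape⟩ = some c' := hcc'
        simp only [Turing.TM0.step, Option.map_eq_some_iff] at h1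
        obtain ⟨⟨s', o⟩, h2, rfl⟩ := h1
        exact hS.2 h2 hc
      obtain ⟨t', p', ht'⟩ := exists_iterate_postConfig (W := fun i => T.nth (n - i)) (n := n)
        (hr _ hc) (hr _ hcS) (s' := c'.q) (T' := c'.Tape) hcc' p
      refine ⟨hcS, t' + t, p', ?_⟩
      rw [Machine.run, Function.iterate_add_apply]
      rw [Machine.run] at hp
      rw [hp, ht']
  obtain ⟨hs, t, p, hp⟩ := key _ hreach
  have hrun : M'.run (t + 1) = ⟨none, fun z => T'.nth (z - p), p + 1⟩ := by
    rw [Machine.run_succ, hp]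
    exact step_postConfig_of_none (hr _ hs) hnone p
  obtain ⟨t', ht', hrun'⟩ := Machine.exists_haltsAfter (M := M') (t := t + 1) (by rw [hrun])
  rw [hrun] at hrun'
  have h1 := ht'.le_busyBeaver
  have h2 := abs_le.1 (M'.run_head_le t')
  rw [hrun'] at h2
  -- The mark, at `j + p`, and the head, at `p + 1`, are both within `t'` of the origin, whence `j ≤
  -- 2 t'`.
  have h3 : ¬(t' : ℤ) ≤ |j + p| := fun hle => by
    have := M'.run_tape_eq_false t' hle
    rw [hrun'] at this
    simp [hj] at this
  rw [not_le, abs_lt] at h3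
  dsimp only at h2
  omega

end PostMachines

/-! ### From stack machines to Post machines -/

section StackMachines

theorem append_nth_length_add {Γ : Type*} [Inhabited Γ] (l : List Γ) (L : Turing.ListBlank Γ)
    (i : ℕ) : (L.append l).nth (l.length + i) = L.nth i := by
  induction l with
  | nil => simp [Turing.ListBlank.append]
  | cons a l ih =>
    rw [List.length_cons, show l.length + 1 + i = l.length + i + 1 by omega,
      Turing.ListBlank.nth_succ, Turing.ListBlank.append, Turing.ListBlank.tail_cons, ih]

theorem append_nth_of_lt {Γ : Type*} [Inhabited Γ] (l : List Γ) (L : Turing.ListBlank Γ) {i : ℕ}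
    (hi : i < l.length) : (L.append l).nth i = l[i] := by
  induction l generalizing i with
  | nil => simp at hi
  | cons a l ih =>
    rcases i with _ | i
    · rw [Turing.ListBlank.append, Turing.ListBlank.nth_zero, Turing.ListBlank.head_cons]
      rfl
    · rw [Turing.ListBlank.append, Turing.ListBlank.nth_succ, Turing.ListBlank.tail_cons,
        ih (by simpa using hi)]
      rfl

/-- A symbol that is not blank leaves a mark in the binary code of a tape. -/
theorem exists_flatMap_nth_eq_true {Γ : Type*} [Inhabited Γ] {n : ℕ} {f : Γ → List Bool}
    (hf : ∃ n, f default = List.replicate n default) (hn : ∀ a, (f a).length = n)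
    (hmark : ∀ a, a ≠ default → true ∈ f a) (i : ℕ) (L : Turing.ListBlank Γ)
    (hL : L.nth i ≠ default) : ∃ j, i ≤ j ∧ (L.flatMap f hf).nth j = true := by
  have hn1 : 1 ≤ n := by
    have := List.length_pos_of_mem (hmark _ hL)
    rwa [hn] at this
  induction i generalizing L with
  | zero =>
    obtain ⟨a, L, rfl⟩ := L.exists_cons
    rw [Turing.ListBlank.nth_zero, Turing.ListBlank.head_cons] at hL
    obtain ⟨j, hj, hj'⟩ := List.mem_iff_getElem.1 (hmark a hL)
    exact ⟨j, Nat.zero_le _, by rw [Turing.ListBlank.cons_flatMap, append_nth_of_lt _ _ hj, hj']⟩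
  | succ i ih =>
    obtain ⟨a, L, rfl⟩ := L.exists_cons
    rw [Turing.ListBlank.nth_succ, Turing.ListBlank.tail_cons] at hL
    obtain ⟨j, hj, hj'⟩ := ih L hL
    refine ⟨(f a).length + j, by rw [hn]; omega, ?_⟩
    rw [Turing.ListBlank.cons_flatMap, append_nth_length_add, hj']

open Turing in
/-- If a stack machine halts with a large stack, then the Busy Beaver number is large. -/
theorem exists_le_busyBeaver_of_stack {K Λ σ : Type*} [DecidableEq K] [Fintype K] {Γ : K → Type*}
    [∀ k, Fintype (Γ k)] [Inhabited Λ] [Inhabited σ] [Fintype σ] (M : Λ → TM2.Stmt Γ Λ σ)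
    {S : Finset Λ} (hS : TM2.Supports M S) :
    ∃ A B : ℕ, ∀ (k : K) (L : List (Γ k)) (c : TM2.Cfg Γ Λ σ),
      c ∈ StateTransition.eval (TM2.step M) (TM2.init k L) →
      ∀ q, A + B * (L.length + 1) ≤ q → ∀ k', (c.stk k').length ≤ 2 * busyBeaver q + 1 := by
  classical
  -- The stacks are put on one tape, its symbols are coded by `n` bits, and the result becomes a
  -- Post machine. The program contributes a fixed number of states and the input `n` per symbol.
  obtain ⟨n, enc, dec, henc, hdec⟩ := TM1to1.exists_enc_dec (Γ := TM2to1.Γ' K Γ)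
  have h1 := TM2to1.tr_supports M hS
  have h2 := TM1to1.tr_supports (enc := enc) (dec := dec) (TM2to1.tr M) h1
  have h3 := TM1to0.tr_supports _ h2
  refine ⟨1 + 2 * (TM1to0.trStmts (TM1to1.tr enc dec (TM2to1.tr M))
    (TM1to1.trSupp (TM2to1.tr M) (TM2to1.trSupp M S))).card, n, fun k L c hc q hq k' => ?_⟩
  rcases Nat.eq_zero_or_pos (c.stk k').length with hlen | hlen
  · omega
  obtain ⟨c₁, hc₁, he₁⟩ :=
    StateTransition.tr_eval (TM2to1.tr_respects M) (TM2to1.trCfg_init k L) hc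
  obtain ⟨c₂, rfl, he₂⟩ := StateTransition.tr_eval
    (TM1to1.tr_respects dec (TM2to1.tr M) (enc0 := henc) hdec) rfl he₁
  obtain ⟨c₃, rfl, he₃⟩ := StateTransition.tr_eval (TM1to0.tr_respects _) rfl he₂
  obtain @⟨l, v, St, L', hL'⟩ := hc₁
  dsimp only at hlen ⊢
  -- The stacks grow away from the left end of the tape, so the top of stack `k'` sits in cell
  -- `length - 1`.
  have hne : (TM2to1.addBottom L').nth ((St k').length - 1) ≠ default := by
    intro h
    have h5 : ((TM2to1.addBottom L').nth ((St k').length - 1)).2 k' = none := by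
      rw [h]
      rfl
    rw [TM2to1.addBottom_nth_snd, TM2to1.stk_nth_val _ (hL' k'), List.getElem?_eq_none_iff,
      List.length_reverse] at h5
    omega
  have hmark : ∀ a, a ≠ default → true ∈ (enc a).toList := by
    intro a ha
    by_contra hcon
    refine ha ?_
    have h6 : (enc a).toList = List.replicate n false :=
      List.eq_replicate_iff.2 ⟨(enc a).toList_length, fun b hb => by
        cases b
        · rfl
        · exact absurd hb hcon⟩
    rw [← hdec a, ← hdec default, henc]
    congr 1
    exact List.Vector.toList_injective h6
  obtain ⟨j, hj, hj'⟩ := exists_flatMap_nth_eq_true (f := fun x => (enc x).toList)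
    ⟨n, by rw [henc]; rfl⟩ (fun a => (enc a).toList_length) hmark _ _ hne
  suffices h : j ≤ 2 * busyBeaver q by omega
  have hq' : n * (L.length + 1) + 1 + 2 * (TM1to0.trStmts (TM1to1.tr enc dec (TM2to1.tr M))
      (TM1to1.trSupp (TM2to1.tr M) (TM2to1.trSupp M S))).card ≤ q := by omega
  refine le_busyBeaver_of_post h3 (n := n * (L.length + 1)) ?_ he₃ (j := j) ?_ hq'
  · intro i hi
    rw [Tape.mk₁, Tape.mk₂, TM1to1.trTape_mk', TM1to1.trTape']
    rcases i with i | i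
    · rw [Int.ofNat_eq_natCast, Tape.mk'_nth_nat, ListBlank.flatMap_mk, ListBlank.nth_mk,
        List.getI_eq_default]
      · rfl
      have hlen' : (TM2to1.trInit k L : List (TM2to1.Γ' K Γ)).length ≤ L.length + 1 := by
        change (List.map (fun a => ((false, Function.update (fun _ => none) k (some a)) :
          TM2to1.Γ' K Γ)) L.reverse).tail.length + 1 ≤ L.length + 1
        rw [List.length_tail, List.length_map, List.length_reverse]
        omega
      rw [List.length_flatMap]
      have hsum : ((TM2to1.trInit k L : List (TM2to1.Γ' K Γ)).map
          fun x => (enc x).toList.length).sum ≤ n * (L.length + 1) := by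
        simp only [List.Vector.toList_length, List.map_const', List.sum_replicate, smul_eq_mul]
        rw [mul_comm]
        exact Nat.mul_le_mul_left n hlen'
      refine hsum.trans ?_
      rcases hi with hi | hi
      · simp at hi
        omega
      · rw [Int.ofNat_eq_natCast] at hi
        omega
    · exact List.getI_nil i
  · rw [TM1to1.trTape_mk', TM1to1.trTape', Tape.mk'_nth_nat]
    exact hj'

end StackMachines

/-! ### Binary numerals and partial recursive codes -/

section Codes

open Turing Turing.PartrecToTM2

instance : Fintype K' := ⟨{.main, .rev, .aux, .stack}, fun k => by cases k <;> decide⟩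

theorem length_trPosNum_le (p : PosNum) : (trPosNum p).length ≤ p := by
  induction p with
  | one => simp [trPosNum]
  | bit1 p ih =>
    rw [trPosNum, List.length_cons, PosNum.cast_bit1]
    omega
  | bit0 p ih =>
    have := p.cast_pos (α := ℕ)
    rw [trPosNum, List.length_cons, PosNum.cast_bit0]
    omega

theorem length_trNat_le (n : ℕ) : (trNat n).length ≤ n := by
  rw [trNat]
  rcases h : (n : Num) with _ | p
  · simp [trNum]
  · have hn : ((n : Num) : ℕ) = n := Num.to_of_nat n
    rw [h] at hn
    rw [trNum, ← hn]
    exact length_trPosNum_le p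

theorem lt_two_pow_length_trPosNum (p : PosNum) : (p : ℕ) < 2 ^ (trPosNum p).length := by
  induction p with
  | one => simp [trPosNum]
  | bit1 p ih =>
    rw [trPosNum, List.length_cons, PosNum.cast_bit1, pow_succ]
    omega
  | bit0 p ih =>
    rw [trPosNum, List.length_cons, PosNum.cast_bit0, pow_succ]
    omega

theorem lt_two_pow_length_trNat (n : ℕ) : n < 2 ^ (trNat n).length := by
  rw [trNat]
  have hn : ((n : Num) : ℕ) = n := Num.to_of_nat n
  rcases h : (n : Num) with _ | p
  · rw [h] at hn
    rw [← hn]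
    simp
  · rw [h] at hn
    rw [← hn]
    exact lt_two_pow_length_trPosNum p

/-- Numbers that are computed from `k` by a fixed code have at most twice as many binary digits as
the Busy Beaver number of machines with linearly many states. -/
theorem exists_length_trNat_le (c : ToPartrec.Code) :
    ∃ A B : ℕ, ∀ k v, [v] ∈ c.eval [k] → ∀ q, A + B * (k + 2) ≤ q →
      (trNat v).length ≤ 2 * busyBeaver q := by
  -- The default label is where the stack machine starts, so it has to be the entry point of `c`.
  let _ : Inhabited Λ' := ⟨trNormal c Cont'.halt⟩
  obtain ⟨A, B, h⟩ := exists_le_busyBeaver_of_stack tr (tr_supports c Cont'.halt)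
  refine ⟨A, B, fun k v hv q hq => ?_⟩
  have hmem : halt [v] ∈ StateTransition.eval (TM2.step tr) (init c [k]) := by
    rw [tr_eval]
    exact Part.mem_map _ hv
  have hinit : (init c [k] : TM2.Cfg (fun _ : K' => Γ') Λ' (Option Γ')) =
      TM2.init K'.main (trList [k]) := by
    rw [init, TM2.init]
    congr 1
    funext k'
    cases k' <;> rfl
  rw [hinit] at hmem
  have hk : (trList [k]).length = (trNat k).length + 1 := by simp [trList]
  have hv' : (trList [v]).length = (trNat v).length + 1 := by simp [trList]
  have := h K'.main (trList [k]) _ hmem q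
    ((Nat.add_le_add_left (Nat.mul_le_mul_left B (by have := length_trNat_le k; omega)) A).trans hq)
    K'.main
  change (trList [v]).length ≤ _ at this
  omega

end Codes

/-! ### Domination of computable functions -/

section Domination

/-- The partial sums of `f` bound `f` by a monotone function. -/
def partialSum (f : ℕ → ℕ) (m : ℕ) : ℕ := Nat.rec (f 0) (fun i s => s + f (i + 1)) m

theorem le_partialSum (f : ℕ → ℕ) {i m : ℕ} (h : i ≤ m) : f i ≤ partialSum f m := by
  induction m with
  | zero =>
    obtain rfl : i = 0 := by omega
    exact le_rfl
  | succ m ih =>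
    change f i ≤ partialSum f m + f (m + 1)
    rcases Nat.lt_or_ge m i with h' | h'
    · obtain rfl : i = m + 1 := by omega
      omega
    · have := ih h'
      omega

theorem computable_partialSum {f : ℕ → ℕ} (hf : Computable f) : Computable (partialSum f) := by
  refine Computable.nat_rec (f := id) (g := fun _ => f 0)
    (h := fun _ (x : ℕ × ℕ) => x.2 + f (x.1 + 1)) Computable.id (Computable.const _) ?_
  exact (Primrec.nat_add.to_comp.comp (Computable.snd.comp Computable.snd)
    (hf.comp (Computable.succ.comp (Computable.fst.comp Computable.snd)))).to₂

theorem computable_two_pow : Computable fun n : ℕ => 2 ^ n := by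
  refine (Computable.nat_rec (f := id) (g := fun _ => 1)
    (h := fun _ (x : ℕ × ℕ) => x.2 + x.2) Computable.id (Computable.const _) ?_).of_eq fun n => ?_
  · exact (Primrec.nat_add.to_comp.comp (Computable.snd.comp Computable.snd)
      (Computable.snd.comp Computable.snd)).to₂
  · induction n with
    | zero => rfl
    | succ n ih =>
      rw [pow_succ, ← ih]
      exact (mul_two _).symm

theorem exists_code_of_computable {f : ℕ → ℕ} (hf : Computable f) :
    ∃ c : Turing.ToPartrec.Code, ∀ k, [f k] ∈ c.eval [k] := by
  obtain ⟨c, hc⟩ := Turing.ToPartrec.Code.exists_code (Nat.Partrec'.part_iff₁.2 hf)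
  refine ⟨c, fun k => ?_⟩
  have := hc (k ::ᵥ List.Vector.nil)
  rw [show (k ::ᵥ List.Vector.nil : List.Vector ℕ 1).1 = [k] from rfl] at this
  rw [this]
  simp

/-- The Busy Beaver function dominates every computable function. -/
theorem eventually_lt_busyBeaver {f : ℕ → ℕ} (hf : Computable f) (r : ℕ) :
    ∀ᶠ d in Filter.atTop, f d < busyBeaver (d - r) := by
  -- With `k = √d + 1` (integer square root) a machine computing this from `k` has only `O(√d)`
  -- states, eventually fewer than `d - r`. Its output has more than `2 * partialSum f (k * k) ≥ 2 *
  -- f d` binary digits.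
  have hG : Computable fun k : ℕ => 2 ^ (2 * partialSum f (k * k)) :=
    computable_two_pow.comp (Primrec.nat_mul.to_comp.comp (Computable.const 2)
      ((computable_partialSum hf).comp (Primrec.nat_mul.to_comp.comp Computable.id Computable.id)))
  obtain ⟨c, hc⟩ := exists_code_of_computable hG
  obtain ⟨A, B, h⟩ := exists_length_trNat_le c
  refine Filter.eventually_atTop.2 ⟨(A + B + r + 10) * (A + B + r + 10), fun d hd => ?_⟩
  have hs : A + B + r + 10 ≤ d.sqrt := Nat.le_sqrt.2 hd
  have hs1 : d.sqrt * d.sqrt ≤ d := Nat.sqrt_le d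
  have hs2 : d < (d.sqrt + 1) * (d.sqrt + 1) := Nat.lt_succ_sqrt d
  have hq : A + B * (d.sqrt + 1 + 2) ≤ d - r := by
    have : A + B * (d.sqrt + 1 + 2) + r ≤ d.sqrt * d.sqrt := by nlinarith
    omega
  have h1 := h _ _ (hc (d.sqrt + 1)) _ hq
  have h2 := lt_two_pow_length_trNat (2 ^ (2 * partialSum f ((d.sqrt + 1) * (d.sqrt + 1))))
  have h3 := (Nat.pow_lt_pow_iff_right one_lt_two).1 h2
  have h4 := le_partialSum f hs2.le
  omega

end Domination

end SizeDriven

/-! ### The main theorem -/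

theorem mainTheorem1 :
    ∃ C : ℝ, 0 < C ∧ ∃ N : ℕ → ℕ,
      (∀ d : ℕ, 3 < d → IsGreatest {n : ℕ | SizeDriven.IsThreshold C d n} (N d)) ∧
      SizeDriven.IsThreshold C 4 2 ∧
      SizeDriven.IsThreshold C 6 15 ∧
      SizeDriven.IsThreshold C 7 84 ∧
      SizeDriven.IsThreshold C 8 420 ∧
      (∀ q : ℕ, (SizeDriven.busyBeaver q : ℝ) / Real.sqrt 2 ≤ (N (q + 4) : ℝ)) ∧
      33 * 10 ^ 6 ≤ N 9 ∧
      52 * 10 ^ 36533 ≤ N 10 ∧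
      (∀ f : ℕ → ℕ, Computable f → ∀ᶠ d in Filter.atTop, f d < N d) := by
  open SizeDriven in
  have hN : ∀ d, 3 < d → IsGreatest {n : ℕ | IsThreshold 2 d n} (sSup {n | IsThreshold 2 d n}) := by
    intro d hd
    have hfin := finite_setOf_isThreshold 2 d
    obtain ⟨c, rfl⟩ : ∃ c, d = c + 2 := ⟨d - 2, by omega⟩
    -- A two-digit counter has threshold 1; it needs two colours, that is, `d > 3`.
    have hne : {n | IsThreshold 2 (c + 2) n}.Nonempty :=
      ⟨1, isThreshold_of_lt_pow (k := 1) le_rfl (by omega) le_rfl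
        (Nat.one_lt_pow (by omega) (by omega))⟩
    exact ⟨Nat.sSup_mem hne hfin.bddAbove, fun n hn => le_csSup hfin.bddAbove hn⟩
  have hlarge : ∀ b, 3 ≤ b →
      2 ^ (b ^ (b + 1) - 1) ≤ sSup {n | SizeDriven.IsThreshold 2 (b + 2 + 2) n} := by
    intro b hb
    obtain ⟨n, hn, hn'⟩ := SizeDriven.exists_isThreshold_two_pow hb
    exact hn.trans ((hN _ (by omega)).2 hn')
  refine ⟨2, two_pos, fun d => sSup {n | SizeDriven.IsThreshold 2 d n}, hN, ?_, ?_, ?_, ?_,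
    fun q => ?_, ?_, ?_, fun f hf => ?_⟩
  · exact SizeDriven.isThreshold_of_lt_pow (c := 2) (k := 1) (by norm_num) (by norm_num)
      (by norm_num) (by norm_num)
  · exact SizeDriven.isThreshold_of_lt_pow (c := 4) (k := 2) (by norm_num) (by norm_num)
      (by norm_num) (by norm_num)
  · exact SizeDriven.isThreshold_of_lt_pow (c := 5) (k := 2) (by norm_num) (by norm_num)
      (by norm_num) (by norm_num)
  · exact SizeDriven.isThreshold_of_lt_pow (c := 6) (k := 3) (by norm_num) (by norm_num)
      (by norm_num) (by norm_num)
  -- The simulation gives the bound without the factor `1/√2`.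
  · have h := SizeDriven.busyBeaver_le_of_isGreatest (hN (q + 4) (by omega))
    refine (div_le_self (Nat.cast_nonneg _) ?_).trans (Nat.cast_le.2 h)
    exact Real.one_le_sqrt.2 one_le_two
  · refine le_trans ?_ (hlarge 5 (by norm_num))
    calc 33 * 10 ^ 6 ≤ 2 ^ 25 := by norm_num
      _ ≤ 2 ^ (5 ^ (5 + 1) - 1) := Nat.pow_le_pow_right two_pos (by norm_num)
  · exact (SizeDriven.mul_ten_pow_le_two_pow (by norm_num)).trans (hlarge 6 (by norm_num))
  · filter_upwards [SizeDriven.eventually_lt_busyBeaver hf 4, Filter.eventually_ge_atTop 4]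
      with d hd hd4
    obtain ⟨q, rfl⟩ : ∃ q, d = q + 4 := ⟨d - 4, by omega⟩
    exact hd.trans_le (SizeDriven.busyBeaver_le_of_isGreatest (hN (q + 4) (by omega)))
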